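/- Let $n\ge 1$ and $0<\alpha\le 2$. There is a constant $C=C_{n,\alpha}$ such that the following holds. Let $(X_t)_{t\ge 0}$ be a rotationally invariant $\alpha$-stable process on $\mathbb{R}^n$, that is, a Lévy process ($X_0=0$ a.s., independent and stationary increments, stochastically continuous) with $\mathbb{E}\,e^{i\xi\cdot X_t}=e^{-t|\xi|^\alpha}$, let $\varphi$ be the (continuous) density of $X_1$, and for $y>0$ let $\varphi_y(x)=y^{-n}\varphi(x/y)$. Let $A(x,y)=(a^{i,j}(x,y))$ be a measurable $(n+1)\times(n+1)$ matrix-valued function (with complex entries) on $\mathbb{R}^n\times(0,\infty)$ with $$\|A\|=\Big\|\sup_{|v|\le 1}|A(x,y)v|\Big\|_{L^\infty(\mathbb{R}^n\times(0,\infty))}<\infty,$$ such that $a^{i,j}(x,y)$ does not depend on $x$ whenever $i=n+1$ or $j=n+1$. With $\nabla=(\partial_{x_1},\dots,\partial_{x_n},\partial_y)$ put $$K_{A,y}(x,\tilde x)=\int_{\mathbb{R}^n}2y\,A(\bar x,y)\nabla\varphi_y(\bar x-\tilde x)\cdot\nabla\varphi_y(\bar x-x)\,d\bar x,\qquad K_A(x,\tilde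 x)=\int_0^\infty K_{A,y}(x,\tilde x)\,dy ,$$ and, for Schwartz functions $f$ on $\mathbb{R}^n$, let $$T_Af(x)=\int_0^\infty\Big(\int_{\mathbb{R}^n}K_{A,y}(x,\tilde x)f(\tilde x)\,d\tilde x\Big)dy .$$ Then the double integral defining $K_A(x,\tilde x)$ converges absolutely for all $x\neq\tilde x$, each of the successive integrals defining $T_Af(x)$ converges absolutely (the inner ones for almost every $y$), and $T_A$ is a Calderón–Zygmund operator with kernel $K_A$ and constant $\kappa=C\|A\|$, that is: 1. $T_A$ is linear and extends to a bounded operator on $L^2(\mathbb{R}^n)$ of norm at most $\kappa$. 2. For all $x\ne\tilde x$, $K_A$ is differentiable in each of its two variables at $(x,\tilde x)$, and $$|K_A(x,\tilde x)|\le\frac{\kappa}{|x-\tilde x|^{n}},\qquad |\nabla_xK_A(x,\tilde x)|\le\frac{\kappa}{|x-\tilde x|^{n+1}},\qquad |\nabla_{\tilde x}K_A(x,\tilde x)|\le\frac{\kappa}{|x-\tilde x|^{n+1}} .$$ 3. For every Schwartz function $f$, $T_Af(x)=\int_{\mathbb{R}^n}K_A(x,\tilde x)f(\tilde x)\,d\tilde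 x$, as an absolutely convergent integral if $x\notin\operatorname{supp}f$, and for every $x$ in the principal value sense up to a bounded multiplier: there are functions $b_\varepsilon:\mathbb{R}^n\to\mathbb{C}$ ($\varepsilon>0$), independent of $f$, with $|b_\varepsilon|\le\kappa$ and $$T_Af(x)=\lim_{\varepsilon\downarrow 0}\Big(\int_{|x-\tilde x|>\varepsilon}K_A(x,\tilde x)f(\tilde x)\,d\tilde x+b_\varepsilon(x)f(x)\Big),$$ where the truncated integrals converge absolutely. -/

import Mathlib

open MeasureTheory ProbabilityTheory Filter Topology Set
open scoped ENNReal NNReal Matrix SchwartzMap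

noncomputable section

namespace StableCZ

/-- A Lévy process on `ℝⁿ`: it starts at `0`, has independent and stationary increments and is
stochastically continuous (at time `0`, hence at every time). -/
structure IsLevyProcess {n : ℕ} {Ω : Type*} [MeasurableSpace Ω]
    (X : ℝ≥0 → Ω → EuclideanSpace ℝ (Fin n)) (P : Measure Ω) : Prop where
  aemeasurable : ∀ t, AEMeasurable (X t) P
  start : ∀ᵐ ω ∂P, X 0 ω = 0
  indep : HasIndepIncrements X P
  stationary : ∀ s t, IdentDistrib (fun ω => X (s + t) ω - X s ω) (fun ω => X t ω - X 0 ω) P P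
  stochCont : ∀ ε : ℝ, 0 < ε → Tendsto (fun t : ℝ≥0 => P {ω | ε < ‖X t ω‖}) (𝓝[>] 0) (𝓝 0)

/-- The rotationally invariant `α`-stable process on `ℝⁿ`: the Lévy process with
`𝔼 exp (i ξ · X_t) = exp (-t |ξ|^α)`. -/
structure IsRotInvStable {n : ℕ} {Ω : Type*} [MeasurableSpace Ω] (α : ℝ)
    (X : ℝ≥0 → Ω → EuclideanSpace ℝ (Fin n)) (P : Measure Ω) : Prop extends
    IsLevyProcess X P where
  charFun_eq : ∀ (t : ℝ≥0) (ξ : EuclideanSpace ℝ (Fin n)),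
    charFun (P.map (X t)) ξ = Complex.exp (-((t : ℝ) * ‖ξ‖ ^ α : ℝ))

/-- `φ` is the continuous version of the density of the random vector `Y`; continuity fixes the
values of `φ` at every point. -/
structure IsContDensity {n : ℕ} {Ω : Type*} [MeasurableSpace Ω]
    (φ : EuclideanSpace ℝ (Fin n) → ℝ) (Y : Ω → EuclideanSpace ℝ (Fin n)) (P : Measure Ω) :
    Prop where
  continuous : Continuous φ
  nonneg : ∀ x, 0 ≤ φ x
  map_eq : P.map Y = volume.withDensity (fun x => ENNReal.ofReal (φ x))

/-- `φ_y(x) = y⁻ⁿ φ(x / y)`. -/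
def dil {n : ℕ} (φ : EuclideanSpace ℝ (Fin n) → ℝ) (y : ℝ) (x : EuclideanSpace ℝ (Fin n)) : ℝ :=
  (y ^ n)⁻¹ * φ (y⁻¹ • x)

/-- The full gradient `(∂_{x_1}, …, ∂_{x_n}, ∂_y)` of `(x, y) ↦ φ_y(x)`, with (complexified)
entries; the last entry is the derivative in `y`. -/
def fullGrad {n : ℕ} (φ : EuclideanSpace ℝ (Fin n) → ℝ) (y : ℝ) (x : EuclideanSpace ℝ (Fin n)) :
    Fin (n + 1) → ℂ :=
  Fin.snoc (α := fun _ => ℂ)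
    (fun i : Fin n => ((fderiv ℝ (dil φ y) x (EuclideanSpace.single i 1) : ℝ) : ℂ))
    ((deriv (fun s : ℝ => dil φ s x) y : ℝ) : ℂ)

/-- Lebesgue measure on the half-space `ℝⁿ × (0, ∞)`. -/
def halfMeasure (n : ℕ) : Measure (EuclideanSpace ℝ (Fin n) × ℝ) :=
  (volume : Measure (EuclideanSpace ℝ (Fin n))).prod (volume.restrict (Ioi (0 : ℝ)))

/-- `‖A‖ = ‖ sup_{|v| ≤ 1} |A(x,y) v| ‖_{L^∞}`: the essential supremum over the half-space of the
Euclidean operator norm of `A(x, y)`. -/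
def coeffNorm {n : ℕ}
    (A : EuclideanSpace ℝ (Fin n) → ℝ → Matrix (Fin (n + 1)) (Fin (n + 1)) ℂ) : ℝ≥0∞ :=
  eLpNorm (fun p : EuclideanSpace ℝ (Fin n) × ℝ =>
    Matrix.toEuclideanCLM (n := Fin (n + 1)) (𝕜 := ℂ) (A p.1 p.2)) ∞ (halfMeasure n)

/-- `2 y A(x̄, y) ∇φ_y(x̄ - x') · ∇φ_y(x̄ - x)`; here `x'` is the second variable of the kernel and
the dot product is bilinear. -/
def kernelIntegrand {n : ℕ} (φ : EuclideanSpace ℝ (Fin n) → ℝ)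
    (A : EuclideanSpace ℝ (Fin n) → ℝ → Matrix (Fin (n + 1)) (Fin (n + 1)) ℂ)
    (x x' xbar : EuclideanSpace ℝ (Fin n)) (y : ℝ) : ℂ :=
  2 * (y : ℂ) * ((A xbar y *ᵥ fullGrad φ y (xbar - x')) ⬝ᵥ fullGrad φ y (xbar - x))

/-- The inner integral over `x̄`, at a fixed height `y`. -/
def sliceKernel {n : ℕ} (φ : EuclideanSpace ℝ (Fin n) → ℝ)
    (A : EuclideanSpace ℝ (Fin n) → ℝ → Matrix (Fin (n + 1)) (Fin (n + 1)) ℂ)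
    (y : ℝ) (x x' : EuclideanSpace ℝ (Fin n)) : ℂ :=
  ∫ xbar, kernelIntegrand φ A x x' xbar y

/-- The kernel `K_A(x, x') = ∫₀^∞ ∫ 2 y A(x̄, y) ∇φ_y(x̄ - x') · ∇φ_y(x̄ - x) dx̄ dy`. -/
def kernelK {n : ℕ} (φ : EuclideanSpace ℝ (Fin n) → ℝ)
    (A : EuclideanSpace ℝ (Fin n) → ℝ → Matrix (Fin (n + 1)) (Fin (n + 1)) ℂ)
    (x x' : EuclideanSpace ℝ (Fin n)) : ℂ :=
  ∫ y in Ioi (0 : ℝ), sliceKernel φ A y x x'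

/-- The operator `T_A` with kernel `K_A`, on Schwartz functions. The kernel is singular on the
diagonal; the integral against `f` is regularised by integrating in `y` last, that is
`T_A f (x) = lim_{δ → 0} ∫ (∫_δ^∞ K_{A,y}(x, x') dy) f(x') dx'`, where `K_{A,y}` is the slice of
the kernel at height `y`. -/
def opT {n : ℕ} (φ : EuclideanSpace ℝ (Fin n) → ℝ)
    (A : EuclideanSpace ℝ (Fin n) → ℝ → Matrix (Fin (n + 1)) (Fin (n + 1)) ℂ)
    (f : 𝓢(EuclideanSpace ℝ (Fin n), ℂ)) (x : EuclideanSpace ℝ (Fin n)) : ℂ :=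
  ∫ y in Ioi (0 : ℝ), ∫ x', sliceKernel φ A y x x' * f x'

/-- `K` satisfies, off the diagonal, the size estimate and the two gradient estimates of a
Calderón–Zygmund kernel with constant `κ`; differentiability is part of the gradient estimates. -/
structure IsCZKernel {n : ℕ}
    (K : EuclideanSpace ℝ (Fin n) → EuclideanSpace ℝ (Fin n) → ℂ) (κ : ℝ) : Prop where
  size : ∀ x x', x ≠ x' → ‖K x x'‖ ≤ κ / ‖x - x'‖ ^ n
  differentiable_fst : ∀ x x', x ≠ x' → DifferentiableAt ℝ (fun z => K z x') x
  differentiable_snd : ∀ x x', x ≠ x' → DifferentiableAt ℝ (fun z => K x z) x'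
  grad_fst : ∀ x x', x ≠ x' → ‖fderiv ℝ (fun z => K z x') x‖ ≤ κ / ‖x - x'‖ ^ (n + 1)
  grad_snd : ∀ x x', x ≠ x' → ‖fderiv ℝ (fun z => K x z) x'‖ ≤ κ / ‖x - x'‖ ^ (n + 1)

/-- `T`, acting on Schwartz functions, is a Calderón–Zygmund operator with kernel `K` and
constant `κ`: it is linear, it has a bounded extension to `L²`, `K` is a Calderón–Zygmund kernel,
and `T f (x) = ∫ K(x, x') f(x') dx'`. The last identity holds as an absolutely convergent integral
if `x` is outside the support of `f`, and for every `x` in the principal value sense. As a kernel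
off the diagonal determines such an operator only up to multiplication by a bounded function (the
identity has kernel `0`, for instance), and as the truncated integrals of a kernel which is not odd
may oscillate boundedly, the principal value is corrected by bounded multiples `b ε x` of `f x`
that do not depend on `f`. -/
structure IsCZOperator {n : ℕ}
    (T : 𝓢(EuclideanSpace ℝ (Fin n), ℂ) → EuclideanSpace ℝ (Fin n) → ℂ)
    (K : EuclideanSpace ℝ (Fin n) → EuclideanSpace ℝ (Fin n) → ℂ) (κ : ℝ) : Prop where
  map_add : ∀ f g x, T (f + g) x = T f x + T g x
  map_smul : ∀ (c : ℂ) f x, T (c • f) x = c * T f x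
  l2_bounded : ∃ S : Lp ℂ 2 (volume : Measure (EuclideanSpace ℝ (Fin n))) →L[ℂ]
      Lp ℂ 2 (volume : Measure (EuclideanSpace ℝ (Fin n))),
    ‖S‖ ≤ κ ∧ ∀ f : 𝓢(EuclideanSpace ℝ (Fin n), ℂ), S (f.toLp 2) =ᵐ[volume] T f
  kernel : IsCZKernel K κ
  off_support : ∀ (f : 𝓢(EuclideanSpace ℝ (Fin n), ℂ)) (x), x ∉ tsupport f →
    Integrable (fun x' => K x x' * f x') ∧ T f x = ∫ x', K x x' * f x'
  truncated_integrable : ∀ (f : 𝓢(EuclideanSpace ℝ (Fin n), ℂ)) (x) (ε : ℝ), 0 < ε →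
    IntegrableOn (fun x' => K x x' * f x') {x' | ε < ‖x - x'‖}
  principal_value : ∃ b : ℝ → EuclideanSpace ℝ (Fin n) → ℂ,
    (∀ ε, 0 < ε → ∀ x, ‖b ε x‖ ≤ κ) ∧
    ∀ (f : 𝓢(EuclideanSpace ℝ (Fin n), ℂ)) (x),
      Tendsto (fun ε : ℝ => (∫ x' in {x' | ε < ‖x - x'‖}, K x x' * f x') + b ε x * f x)
        (𝓝[>] 0) (𝓝 (T f x))

end StableCZ

end

noncomputable section

namespace StableCZ

/-! The gradient of `φ_y` is a dilate `y^(-n-1) Φ(x / y)` of fixed profiles (`fullGrad_eq`), so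
`K_A` is an integral over heights of slices, each a finite sum of terms `compKernel` with one
coefficient and two profiles. All conclusions follow from estimates on slices, collected in
`IsCZSlices`. With `r = |x - x'|` the size bound is `y^(-n-1) (1 + r/y)^(-n-α)` and the gradient
bound has `n + 1` in place of `n`. Integrated in `y` they give `r^(-n)` and `r^(-n-1)`
(`integrableOn_prof`). Each slice has mean zero in `x'`. Against a Hölder function this gains a
power of `y` at small heights, which makes `T_A f` converge and controls the truncated integrals
(`tendsto_truncated`).

For `L²`, the pairing of a slice term with `f` and `g` is `2y ∫ a F_y G_y`, where `F_y` and `G_y`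
are the convolutions of `f` and `g` with the scaled profiles. Cauchy–Schwarz leaves two square
functions. These are bounded by Plancherel because the transforms of the profiles vanish at the
origin and at infinity (`lintegral_compKernel_le`). Only the boundedness of `a` matters here.

The transforms of the profiles are products of linear forms, powers of `|ξ|^α` and `exp(-b|ξ|^α)`.
They are singular at the origin, so the decay of the profiles is limited: `n + l + α` orders for `l`
linear forms (`hasDecay_fourierInv_stab`). A difference with step `h`, `⟨h, x⟩ = 1/2`, multiplies
the inverse transform at `x` by `-2`. High differences of the multiplier are small by Cauchy's
estimate, since `|ξ + t h|²` is a polynomial in `t` and `w^(α/2)` is holomorphic for `Re w > 0`.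

The space profiles have `l = 1`, hence `n + 1 + α` orders of decay, which allows differentiation
inside the slice for any bounded coefficient. For the height profile `l = 0` guarantees only `n +
α`, one order short. This is where the independence of `x` of the last row and column is used: the
slice is then a dilate of the correlation of two profiles, whose multiplier is of the same type, and
its derivative contributes the missing linear form (`IsStableProfile.hasGradBound`). -/

/-- `ℝⁿ` with the Euclidean norm. -/
abbrev Eu (n : ℕ) := EuclideanSpace ℝ (Fin n)

/-! ### The majorant of a slice and its integral over heights -/

/-- The size at height `y` and distance `r` of a kernel slice of homogeneity `-m`, with `δ` orders
of decay to spare. -/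
def prof (m δ r y : ℝ) : ℝ := y ^ (-m - 1) * (1 + r / y) ^ (-(m + δ))

lemma prof_nonneg {m δ r y : ℝ} (hr : 0 ≤ r) (hy : 0 < y) : 0 ≤ prof m δ r y := by
  unfold prof; positivity

lemma prof_anti {m δ r r' y : ℝ} (hm : 0 ≤ m + δ) (hr : 0 ≤ r) (hrr : r ≤ r') (hy : 0 < y) :
    prof m δ r' y ≤ prof m δ r y := by
  unfold prof
  gcongr ?_ * ?_
  apply Real.rpow_le_rpow_of_nonpos (by positivity) (by gcongr) (by linarith)

lemma prof_le_rpow {m δ r y : ℝ} (hm : 0 ≤ m + δ) (hr : 0 ≤ r) (hy : 0 < y) :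
    prof m δ r y ≤ y ^ (-m - 1) := by
  unfold prof
  refine mul_le_of_le_one_right (by positivity) ?_
  apply Real.rpow_le_one_of_one_le_of_nonpos (by linarith [div_nonneg hr hy.le]) (by linarith)

lemma prof_le_near {m δ r y : ℝ} (hm : 0 ≤ m + δ) (hr : 0 < r) (hy : 0 < y) :
    prof m δ r y ≤ y ^ (δ - 1) * r ^ (-(m + δ)) := by
  unfold prof
  have h1 : (1 + r / y) ^ (-(m + δ)) ≤ (r / y) ^ (-(m + δ)) :=
    Real.rpow_le_rpow_of_nonpos (by positivity) (by linarith) (by linarith)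
  calc y ^ (-m - 1) * (1 + r / y) ^ (-(m + δ))
      ≤ y ^ (-m - 1) * (r / y) ^ (-(m + δ)) := by gcongr
    _ = y ^ (δ - 1) * r ^ (-(m + δ)) := by
        rw [Real.div_rpow hr.le hy.le, Real.rpow_neg hy.le, div_inv_eq_mul, mul_comm (r ^ _),
          ← mul_assoc, ← Real.rpow_add hy]
        ring_nf

/-- With `far_le_prof`, a converse of the upper bounds: an estimate proved separately for `y ≤ r`
and for `y ≥ r` becomes one multiple of `prof`, which `integrableOn_prof` then integrates. -/
lemma near_le_prof {m δ r y : ℝ} (hm : 0 ≤ m + δ) (hy : 0 < y) (hyr : y ≤ r) :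
    y ^ (δ - 1) * r ^ (-(m + δ)) ≤ 2 ^ (m + δ) * prof m δ r y := by
  have hr : 0 < r := hy.trans_le hyr
  have h1 : (2 * (r / y)) ^ (-(m + δ)) ≤ (1 + r / y) ^ (-(m + δ)) := by
    apply Real.rpow_le_rpow_of_nonpos (by positivity) _ (by linarith)
    have : 1 ≤ r / y := by rwa [le_div_iff₀ hy, one_mul]
    linarith
  calc y ^ (δ - 1) * r ^ (-(m + δ))
      = 2 ^ (m + δ) * (y ^ (-m - 1) * (2 * (r / y)) ^ (-(m + δ))) := by
        rw [Real.mul_rpow (by norm_num) (by positivity), Real.div_rpow hr.le hy.le,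
          Real.rpow_neg hy.le, div_inv_eq_mul, Real.rpow_neg (by norm_num : (0:ℝ) ≤ 2)]
        have h2 : (2 : ℝ) ^ (m + δ) ≠ 0 := by positivity
        have h3 : y ^ (δ - 1) = y ^ (-m - 1) * y ^ (m + δ) := by
          rw [← Real.rpow_add hy]; ring_nf
        rw [h3]; field_simp
    _ ≤ 2 ^ (m + δ) * prof m δ r y := by unfold prof; gcongr

lemma far_le_prof {m δ r y : ℝ} (hm : 0 ≤ m + δ) (hr : 0 < r) (hy : 0 < y) (hyr : r ≤ y) :
    y ^ (-m - 1) ≤ 2 ^ (m + δ) * prof m δ r y := by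
  have h1 : (2 : ℝ) ^ (-(m + δ)) ≤ (1 + r / y) ^ (-(m + δ)) := by
    apply Real.rpow_le_rpow_of_nonpos (by positivity) _ (by linarith)
    have : r / y ≤ 1 := by rwa [div_le_one hy]
    linarith
  calc y ^ (-m - 1) = 2 ^ (m + δ) * (y ^ (-m - 1) * (2 : ℝ) ^ (-(m + δ))) := by
        rw [Real.rpow_neg (by norm_num : (0:ℝ) ≤ 2)]
        have h2 : (2 : ℝ) ^ (m + δ) ≠ 0 := by positivity
        field_simp
    _ ≤ _ := by unfold prof; gcongr

/-- Split at `y = r`. Below, the spare decay leaves `y^(δ-1)`, integrable at zero; above, `y^(-m-1)`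
is integrable at infinity. Both pieces scale like `r^(-m)`. -/
lemma integrableOn_prof {m δ r : ℝ} (hm : 0 < m) (hδ : 0 < δ) (hr : 0 < r) :
    IntegrableOn (prof m δ r) (Ioi 0) ∧
      ∫ y in Ioi (0 : ℝ), prof m δ r y ≤ (1 / δ + 1 / m) * r ^ (-m) := by
  have hmeas : Measurable (prof m δ r) := by unfold prof; fun_prop
  have hmδ : 0 ≤ m + δ := by linarith
  have e1 : IntegrableOn (fun y : ℝ => y ^ (δ - 1) * r ^ (-(m + δ))) (Ioc 0 r) := by
    have := (intervalIntegral.intervalIntegrable_rpow' (a := 0) (b := r) (r := δ - 1)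
      (by linarith)).mul_const (r ^ (-(m + δ)))
    rwa [intervalIntegrable_iff_integrableOn_Ioc_of_le hr.le] at this
  have e2 : IntegrableOn (fun y : ℝ => y ^ (-m - 1)) (Ioi r) :=
    integrableOn_Ioi_rpow_of_lt (by linarith) hr
  have b1 : ∀ y ∈ Ioc 0 r, prof m δ r y ≤ y ^ (δ - 1) * r ^ (-(m + δ)) := fun y hy =>
    prof_le_near hmδ hr hy.1
  have b2 : ∀ y ∈ Ioi r, prof m δ r y ≤ y ^ (-m - 1) := fun y hy =>
    prof_le_rpow hmδ hr.le (hr.trans hy)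
  have i1 : IntegrableOn (prof m δ r) (Ioc 0 r) := by
    refine e1.mono' hmeas.aestronglyMeasurable
      ((ae_restrict_iff' measurableSet_Ioc).2 (.of_forall ?_))
    intro y hy
    rw [Real.norm_of_nonneg (prof_nonneg hr.le hy.1)]
    exact b1 y hy
  have i2 : IntegrableOn (prof m δ r) (Ioi r) := by
    refine e2.mono' hmeas.aestronglyMeasurable
      ((ae_restrict_iff' measurableSet_Ioi).2 (.of_forall ?_))
    intro y hy
    rw [Real.norm_of_nonneg (prof_nonneg hr.le (hr.trans hy))]
    exact b2 y hy
  have hun : Ioi (0 : ℝ) = Ioc 0 r ∪ Ioi r := (Ioc_union_Ioi_eq_Ioi hr.le).symm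
  refine ⟨by rw [hun]; exact i1.union i2, ?_⟩
  rw [hun, setIntegral_union (Ioc_disjoint_Ioi le_rfl) measurableSet_Ioi i1 i2]
  have c1 : ∫ y in Ioc 0 r, prof m δ r y ≤ 1 / δ * r ^ (-m) := by
    refine (setIntegral_mono_on i1 e1 measurableSet_Ioc b1).trans (le_of_eq ?_)
    rw [integral_mul_const, ← intervalIntegral.integral_of_le hr.le,
      integral_rpow (Or.inl (by linarith))]
    rw [sub_add_cancel, Real.zero_rpow hδ.ne', sub_zero, div_mul_eq_mul_div, ← Real.rpow_add hr]
    ring_nf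
  have c2 : ∫ y in Ioi r, prof m δ r y ≤ 1 / m * r ^ (-m) := by
    refine (setIntegral_mono_on i2 e2 measurableSet_Ioi b2).trans (le_of_eq ?_)
    rw [integral_Ioi_rpow_of_lt (by linarith) hr, sub_add_cancel, neg_div_neg_eq]
    ring
  linarith

/-! ### Space moments of the majorant -/

section Moments

variable {n : ℕ}

lemma integrable_comp_norm_div {N : ℝ} (hN : (n : ℝ) < N) {y : ℝ} (hy : 0 < y) :
    Integrable (fun u : Eu n => (1 + ‖u‖ / y) ^ (-N)) ∧
      ∫ u : Eu n, (1 + ‖u‖ / y) ^ (-N) = y ^ n * ∫ u : Eu n, (1 + ‖u‖) ^ (-N) := by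
  have h : Integrable (fun u : Eu n => (1 + ‖u‖) ^ (-N)) :=
    integrable_one_add_norm (by simpa using hN)
  have e : (fun u : Eu n => (1 + ‖u‖ / y) ^ (-N)) =
      fun u => (fun u : Eu n => (1 + ‖u‖) ^ (-N)) (y⁻¹ • u) := by
    funext u
    simp only [norm_smul, norm_inv, Real.norm_of_nonneg hy.le]
    rw [div_eq_inv_mul]
  rw [e]
  refine ⟨h.comp_smul (inv_ne_zero hy.ne'), ?_⟩
  exact (Measure.integral_comp_inv_smul_of_nonneg volume
    (fun u : Eu n => (1 + ‖u‖) ^ (-N)) hy.le).trans (by simp)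

lemma prof_moment_zero {δ : ℝ} (hδ : 0 < δ) {y : ℝ} (hy : 0 < y) :
    Integrable (fun u : Eu n => prof n δ ‖u‖ y) ∧
      ∫ u : Eu n, prof n δ ‖u‖ y = y⁻¹ * ∫ u : Eu n, (1 + ‖u‖) ^ (-(n + δ)) := by
  obtain ⟨h1, h2⟩ := integrable_comp_norm_div (n := n) (N := n + δ) (by linarith) hy
  unfold prof
  refine ⟨h1.const_mul _, ?_⟩
  rw [integral_const_mul, h2, ← mul_assoc, ← Real.rpow_natCast y n, ← Real.rpow_add hy]
  congr 1
  rw [← Real.rpow_neg_one]; ring_nf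

/-- As `r ≤ y (1 + r/y)`, half of the spare decay pays for a Hölder factor and the other half still
ensures integrability. The factor `y^(δ/2)` is the gain at small heights. -/
lemma prof_mul_rpow_le {m δ r y : ℝ} (hδ : 0 < δ) (hr : 0 ≤ r) (hy : 0 < y) :
    prof m δ r y * r ^ (δ / 2) ≤ y ^ (δ / 2) * prof m (δ / 2) r y := by
  have h0 : 0 < 1 + r / y := by positivity
  have h1 : r ^ (δ / 2) ≤ y ^ (δ / 2) * (1 + r / y) ^ (δ / 2) := by
    rw [← Real.mul_rpow hy.le h0.le]
    apply Real.rpow_le_rpow hr _ (by positivity)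
    rw [mul_add, mul_div_cancel₀ _ hy.ne']; linarith
  calc prof m δ r y * r ^ (δ / 2)
      ≤ prof m δ r y * (y ^ (δ / 2) * (1 + r / y) ^ (δ / 2)) := by
        gcongr; exact prof_nonneg hr hy
    _ = y ^ (δ / 2) * (y ^ (-m - 1) * ((1 + r / y) ^ (-(m + δ)) * (1 + r / y) ^ (δ / 2))) := by
        unfold prof; ring
    _ = _ := by
        rw [← Real.rpow_add h0]; unfold prof; ring_nf

end Moments

/-! ### From slice bounds to a Calderón–Zygmund operator -/

/-- A family of kernel slices `k y`, `y > 0`, with the size, cancellation, gradient and `L²` bounds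
under which `∫₀^∞ k y dy` is a Calderón–Zygmund kernel. -/
structure IsCZSlices {n : ℕ} (k : ℝ → Eu n → Eu n → ℂ) (B δ : ℝ) : Prop where
  nonneg : 0 ≤ B
  measurable : Measurable (fun p : ℝ × Eu n × Eu n => k p.1 p.2.1 p.2.2)
  size : ∀ y, 0 < y → ∀ x x', ‖k y x x'‖ ≤ B * prof n δ ‖x - x'‖ y
  cancel : ∀ y, 0 < y → ∀ x, ∫ x', k y x x' = 0
  diff_fst : ∀ y, 0 < y → ∀ x x', DifferentiableAt ℝ (fun z => k y z x') x
  diff_snd : ∀ y, 0 < y → ∀ x x', DifferentiableAt ℝ (fun z => k y x z) x'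
  grad_fst : ∀ y, 0 < y → ∀ x x',
    ‖fderiv ℝ (fun z => k y z x') x‖ ≤ B * prof (n + 1) δ ‖x - x'‖ y
  grad_snd : ∀ y, 0 < y → ∀ x x',
    ‖fderiv ℝ (fun z => k y x z) x'‖ ≤ B * prof (n + 1) δ ‖x - x'‖ y
  l2 : ∀ (f : 𝓢(Eu n, ℂ)) (g : Eu n → ℂ), Integrable g → MemLp g 2 volume →
    ∫⁻ y in Ioi (0 : ℝ), ‖∫ x, (∫ x', k y x x' * f x') * g x‖ₑ ≤
      ENNReal.ofReal B * eLpNorm f 2 volume * eLpNorm g 2 volume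

section Slices

variable {n : ℕ}

/-- Directional derivatives are limits of difference quotients that are measurable in `y`, and a
linear map on `ℝⁿ` is a finite combination of its values on the basis. -/
lemma aestronglyMeasurable_fderiv_param {q : ℝ → Eu n → ℂ} {s : Set ℝ} (hs : MeasurableSet s)
    (hq : ∀ x, Measurable (fun y => q y x)) {x : Eu n}
    (hd : ∀ y ∈ s, DifferentiableAt ℝ (q y) x) :
    AEStronglyMeasurable (fun y => fderiv ℝ (q y) x) (volume.restrict s) := by
  have happ : ∀ v : Eu n, AEStronglyMeasurable (fun y => fderiv ℝ (q y) x v)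
      (volume.restrict s) := by
    intro v
    refine aestronglyMeasurable_of_tendsto_ae atTop
      (f := fun (m : ℕ) y => (m : ℝ) • (q y (x + (m : ℝ)⁻¹ • v) - q y x)) ?_ ?_
    · intro m
      exact (((hq _).sub (hq _)).const_smul (m : ℝ)).aestronglyMeasurable
    · refine (ae_restrict_iff' hs).2 (.of_forall fun y hy => ?_)
      refine (hd y hy).hasFDerivAt.lim v ?_
      simpa using tendsto_natCast_atTop_atTop (R := ℝ)
  have hdec : (fun y => fderiv ℝ (q y) x) = fun y => ∑ i : Fin n,
      ContinuousLinearMap.smulRightL ℝ (Eu n) ℂ (EuclideanSpace.proj i)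
        (fderiv ℝ (q y) x (EuclideanSpace.single i 1)) := by
    funext y
    ext v
    simp only [sum_apply, ContinuousLinearMap.smulRightL_apply_apply]
    conv_lhs => rw [← (EuclideanSpace.basisFun (Fin n) ℝ).sum_repr v]
    simp [map_sum]
  rw [hdec]
  refine Finset.aestronglyMeasurable_fun_sum _ fun i _ => ?_
  exact (ContinuousLinearMap.continuous _).comp_aestronglyMeasurable (happ _)

/-- Differentiation under the height integral. On the ball of radius `|x - c| / 2` about `x` the
distance to the pole `c` is at least `|x - c| / 2`, so `prof` at that distance dominates. The other
variable is frozen as `c`, so the lemma serves both gradients. -/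
lemma differentiableAt_integral_slices {q : ℝ → Eu n → ℂ} {c : Eu n} {B δ : ℝ} (hn : 1 ≤ n)
    (hδ : 0 < δ) (hB : 0 ≤ B) (hq : ∀ x, Measurable (fun y => q y x))
    (hsize : ∀ y, 0 < y → ∀ x, ‖q y x‖ ≤ B * prof n δ ‖x - c‖ y)
    (hd : ∀ y, 0 < y → ∀ x, DifferentiableAt ℝ (q y) x)
    (hg : ∀ y, 0 < y → ∀ x, ‖fderiv ℝ (q y) x‖ ≤ B * prof (n + 1) δ ‖x - c‖ y)
    {x : Eu n} (hx : x ≠ c) :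
    DifferentiableAt ℝ (fun z => ∫ y in Ioi (0 : ℝ), q y z) x ∧
      ‖fderiv ℝ (fun z => ∫ y in Ioi (0 : ℝ), q y z) x‖ ≤
        B * ((1 / δ + 1 / (n + 1)) * ‖x - c‖ ^ (-((n : ℝ) + 1))) := by
  have hn' : (0 : ℝ) < n := by exact_mod_cast hn
  have hr : 0 < ‖x - c‖ := norm_pos_iff.2 (sub_ne_zero.2 hx)
  have hpos : ∀ᵐ y ∂(volume.restrict (Ioi (0 : ℝ))), 0 < y :=
    ae_restrict_mem measurableSet_Ioi
  have hprof := integrableOn_prof hn' hδ hr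
  have hprof1 := integrableOn_prof (m := n + 1) (by positivity) hδ hr
  have hprof2 := integrableOn_prof (m := n + 1) (by positivity) hδ (half_pos hr)
  have key : HasFDerivAt (fun z => ∫ y in Ioi (0 : ℝ), q y z)
      (∫ y in Ioi (0 : ℝ), fderiv ℝ (q y) x) x := by
    refine hasFDerivAt_integral_of_dominated_of_fderiv_le (F' := fun z y => fderiv ℝ (q y) z)
      (bound := fun y => B * prof (n + 1) δ (‖x - c‖ / 2) y)
      (Metric.ball_mem_nhds x (half_pos hr))
      (.of_forall fun z => (hq z).aestronglyMeasurable) ?_ ?_ ?_ ?_ ?_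
    · refine (hprof.1.const_mul B).mono' (hq x).aestronglyMeasurable ?_
      filter_upwards [hpos] with y hy using hsize y hy x
    · exact aestronglyMeasurable_fderiv_param measurableSet_Ioi hq fun y hy => hd y hy x
    · filter_upwards [hpos] with y hy z hz
      refine (hg y hy z).trans ?_
      gcongr
      refine prof_anti (by positivity) (by positivity) ?_ hy
      rw [Metric.mem_ball, dist_eq_norm] at hz
      have : ‖x - c‖ ≤ ‖z - x‖ + ‖z - c‖ := by
        rw [← norm_neg (z - x)]
        refine le_trans (le_of_eq ?_) (norm_add_le _ _)
        congr 1; abel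
      linarith
    · exact hprof2.1.const_mul B
    · filter_upwards [hpos] with y hy z _ using (hd y hy z).hasFDerivAt
  refine ⟨key.differentiableAt, ?_⟩
  rw [key.fderiv]
  calc ‖∫ y in Ioi (0 : ℝ), fderiv ℝ (q y) x‖
      ≤ ∫ y in Ioi (0 : ℝ), B * prof (n + 1) δ ‖x - c‖ y := by
        refine norm_integral_le_of_norm_le (hprof1.1.const_mul B) ?_
        filter_upwards [hpos] with y hy using hg y hy x
    _ ≤ _ := by
        rw [integral_const_mul]
        exact mul_le_mul_of_nonneg_left hprof1.2 hB

/-- The Lipschitz bound at distance at most `1` and boundedness beyond. It is applied with `s = δ /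
2`, which is why `δ ≤ 2` is assumed later. -/
lemma exists_holder_bound (f : 𝓢(Eu n, ℂ)) {s : ℝ} (hs0 : 0 ≤ s) (hs : s ≤ 1) :
    ∃ L, 0 ≤ L ∧ ∀ x x', ‖f x' - f x‖ ≤ L * ‖x - x'‖ ^ s := by
  obtain ⟨S, hS⟩ : ∃ S, ∀ x, ‖f x‖ ≤ S := ⟨_, fun x => SchwartzMap.norm_le_seminorm ℝ f x⟩
  obtain ⟨K, hK⟩ : ∃ K, ∀ x, ‖fderiv ℝ f x‖ ≤ K := by
    obtain ⟨K, hK⟩ := f.decay 0 1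
    exact ⟨K, fun x => by simpa [norm_iteratedFDeriv_one] using hK.2 x⟩
  have hS0 : 0 ≤ S := (norm_nonneg _).trans (hS 0)
  have hK0 : 0 ≤ K := (norm_nonneg _).trans (hK 0)
  refine ⟨2 * S + K, by positivity, fun x x' => ?_⟩
  have h1 : ‖f x' - f x‖ ≤ K * ‖x - x'‖ := by
    have := convex_univ.norm_image_sub_le_of_norm_fderiv_le (𝕜 := ℝ) (f := f) (x := x) (y := x')
      (fun z _ => f.differentiable.differentiableAt) (fun z _ => hK z) trivial trivial
    rwa [norm_sub_rev x x']
  have h2 : ‖f x' - f x‖ ≤ 2 * S := by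
    linarith [norm_sub_le (f x') (f x), hS x, hS x']
  rcases le_total ‖x - x'‖ 1 with h | h
  · have : ‖x - x'‖ ≤ ‖x - x'‖ ^ s := by
      rcases eq_or_lt_of_le (norm_nonneg (x - x')) with h0 | h0
      · rw [← h0]; positivity
      · conv_lhs => rw [← Real.rpow_one ‖x - x'‖]
        exact Real.rpow_le_rpow_of_exponent_ge h0 h hs
    have h3 : (0 : ℝ) ≤ ‖x - x'‖ ^ s := by positivity
    nlinarith
  · have : 1 ≤ ‖x - x'‖ ^ s := Real.one_le_rpow h hs0
    nlinarith

end Slices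

namespace IsCZSlices

variable {n : ℕ} {k : ℝ → Eu n → Eu n → ℂ} {B δ : ℝ}

lemma measurable_snd (hk : IsCZSlices k B δ) (y : ℝ) (x : Eu n) : Measurable (k y x) :=
  hk.measurable.comp (f := fun x' => (y, x, x')) (by fun_prop)

lemma integrable_prof_sub (hδ : 0 < δ) {y : ℝ} (hy : 0 < y) (x : Eu n) :
    Integrable (fun x' => prof n δ ‖x - x'‖ y) :=
  (prof_moment_zero hδ hy).1.comp_sub_left x

lemma integrable (hk : IsCZSlices k B δ) (hδ : 0 < δ) {y : ℝ} (hy : 0 < y) (x : Eu n) :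
    Integrable (k y x) :=
  ((integrable_prof_sub hδ hy x).const_mul B).mono' (hk.measurable_snd y x).aestronglyMeasurable
    (.of_forall fun x' => hk.size y hy x x')

lemma size_le (hk : IsCZSlices k B δ) (hδ : 0 < δ) {y : ℝ} (hy : 0 < y) (x x' : Eu n) :
    ‖k y x x'‖ ≤ B * y ^ (-(n : ℝ) - 1) :=
  (hk.size y hy x x').trans
    (mul_le_mul_of_nonneg_left (prof_le_rpow (by positivity) (norm_nonneg _) hy) hk.nonneg)

lemma integrable_mul (hk : IsCZSlices k B δ) (hδ : 0 < δ) {y : ℝ} (hy : 0 < y) (x : Eu n)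
    {h : Eu n → ℂ} (hh : Integrable h) : Integrable (fun x' => k y x x' * h x') :=
  hh.bdd_mul (hk.measurable_snd y x).aestronglyMeasurable
    (.of_forall fun x' => hk.size_le hδ hy x x')

lemma integrableOn_kernel (hk : IsCZSlices k B δ) (hn : 1 ≤ n) (hδ : 0 < δ) {x x' : Eu n}
    (hx : x ≠ x') : IntegrableOn (fun y => k y x x') (Ioi 0) ∧
      ‖∫ y in Ioi (0 : ℝ), k y x x'‖ ≤ B * ((1 / δ + 1 / n) * ‖x - x'‖ ^ (-(n : ℝ))) := by
  have hn' : (0 : ℝ) < n := by exact_mod_cast hn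
  have hr : 0 < ‖x - x'‖ := norm_pos_iff.2 (sub_ne_zero.2 hx)
  have hprof := integrableOn_prof hn' hδ hr
  have hb : ∀ᵐ y ∂(volume.restrict (Ioi (0 : ℝ))), ‖k y x x'‖ ≤ B * prof n δ ‖x - x'‖ y := by
    filter_upwards [ae_restrict_mem measurableSet_Ioi] with y hy using hk.size y hy x x'
  refine ⟨(hprof.1.const_mul B).mono'
    (hk.measurable.comp (f := fun y => (y, x, x')) (by fun_prop)).aestronglyMeasurable hb, ?_⟩
  refine (norm_integral_le_of_norm_le (hprof.1.const_mul B) hb).trans ?_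
  rw [integral_const_mul]
  exact mul_le_mul_of_nonneg_left hprof.2 hk.nonneg

/-- Fubini's theorem for the slices against a function that vanishes near `x`. -/
lemma integral_swap_of_far (hk : IsCZSlices k B δ) (hn : 1 ≤ n) (hδ : 0 < δ) {x : Eu n} {r : ℝ}
    (hr : 0 < r) {h : Eu n → ℂ} (hh : Integrable h) (hfar : ∀ x', ‖x - x'‖ < r → h x' = 0) :
    Integrable (fun x' => (∫ y in Ioi (0 : ℝ), k y x x') * h x') ∧
    IntegrableOn (fun y => ∫ x', k y x x' * h x') (Ioi 0) ∧
      ∫ y in Ioi (0 : ℝ), ∫ x', k y x x' * h x' =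
        ∫ x', (∫ y in Ioi (0 : ℝ), k y x x') * h x' := by
  have hn' : (0 : ℝ) < n := by exact_mod_cast hn
  have hprod : Integrable (fun p : ℝ × Eu n => k p.1 x p.2 * h p.2)
      ((volume.restrict (Ioi (0 : ℝ))).prod volume) := by
    refine (((integrableOn_prof hn' hδ hr).1.const_mul B).mul_prod hh.norm).mono' ?_ ?_
    · exact (hk.measurable.comp (f := fun p : ℝ × Eu n => (p.1, x, p.2))
        (by fun_prop)).aestronglyMeasurable.mul hh.aestronglyMeasurable.comp_snd
    · have : ∀ᵐ p ∂((volume.restrict (Ioi (0 : ℝ))).prod (volume : Measure (Eu n))), 0 < p.1 :=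
        Measure.quasiMeasurePreserving_fst.ae (ae_restrict_mem measurableSet_Ioi)
      filter_upwards [this] with p hp
      rw [norm_mul]
      by_cases hz : ‖x - p.2‖ < r
      · simp [hfar _ hz]
      · gcongr
        refine (hk.size _ hp _ _).trans ?_
        have := hk.nonneg
        gcongr
        exact prof_anti (by positivity) hr.le (not_lt.1 hz) hp
  have hmul : ∀ x', ∫ y in Ioi (0 : ℝ), k y x x' * h x' = (∫ y in Ioi (0 : ℝ), k y x x') * h x' :=
    fun x' => integral_mul_const _ _
  refine ⟨?_, hprod.integral_prod_left, ?_⟩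
  · simpa only [hmul] using hprod.integral_prod_right
  · rw [integral_integral_swap hprod]
    simp only [hmul]

/-- The constant in the Hölder moment bound for slices. -/
lemma holder_bound (hk : IsCZSlices k B δ) (hδ : 0 < δ) {y : ℝ} (hy : 0 < y) (x : Eu n)
    {h : Eu n → ℂ} {L : ℝ} (hL : 0 ≤ L) (hh : ∀ x', ‖h x'‖ ≤ L * ‖x - x'‖ ^ (δ / 2))
    (s : Set (Eu n)) :
    ‖∫ x' in s, k y x x' * h x'‖ ≤
      B * L * (y ^ (δ / 2 - 1) * ∫ u : Eu n, (1 + ‖u‖) ^ (-(n + δ / 2))) := by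
  have hB := hk.nonneg
  obtain ⟨i1, i2⟩ := prof_moment_zero (n := n) (half_pos hδ) hy
  have i3 : Integrable (fun x' => B * L * (y ^ (δ / 2) * prof n (δ / 2) ‖x - x'‖ y)) :=
    ((integrable_prof_sub (half_pos hδ) hy x).const_mul _).const_mul _
  calc ‖∫ x' in s, k y x x' * h x'‖
      ≤ ∫ x' in s, B * L * (y ^ (δ / 2) * prof n (δ / 2) ‖x - x'‖ y) := by
        refine norm_integral_le_of_norm_le i3.integrableOn (.of_forall fun x' => ?_)
        rw [norm_mul]
        have h1 : 0 ≤ prof n δ ‖x - x'‖ y := prof_nonneg (norm_nonneg _) hy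
        calc ‖k y x x'‖ * ‖h x'‖ ≤ (B * prof n δ ‖x - x'‖ y) * (L * ‖x - x'‖ ^ (δ / 2)) :=
              mul_le_mul (hk.size y hy x x') (hh x') (norm_nonneg _) (by positivity)
          _ = B * L * (prof n δ ‖x - x'‖ y * ‖x - x'‖ ^ (δ / 2)) := by ring
          _ ≤ _ := by
              gcongr ?_ * ?_
              exact prof_mul_rpow_le hδ (norm_nonneg _) hy
    _ ≤ ∫ x', B * L * (y ^ (δ / 2) * prof n (δ / 2) ‖x - x'‖ y) := by
        refine setIntegral_le_integral i3 (.of_forall fun x' => ?_)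
        have := prof_nonneg (m := n) (δ := δ / 2) (norm_nonneg (x - x')) hy
        positivity
    _ = _ := by
        rw [integral_const_mul, integral_const_mul,
          integral_sub_left_eq_self (fun u : Eu n => prof n (δ / 2) ‖u‖ y) volume x, i2,
          ← mul_assoc (y ^ (δ / 2)), Real.rpow_sub_one hy.ne']
        ring_nf

end IsCZSlices

namespace IsCZSlices

variable {n : ℕ} {k : ℝ → Eu n → Eu n → ℂ} {B δ : ℝ}

/-- For `y ≤ 1` the mean-zero property replaces `f x'` by `f x' - f x`, and Hölder continuity gives
`y^(δ/2 - 1)`. For `y ≥ 1` the sup bound `y^(-n-1)` of the slice meets `f ∈ L¹`. The result is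
integrable in `y` uniformly in `x`. -/
lemma exists_slice_bound (hk : IsCZSlices k B δ) (hδ : 0 < δ) (hδ2 : δ ≤ 2) (f : 𝓢(Eu n, ℂ)) :
    ∃ D, ∀ y, 0 < y → ∀ x, ‖∫ x', k y x x' * f x'‖ ≤ D * prof n (δ / 2) 1 y := by
  obtain ⟨L, hL, hf⟩ := exists_holder_bound f (s := δ / 2) (by positivity) (by linarith)
  have hB := hk.nonneg
  set c := ∫ u : Eu n, (1 + ‖u‖) ^ (-(n + δ / 2)) with hc
  have hc0 : 0 ≤ c := integral_nonneg fun u => by positivity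
  set I := ∫ x, ‖f x‖ with hI
  have hI0 : 0 ≤ I := integral_nonneg fun u => by positivity
  have hfi : Integrable f := f.integrable
  refine ⟨(B * L * c + B * I) * 2 ^ (n + δ / 2), fun y hy x => ?_⟩
  have hp := prof_nonneg (m := n) (δ := δ / 2) zero_le_one hy
  rcases le_total y 1 with h | h
  · have e : ∫ x', k y x x' * f x' = ∫ x' in univ, k y x x' * (f x' - f x) := by
      simp only [mul_sub, setIntegral_univ]
      rw [integral_sub (hk.integrable_mul hδ hy x hfi) ((hk.integrable hδ hy x).mul_const _),
        integral_mul_const, hk.cancel y hy, zero_mul, sub_zero]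
    rw [e]
    refine (hk.holder_bound hδ hy x hL (fun x' => hf x x') univ).trans ?_
    have := near_le_prof (m := n) (δ := δ / 2) (by positivity) hy h
    rw [Real.one_rpow, mul_one] at this
    calc B * L * (y ^ (δ / 2 - 1) * c) = B * L * c * y ^ (δ / 2 - 1) := by ring
      _ ≤ B * L * c * (2 ^ (n + δ / 2) * prof n (δ / 2) 1 y) := by gcongr
      _ ≤ _ := by
        have : 0 ≤ B * I * (2 ^ (n + δ / 2) * prof n (δ / 2) 1 y) := by positivity
        linarith
  · have : ‖∫ x', k y x x' * f x'‖ ≤ ∫ x', B * y ^ (-(n : ℝ) - 1) * ‖f x'‖ := by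
      refine norm_integral_le_of_norm_le (hfi.norm.const_mul _) (.of_forall fun x' => ?_)
      rw [norm_mul]
      gcongr
      exact hk.size_le hδ hy x x'
    rw [integral_const_mul] at this
    refine this.trans ?_
    have h2 := far_le_prof (m := n) (δ := δ / 2) (by positivity) one_pos hy h
    calc B * y ^ (-(n : ℝ) - 1) * I = B * I * y ^ (-(n : ℝ) - 1) := by ring
      _ ≤ B * I * (2 ^ (n + δ / 2) * prof n (δ / 2) 1 y) := by gcongr
      _ ≤ _ := by
        have : 0 ≤ B * L * c * (2 ^ (n + δ / 2) * prof n (δ / 2) 1 y) := by positivity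
        linarith

lemma stronglyMeasurable_slice_integral (hk : IsCZSlices k B δ) {h : Eu n → ℂ} (hh : Measurable h)
    {s : Set (Eu n)} :
    StronglyMeasurable (fun p : ℝ × Eu n => ∫ x' in s, k p.1 p.2 x' * h x') := by
  refine StronglyMeasurable.integral_prod_right
    (f := fun (p : ℝ × Eu n) x' => k p.1 p.2 x' * h x') (ν := volume.restrict s) ?_
  refine Measurable.stronglyMeasurable ?_
  refine Measurable.mul ?_ (hh.comp _root_.measurable_snd)
  exact hk.measurable.comp (f := fun p : (ℝ × Eu n) × Eu n => (p.1.1, p.1.2, p.2)) (by fun_prop)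

lemma integrableOn_slice_integral (hk : IsCZSlices k B δ) (hn : 1 ≤ n) (hδ : 0 < δ) (hδ2 : δ ≤ 2)
    (f : 𝓢(Eu n, ℂ)) (x : Eu n) : IntegrableOn (fun y => ∫ x', k y x x' * f x') (Ioi 0) := by
  obtain ⟨D, hD⟩ := hk.exists_slice_bound hδ hδ2 f
  refine ((integrableOn_prof (m := n) (by exact_mod_cast hn) (half_pos hδ) one_pos).1.const_mul
    D).mono' ?_ ?_
  · have := hk.stronglyMeasurable_slice_integral f.continuous.measurable (s := univ)
    simp only [setIntegral_univ] at this
    exact (this.comp_measurable (g := fun y => (y, x)) (by fun_prop)).aestronglyMeasurable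
  · filter_upwards [ae_restrict_mem measurableSet_Ioi] with y hy using hD y hy x

lemma compl_eq_closedBall (x : Eu n) (ε : ℝ) : {x' | ε < ‖x - x'‖}ᶜ = Metric.closedBall x ε := by
  ext z
  simp [dist_eq_norm, norm_sub_rev]

lemma measurableSet_far (x : Eu n) (ε : ℝ) : MeasurableSet {x' | ε < ‖x - x'‖} :=
  measurableSet_lt measurable_const (by fun_prop)

lemma near_bound (hk : IsCZSlices k B δ) (hδ : 0 < δ) {y : ℝ} (hy : 0 < y) (x : Eu n)
    {h : Eu n → ℂ} {D : ℝ} (hD : ∀ x', ‖h x'‖ ≤ D) {ε : ℝ} (hε : 0 < ε) :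
    ‖∫ x' in {x' | ε < ‖x - x'‖}ᶜ, k y x x' * h x'‖ ≤
      B * y ^ (-(n : ℝ) - 1) * D * (ε ^ n * volume.real (Metric.ball (0 : Eu n) 1)) := by
  have hB := hk.nonneg
  have hvol : volume.real (Metric.closedBall x ε) =
      ε ^ n * volume.real (Metric.ball (0 : Eu n) 1) := by
    simpa using Measure.addHaar_real_closedBall (volume : Measure (Eu n)) x hε.le
  rw [← hvol, compl_eq_closedBall]
  refine norm_setIntegral_le_of_norm_le_const measure_closedBall_lt_top fun x' _ => ?_
  rw [norm_mul]
  exact mul_le_mul (hk.size_le hδ hy x x') (hD x') (norm_nonneg _) (by positivity)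

/-- The multiplier that corrects the truncated integrals. -/
def corr (k : ℝ → Eu n → Eu n → ℂ) (ε : ℝ) (x : Eu n) : ℂ :=
  ∫ y in Ioi (0 : ℝ), ∫ z in {z | ε < ‖x - z‖}ᶜ, k y x z

/-- The constant that bounds the correction multiplier. -/
def corrConst (n : ℕ) (δ : ℝ) : ℝ :=
  ((∫ u : Eu n, (1 + ‖u‖) ^ (-(n + δ / 2))) + volume.real (Metric.ball (0 : Eu n) 1)) *
    2 ^ (n + δ / 2) * (1 / (δ / 2) + 1 / n)

/-- At heights above `ε` the slice is at most a multiple of `y^(-n-1)` and the ball has volume of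
order `ε^n`. Below `ε`, the mean-zero property turns the integral over the ball into minus the
integral over its complement, where the slice is already in its tail. The two regimes scale alike,
so the bound does not depend on `ε`. -/
lemma corr_bound (hk : IsCZSlices k B δ) (hn : 1 ≤ n) (hδ : 0 < δ) {ε : ℝ} (hε : 0 < ε)
    (x : Eu n) :
    IntegrableOn (fun y => ∫ x' in {x' | ε < ‖x - x'‖}ᶜ, k y x x') (Ioi 0) ∧
      ‖corr k ε x‖ ≤ B * corrConst n δ := by
  have hn' : (0 : ℝ) < n := by exact_mod_cast hn
  have hB := hk.nonneg
  set c := ∫ u : Eu n, (1 + ‖u‖) ^ (-(n + δ / 2)) with hc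
  have hc0 : 0 ≤ c := integral_nonneg fun u => by positivity
  set v := volume.real (Metric.ball (0 : Eu n) 1) with hv
  have hv0 : 0 ≤ v := measureReal_nonneg
  have hb : ∀ y, 0 < y → ‖∫ x' in {x' | ε < ‖x - x'‖}ᶜ, k y x x'‖ ≤
      B * (c + v) * 2 ^ (n + δ / 2) * ε ^ n * prof n (δ / 2) ε y := by
    intro y hy
    have hp := prof_nonneg (m := n) (δ := δ / 2) hε.le hy
    rcases le_total y ε with h | h
    · have hsum := integral_add_compl (measurableSet_far x ε) (hk.integrable hδ hy x)
      rw [hk.cancel y hy] at hsum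
      rw [eq_neg_of_add_eq_zero_right hsum, norm_neg]
      -- The indicator of the far region is at most `ε^(-δ/2) |x - x'|^(δ/2)`, so it can play the
      -- Hölder function in `holder_bound`.
      have e : ∫ x' in {x' | ε < ‖x - x'‖}, k y x x' =
          ∫ x' in {x' | ε < ‖x - x'‖}, k y x x' *
            ({x' | ε < ‖x - x'‖}.indicator (fun _ => (1 : ℂ)) x') := by
        refine setIntegral_congr_fun (measurableSet_far x ε) fun x' hx' => ?_
        simp only [indicator_of_mem hx', mul_one]
      rw [e]
      refine (hk.holder_bound hδ hy x (L := ε ^ (-(δ / 2))) (by positivity)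
        (fun x' => ?_) _).trans ?_
      · by_cases hx' : ε < ‖x - x'‖
        · rw [indicator_of_mem (by exact hx'), norm_one, Real.rpow_neg hε.le, ← div_eq_inv_mul,
            ← Real.div_rpow (norm_nonneg _) hε.le]
          refine Real.one_le_rpow ?_ (by positivity)
          rw [le_div_iff₀ hε, one_mul]; exact hx'.le
        · rw [indicator_of_notMem (by exact hx'), norm_zero]; positivity
      · have h1 := near_le_prof (m := n) (δ := δ / 2) (by positivity) hy h
        have h2 : ε ^ (-(δ / 2)) = ε ^ n * ε ^ (-(n + δ / 2)) := by
          rw [← Real.rpow_natCast ε n, ← Real.rpow_add hε]; ring_nf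
        calc B * ε ^ (-(δ / 2)) * (y ^ (δ / 2 - 1) * c)
            = B * c * ε ^ n * (y ^ (δ / 2 - 1) * ε ^ (-(n + δ / 2))) := by rw [h2]; ring
          _ ≤ B * c * ε ^ n * (2 ^ (n + δ / 2) * prof n (δ / 2) ε y) := by gcongr
          _ ≤ _ := by
            have : 0 ≤ B * v * ε ^ n * (2 ^ (n + δ / 2) * prof n (δ / 2) ε y) := by positivity
            linarith
    · have := hk.near_bound hδ hy x (h := fun _ => 1) (D := 1) (by simp) hε
      simp only [mul_one] at this
      refine this.trans ?_
      have h2 := far_le_prof (m := n) (δ := δ / 2) (by positivity) hε hy h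
      calc B * y ^ (-(n : ℝ) - 1) * (ε ^ n * v) = B * v * ε ^ n * y ^ (-(n : ℝ) - 1) := by ring
        _ ≤ B * v * ε ^ n * (2 ^ (n + δ / 2) * prof n (δ / 2) ε y) := by gcongr
        _ ≤ _ := by
          have : 0 ≤ B * c * ε ^ n * (2 ^ (n + δ / 2) * prof n (δ / 2) ε y) := by positivity
          linarith
  have hprof := integrableOn_prof hn' (half_pos hδ) hε
  have hae : ∀ᵐ y ∂(volume.restrict (Ioi (0 : ℝ))),
      ‖∫ x' in {x' | ε < ‖x - x'‖}ᶜ, k y x x'‖ ≤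
        B * (c + v) * 2 ^ (n + δ / 2) * ε ^ n * prof n (δ / 2) ε y := by
    filter_upwards [ae_restrict_mem measurableSet_Ioi] with y hy using hb y hy
  refine ⟨(hprof.1.const_mul _).mono' ?_ hae, ?_⟩
  · have := hk.stronglyMeasurable_slice_integral (h := fun _ => 1) measurable_const
      (s := {x' | ε < ‖x - x'‖}ᶜ)
    simp only [mul_one] at this
    exact (this.comp_measurable (g := fun y => (y, x)) (by fun_prop)).aestronglyMeasurable
  · refine (norm_integral_le_of_norm_le (hprof.1.const_mul _) hae).trans ?_
    rw [integral_const_mul]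
    calc B * (c + v) * 2 ^ (n + δ / 2) * ε ^ n * ∫ y in Ioi (0 : ℝ), prof n (δ / 2) ε y
        ≤ B * (c + v) * 2 ^ (n + δ / 2) * ε ^ n *
            ((1 / (δ / 2) + 1 / n) * ε ^ (-(n : ℝ))) := by
          gcongr; exact hprof.2
      _ = B * corrConst n δ * (ε ^ n * ε ^ (-(n : ℝ))) := by
          rw [corrConst, ← hc, ← hv]; ring
      _ = _ := by
          rw [Real.rpow_neg hε.le, Real.rpow_natCast, mul_inv_cancel₀ (by positivity), mul_one]

/-- Splitting each slice integral at distance `ε`, and `f x'` near `x` into `f x` plus a difference,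
gives the truncated integral, the correction `corr k ε x * f x`, and the near integral of `k y x x'
* (f x' - f x)`. The last tends to zero at every height because the ball shrinks. The bounds of
`exists_slice_bound`, which hold for it too, dominate it in `y`. -/
lemma tendsto_truncated (hk : IsCZSlices k B δ) (hn : 1 ≤ n) (hδ : 0 < δ) (hδ2 : δ ≤ 2)
    (f : 𝓢(Eu n, ℂ)) (x : Eu n) :
    Tendsto (fun ε : ℝ => (∫ x' in {x' | ε < ‖x - x'‖},
        (∫ y in Ioi (0 : ℝ), k y x x') * f x') + corr k ε x * f x)
      (𝓝[>] 0) (𝓝 (∫ y in Ioi (0 : ℝ), ∫ x', k y x x' * f x')) := by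
  have hn' : (0 : ℝ) < n := by exact_mod_cast hn
  have hB := hk.nonneg
  have hfi : Integrable f := f.integrable
  obtain ⟨L, hL, hf⟩ := exists_holder_bound f (s := δ / 2) (by positivity) (by linarith)
  obtain ⟨S, hS⟩ : ∃ S, ∀ x, ‖f x‖ ≤ S := ⟨_, fun x => SchwartzMap.norm_le_seminorm ℝ f x⟩
  have hS0 : 0 ≤ S := (norm_nonneg _).trans (hS 0)
  have hS2 : ∀ x', ‖f x' - f x‖ ≤ 2 * S := fun x' => by
    linarith [norm_sub_le (f x') (f x), hS x, hS x']
  set c := ∫ u : Eu n, (1 + ‖u‖) ^ (-(n + δ / 2)) with hc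
  have hc0 : 0 ≤ c := integral_nonneg fun u => by positivity
  set v := volume.real (Metric.ball (0 : Eu n) 1) with hv
  have hv0 : 0 ≤ v := measureReal_nonneg
  have hpos : ∀ᵐ y ∂(volume.restrict (Ioi (0 : ℝ))), 0 < y := ae_restrict_mem measurableSet_Ioi
  have key : Tendsto (fun ε : ℝ => ∫ y in Ioi (0 : ℝ), ∫ x' in {x' | ε < ‖x - x'‖}ᶜ,
      k y x x' * (f x' - f x)) (𝓝[>] 0) (𝓝 (∫ y in Ioi (0 : ℝ), (0 : ℂ))) := by
    refine tendsto_integral_filter_of_dominated_convergence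
      (fun y => (B * L * c + B * (2 * S) * v) * 2 ^ (n + δ / 2) * prof n (δ / 2) 1 y)
      ?_ ?_ ?_ ?_
    · refine .of_forall fun ε => ?_
      have := hk.stronglyMeasurable_slice_integral (h := fun x' => f x' - f x)
        (f.continuous.measurable.sub measurable_const) (s := {x' | ε < ‖x - x'‖}ᶜ)
      exact (this.comp_measurable (g := fun y => (y, x)) (by fun_prop)).aestronglyMeasurable
    · filter_upwards [Ioc_mem_nhdsGT (zero_lt_one (α := ℝ))] with ε hε
      filter_upwards [hpos] with y hy
      have hp := prof_nonneg (m := n) (δ := δ / 2) zero_le_one hy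
      rcases le_total y 1 with h | h
      · refine (hk.holder_bound hδ hy x hL (fun x' => hf x x') _).trans ?_
        have := near_le_prof (m := n) (δ := δ / 2) (by positivity) hy h
        rw [Real.one_rpow, mul_one] at this
        calc B * L * (y ^ (δ / 2 - 1) * c) = B * L * c * y ^ (δ / 2 - 1) := by ring
          _ ≤ B * L * c * (2 ^ (n + δ / 2) * prof n (δ / 2) 1 y) := by gcongr
          _ ≤ _ := by
            have : 0 ≤ B * (2 * S) * v * (2 ^ (n + δ / 2) * prof n (δ / 2) 1 y) := by positivity
            linarith
      · refine (hk.near_bound hδ hy x hS2 hε.1).trans ?_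
        have h2 := far_le_prof (m := n) (δ := δ / 2) (by positivity) one_pos hy h
        have h3 : ε ^ n ≤ 1 := pow_le_one₀ hε.1.le hε.2
        calc B * y ^ (-(n : ℝ) - 1) * (2 * S) * (ε ^ n * v)
            ≤ B * y ^ (-(n : ℝ) - 1) * (2 * S) * (1 * v) := by gcongr
          _ = B * (2 * S) * v * y ^ (-(n : ℝ) - 1) := by ring
          _ ≤ B * (2 * S) * v * (2 ^ (n + δ / 2) * prof n (δ / 2) 1 y) := by gcongr
          _ ≤ _ := by
            have : 0 ≤ B * L * c * (2 ^ (n + δ / 2) * prof n (δ / 2) 1 y) := by positivity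
            linarith
    · exact (integrableOn_prof hn' (half_pos hδ) one_pos).1.const_mul _
    · filter_upwards [hpos] with y hy
      have h0 : Tendsto (fun ε : ℝ => B * y ^ (-(n : ℝ) - 1) * (2 * S) * (ε ^ n * v))
          (𝓝[>] 0) (𝓝 0) := by
        have : Tendsto (fun ε : ℝ => B * y ^ (-(n : ℝ) - 1) * (2 * S) * (ε ^ n * v))
            (𝓝 0) (𝓝 (B * y ^ (-(n : ℝ) - 1) * (2 * S) * (0 ^ n * v))) :=
          Continuous.tendsto (by fun_prop) 0
        rw [zero_pow (by omega), zero_mul, mul_zero] at this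
        exact this.mono_left nhdsWithin_le_nhds
      refine squeeze_zero_norm' ?_ h0
      filter_upwards [self_mem_nhdsWithin] with ε hε using hk.near_bound hδ hy x hS2 hε
  rw [integral_zero] at key
  have hT := hk.integrableOn_slice_integral hn hδ hδ2 f x
  have key2 := tendsto_const_nhds (x := ∫ y in Ioi (0 : ℝ), ∫ x', k y x x' * f x') |>.sub key
  rw [sub_zero] at key2
  refine key2.congr' ?_
  filter_upwards [self_mem_nhdsWithin] with ε hε
  have hs := measurableSet_far x ε
  obtain ⟨-, j2, j3⟩ := hk.integral_swap_of_far hn hδ (x := x) hε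
    (hfi.indicator hs) (fun x' hx' => indicator_of_notMem
      (by simpa using hx'.le) _)
  have hind : ∀ g : Eu n → ℂ, ∫ x', g x' * {x' | ε < ‖x - x'‖}.indicator f x' =
      ∫ x' in {x' | ε < ‖x - x'‖}, g x' * f x' := by
    intro g
    rw [← integral_indicator hs]
    refine integral_congr_ae (.of_forall fun x' => ?_)
    by_cases hx' : x' ∈ {x' | ε < ‖x - x'‖}
    · simp only [indicator_of_mem hx']
    · simp only [indicator_of_notMem hx', mul_zero]
  have e1 : ∫ x' in {x' | ε < ‖x - x'‖}, (∫ y in Ioi (0 : ℝ), k y x x') * f x' =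
      ∫ y in Ioi (0 : ℝ), ∫ x' in {x' | ε < ‖x - x'‖}, k y x x' * f x' := by
    rw [← hind, ← j3]
    simp only [hind]
  have j2' : IntegrableOn (fun y => ∫ x' in {x' | ε < ‖x - x'‖}, k y x x' * f x') (Ioi 0) := by
    simpa only [hind] using j2
  have hc := (hk.corr_bound hn hδ hε x).1
  have e2 : corr k ε x * f x =
      ∫ y in Ioi (0 : ℝ), (∫ x' in {x' | ε < ‖x - x'‖}ᶜ, k y x x') * f x :=
    (integral_mul_const _ _).symm
  rw [e1, e2, ← integral_add j2' (hc.mul_const _), sub_eq_iff_eq_add]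
  have hrest : ∀ y, 0 < y → ∫ x', k y x x' * f x' =
      ((∫ x' in {x' | ε < ‖x - x'‖}, k y x x' * f x') +
        (∫ x' in {x' | ε < ‖x - x'‖}ᶜ, k y x x') * f x) +
      ∫ x' in {x' | ε < ‖x - x'‖}ᶜ, k y x x' * (f x' - f x) := by
    intro y hy
    have i1 := hk.integrable_mul hδ hy x hfi
    rw [← integral_add_compl hs i1, add_assoc]
    congr 1
    simp only [mul_sub]
    rw [integral_sub i1.integrableOn ((hk.integrable hδ hy x).mul_const _).integrableOn,
      integral_mul_const]
    ring
  have hdiff : IntegrableOn (fun y => ∫ x' in {x' | ε < ‖x - x'‖}ᶜ, k y x x' * (f x' - f x))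
      (Ioi 0) := by
    refine (hT.sub (j2'.add (hc.mul_const (f x)))).congr ?_
    filter_upwards [hpos] with y hy
    simp only [Pi.sub_apply, Pi.add_apply]
    rw [hrest y hy]
    ring
  refine Eq.trans ?_ (integral_add (j2'.add (hc.mul_const (f x))) hdiff)
  refine integral_congr_ae ?_
  filter_upwards [hpos] with y hy using hrest y hy

end IsCZSlices

lemma eLpNorm_two_sq {X : Type*} [MeasurableSpace X] {F : Type*} [NormedAddCommGroup F]
    (f : X → F) (μ : Measure X) : eLpNorm f 2 μ ^ 2 = ∫⁻ x, ‖f x‖ₑ ^ 2 ∂μ := by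
  rw [eLpNorm_eq_lintegral_rpow_enorm_toReal two_ne_zero ENNReal.ofNat_ne_top, ← ENNReal.rpow_two,
    ← ENNReal.rpow_mul]
  simp

namespace IsCZSlices

variable {n : ℕ} {k : ℝ → Eu n → Eu n → ℂ} {B δ : ℝ}

/-- The operator obtained by integrating the slices in `y` last. -/
def sliceOp (k : ℝ → Eu n → Eu n → ℂ) (f : 𝓢(Eu n, ℂ)) (x : Eu n) : ℂ :=
  ∫ y in Ioi (0 : ℝ), ∫ x', k y x x' * f x'

lemma stronglyMeasurable_slice_integral_univ (hk : IsCZSlices k B δ) (f : 𝓢(Eu n, ℂ)) :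
    StronglyMeasurable (fun p : ℝ × Eu n => ∫ x', k p.1 p.2 x' * f x') := by
  have := hk.stronglyMeasurable_slice_integral f.continuous.measurable (s := univ)
  simpa only [setIntegral_univ] using this

lemma stronglyMeasurable_sliceOp (hk : IsCZSlices k B δ) (f : 𝓢(Eu n, ℂ)) :
    StronglyMeasurable (sliceOp k f) :=
  (hk.stronglyMeasurable_slice_integral_univ f).integral_prod_left' (μ := volume.restrict (Ioi 0))

lemma exists_sliceOp_bound (hk : IsCZSlices k B δ) (hn : 1 ≤ n) (hδ : 0 < δ) (hδ2 : δ ≤ 2)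
    (f : 𝓢(Eu n, ℂ)) : ∃ D, ∀ x, ‖sliceOp k f x‖ ≤ D := by
  obtain ⟨D, hD⟩ := hk.exists_slice_bound hδ hδ2 f
  refine ⟨∫ y in Ioi (0 : ℝ), D * prof n (δ / 2) 1 y, fun x => ?_⟩
  refine norm_integral_le_of_norm_le ((integrableOn_prof (m := n) (by exact_mod_cast hn)
    (half_pos hδ) one_pos).1.const_mul D) ?_
  filter_upwards [ae_restrict_mem measurableSet_Ioi] with y hy using hD y hy x

/-- The uniform slice bound makes Fubini's theorem legitimate, after which the height integral is
the one in the `l2` hypothesis. -/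
lemma enorm_integral_sliceOp_mul_le (hk : IsCZSlices k B δ) (hn : 1 ≤ n) (hδ : 0 < δ)
    (hδ2 : δ ≤ 2) (f : 𝓢(Eu n, ℂ)) {g : Eu n → ℂ} (hg : Integrable g) (hg2 : MemLp g 2 volume) :
    ‖∫ x, sliceOp k f x * g x‖ₑ ≤
      ENNReal.ofReal B * eLpNorm f 2 volume * eLpNorm g 2 volume := by
  obtain ⟨D, hD⟩ := hk.exists_slice_bound hδ hδ2 f
  have hprod : Integrable (fun p : ℝ × Eu n => (∫ x', k p.1 p.2 x' * f x') * g p.2)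
      ((volume.restrict (Ioi (0 : ℝ))).prod volume) := by
    refine (((integrableOn_prof (m := n) (by exact_mod_cast hn)
      (half_pos hδ) one_pos).1.const_mul D).mul_prod hg.norm).mono' ?_ ?_
    · exact (hk.stronglyMeasurable_slice_integral_univ f).aestronglyMeasurable.mul
        hg.aestronglyMeasurable.comp_snd
    · have : ∀ᵐ p ∂((volume.restrict (Ioi (0 : ℝ))).prod (volume : Measure (Eu n))), 0 < p.1 :=
        Measure.quasiMeasurePreserving_fst.ae (ae_restrict_mem measurableSet_Ioi)
      filter_upwards [this] with p hp
      rw [norm_mul]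
      gcongr
      exact hD _ hp _
  have e : ∫ x, sliceOp k f x * g x =
      ∫ y in Ioi (0 : ℝ), ∫ x, (∫ x', k y x x' * f x') * g x := by
    rw [integral_integral_swap hprod]
    refine integral_congr_ae (.of_forall fun x => ?_)
    exact (integral_mul_const _ _).symm
  rw [e]
  exact (enorm_integral_le_lintegral_enorm _).trans (hk.l2 f g hg hg2)

/-- Duality, tested on the conjugate of `sliceOp k f` itself. A priori this function is only known
to be bounded, so it is first cut to a ball, where it lies in `L¹ ∩ L²`. The cut norm `N` is finite
and satisfies `N² ≤ c N`, so `N` cancels, and the radius then goes to infinity. -/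
lemma eLpNorm_sliceOp_le (hk : IsCZSlices k B δ) (hn : 1 ≤ n) (hδ : 0 < δ) (hδ2 : δ ≤ 2)
    (f : 𝓢(Eu n, ℂ)) :
    eLpNorm (sliceOp k f) 2 volume ≤ ENNReal.ofReal B * eLpNorm f 2 volume := by
  obtain ⟨D, hD⟩ := hk.exists_sliceOp_bound hn hδ hδ2 f
  have hm := hk.stronglyMeasurable_sliceOp f
  have hfin : ∀ m : ℕ, MemLp ((Metric.ball (0 : Eu n) m).indicator (sliceOp k f)) 2 volume ∧
      Integrable ((Metric.ball (0 : Eu n) m).indicator (sliceOp k f)) := by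
    intro m
    have hb : IsFiniteMeasure (volume.restrict (Metric.ball (0 : Eu n) m)) :=
      ⟨by simpa using measure_ball_lt_top⟩
    constructor
    · rw [memLp_indicator_iff_restrict Metric.isOpen_ball.measurableSet]
      exact MemLp.of_bound hm.aestronglyMeasurable D (.of_forall hD)
    · rw [integrable_indicator_iff Metric.isOpen_ball.measurableSet]
      exact Integrable.of_bound hm.aestronglyMeasurable D (.of_forall hD)
  have hle : ∀ m : ℕ, eLpNorm ((Metric.ball (0 : Eu n) m).indicator (sliceOp k f)) 2 volume ≤
      ENNReal.ofReal B * eLpNorm f 2 volume := by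
    intro m
    set h := (Metric.ball (0 : Eu n) m).indicator (sliceOp k f) with hh
    have hstar : eLpNorm (fun x => star (h x)) 2 volume = eLpNorm h 2 volume :=
      eLpNorm_congr_norm_ae (.of_forall fun x => norm_star _)
    have hg2 : MemLp (fun x => star (h x)) 2 volume :=
      (hfin m).1.congr_norm (continuous_star.comp_aestronglyMeasurable
        (hfin m).1.aestronglyMeasurable) (.of_forall fun x => (norm_star _).symm)
    have hg : Integrable (fun x => star (h x)) :=
      (hfin m).2.mono (continuous_star.comp_aestronglyMeasurable
        (hfin m).1.aestronglyMeasurable) (.of_forall fun x => (norm_star _).le)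
    have key := hk.enorm_integral_sliceOp_mul_le hn hδ hδ2 f hg hg2
    have e : ∫ x, sliceOp k f x * star (h x) = ((∫ x, ‖h x‖ ^ 2 : ℝ) : ℂ) := by
      rw [← integral_complex_ofReal]
      refine integral_congr_ae (.of_forall fun x => ?_)
      have h1 : sliceOp k f x * star (h x) = h x * star (h x) := by
        by_cases hx : x ∈ Metric.ball (0 : Eu n) m
        · rw [hh, indicator_of_mem hx]
        · rw [hh, indicator_of_notMem hx]; simp
      simp only [h1]
      rw [Complex.star_def, Complex.mul_conj, Complex.normSq_eq_norm_sq]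
    have e2 : ‖∫ x, sliceOp k f x * star (h x)‖ₑ = eLpNorm h 2 volume ^ 2 := by
      rw [e, eLpNorm_two_sq]
      have : ‖((∫ x, ‖h x‖ ^ 2 : ℝ) : ℂ)‖ₑ = ENNReal.ofReal (∫ x, ‖h x‖ ^ 2) := by
        rw [← ofReal_norm, Complex.norm_real,
          Real.norm_of_nonneg (integral_nonneg fun x => by positivity)]
      rw [this, ofReal_integral_eq_lintegral_ofReal ((hfin m).1.integrable_norm_pow two_ne_zero)
        (.of_forall fun x => by positivity)]
      refine lintegral_congr fun x => ?_
      rw [ENNReal.ofReal_pow (norm_nonneg _), ofReal_norm]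
    rw [e2, hstar] at key
    rcases eq_or_ne (eLpNorm h 2 volume) 0 with h0 | h0
    · rw [h0]; exact zero_le
    · rw [sq] at key
      exact (ENNReal.mul_le_mul_iff_left h0 (hfin m).1.eLpNorm_ne_top).1 key
  refine Lp.eLpNorm_le_of_ae_tendsto (u := atTop) (.of_forall hle)
    (fun m : ℕ => (hfin m).1.aestronglyMeasurable) (.of_forall fun x => ?_)
  refine tendsto_const_nhds.congr' ?_
  filter_upwards [eventually_gt_atTop ⌈‖x‖⌉₊] with m hm
  rw [indicator_of_mem]
  simpa using (Nat.le_ceil ‖x‖).trans_lt (by exact_mod_cast hm)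

lemma sliceOp_add (hk : IsCZSlices k B δ) (hn : 1 ≤ n) (hδ : 0 < δ) (hδ2 : δ ≤ 2)
    (f g : 𝓢(Eu n, ℂ)) (x : Eu n) : sliceOp k (f + g) x = sliceOp k f x + sliceOp k g x := by
  unfold sliceOp
  rw [← integral_add (hk.integrableOn_slice_integral hn hδ hδ2 f x)
    (hk.integrableOn_slice_integral hn hδ hδ2 g x)]
  refine setIntegral_congr_fun measurableSet_Ioi fun y hy => ?_
  simp only [add_apply, mul_add]
  exact integral_add (hk.integrable_mul hδ hy x f.integrable)
    (hk.integrable_mul hδ hy x g.integrable)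

lemma sliceOp_smul (c : ℂ) (f : 𝓢(Eu n, ℂ)) (x : Eu n) :
    sliceOp k (c • f) x = c * sliceOp k f x := by
  unfold sliceOp
  simp only [smul_apply, smul_eq_mul, mul_left_comm _ c, integral_const_mul]

/-- The constant of the Calderón–Zygmund operator built from slices. -/
def sliceConst (n : ℕ) (δ : ℝ) : ℝ :=
  1 + (1 / δ + 1 / n) + (1 / δ + 1 / (n + 1)) + corrConst n δ

lemma corrConst_nonneg (n : ℕ) {δ : ℝ} (hδ : 0 < δ) : 0 ≤ corrConst n δ := by
  have : 0 ≤ ∫ u : Eu n, (1 + ‖u‖) ^ (-(n + δ / 2)) := integral_nonneg fun u => by positivity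
  unfold corrConst
  positivity

theorem isCZOperator (hk : IsCZSlices k B δ) (hn : 1 ≤ n) (hδ : 0 < δ) (hδ2 : δ ≤ 2) :
    IsCZOperator (sliceOp k) (fun x x' => ∫ y in Ioi (0 : ℝ), k y x x') (sliceConst n δ * B) := by
  have hB := hk.nonneg
  have hc0 := corrConst_nonneg n hδ
  have hn' : (0 : ℝ) < n := by exact_mod_cast hn
  have hC1 : 1 ≤ sliceConst n δ := by
    unfold sliceConst
    have : 0 ≤ (1 / δ + 1 / n) + (1 / δ + 1 / ((n : ℝ) + 1)) := by positivity
    linarith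
  have hC2 : 1 / δ + 1 / n ≤ sliceConst n δ := by
    unfold sliceConst
    have : 0 ≤ 1 / δ + 1 / ((n : ℝ) + 1) := by positivity
    linarith
  have hC3 : 1 / δ + 1 / ((n : ℝ) + 1) ≤ sliceConst n δ := by
    unfold sliceConst
    have : 0 ≤ 1 / δ + 1 / (n : ℝ) := by positivity
    linarith
  have hC4 : corrConst n δ ≤ sliceConst n δ := by
    unfold sliceConst
    have : 0 ≤ (1 / δ + 1 / n) + (1 / δ + 1 / ((n : ℝ) + 1)) := by positivity
    linarith
  have hpow : ∀ {x x' : Eu n}, x ≠ x' → ‖x - x'‖ ^ (-((n : ℝ) + 1)) = (‖x - x'‖ ^ (n + 1))⁻¹ := by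
    intro x x' _
    rw [Real.rpow_neg (norm_nonneg _)]
    congr 1
    exact_mod_cast Real.rpow_natCast ‖x - x'‖ (n + 1)
  have hfst : ∀ x x' : Eu n, x ≠ x' → _ := fun x x' hx =>
    differentiableAt_integral_slices (q := fun y z => k y z x') (c := x') hn hδ hB
      (fun z => hk.measurable.comp (f := fun y => (y, z, x')) (by fun_prop))
      (fun y hy z => hk.size y hy z x') (fun y hy z => hk.diff_fst y hy z x')
      (fun y hy z => hk.grad_fst y hy z x') hx
  have hsnd : ∀ x x' : Eu n, x ≠ x' → _ := fun x x' hx =>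
    differentiableAt_integral_slices (q := fun y z => k y x z) (c := x) hn hδ hB
      (fun z => hk.measurable.comp (f := fun y => (y, x, z)) (by fun_prop))
      (fun y hy z => by rw [norm_sub_rev]; exact hk.size y hy x z)
      (fun y hy z => hk.diff_snd y hy x z)
      (fun y hy z => by rw [norm_sub_rev]; exact hk.grad_snd y hy x z) hx.symm
  refine ⟨hk.sliceOp_add hn hδ hδ2, sliceOp_smul, ?_, ?_, ?_, ?_, ?_⟩
  · have hmem : ∀ f : 𝓢(Eu n, ℂ), MemLp (sliceOp k f) 2 volume := fun f =>
      ⟨(hk.stronglyMeasurable_sliceOp f).aestronglyMeasurable,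
        (hk.eLpNorm_sliceOp_le hn hδ hδ2 f).trans_lt
          (ENNReal.mul_lt_top ENNReal.ofReal_lt_top (f.memLp 2 volume).eLpNorm_lt_top)⟩
    let T : 𝓢(Eu n, ℂ) →ₗ[ℂ] Lp ℂ 2 (volume : Measure (Eu n)) :=
      { toFun := fun f => (hmem f).toLp
        map_add' := fun f g => by
          rw [← MemLp.toLp_add]
          exact MemLp.toLp_congr _ _
            (.of_forall fun x => hk.sliceOp_add hn hδ hδ2 f g x)
        map_smul' := fun c f => by
          rw [RingHom.id_apply, ← MemLp.toLp_const_smul]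
          exact MemLp.toLp_congr _ _ (.of_forall fun x => sliceOp_smul c f x) }
    let e : 𝓢(Eu n, ℂ) →ₗ[ℂ] Lp ℂ 2 (volume : Measure (Eu n)) :=
      (SchwartzMap.toLpCLM ℂ ℂ 2 volume).toLinearMap
    -- The bounded extension is determined on the dense image of the Schwartz functions in `L²`.
    have hdense : DenseRange e :=
      SchwartzMap.denseRange_toLpCLM (F := ℂ) (p := 2) ENNReal.ofNat_ne_top
    have hnorm : ∀ f, ‖T f‖ ≤ B * ‖e f‖ := by
      intro f
      change ‖(hmem f).toLp‖ ≤ B * ‖f.toLp 2 volume‖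
      rw [Lp.norm_toLp, SchwartzMap.norm_toLp]
      have := ENNReal.toReal_mono (ENNReal.mul_ne_top ENNReal.ofReal_ne_top
        (f.memLp 2 volume).eLpNorm_ne_top) (hk.eLpNorm_sliceOp_le hn hδ hδ2 f)
      rwa [ENNReal.toReal_mul, ENNReal.toReal_ofReal hB] at this
    refine ⟨T.extendOfNorm e, ?_, fun f => ?_⟩
    · refine (ContinuousLinearMap.opNorm_le_bound _ hB
        (LinearMap.norm_extendOfNorm_apply_le hdense B hnorm)).trans ?_
      exact le_mul_of_one_le_left hB hC1
    · have : T.extendOfNorm e (f.toLp 2) = T f := LinearMap.extendOfNorm_eq hdense ⟨B, hnorm⟩ f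
      rw [this]
      exact (hmem f).coeFn_toLp
  · refine ⟨fun x x' hx => ?_, fun x x' hx => (hfst x x' hx).1, fun x x' hx => (hsnd x x' hx).1,
      fun x x' hx => ?_, fun x x' hx => ?_⟩
    · refine (hk.integrableOn_kernel hn hδ hx).2.trans ?_
      rw [Real.rpow_neg (norm_nonneg _), Real.rpow_natCast, div_eq_mul_inv (sliceConst n δ * B),
        ← mul_assoc, mul_comm B]
      gcongr
    · refine (hfst x x' hx).2.trans ?_
      rw [hpow hx, div_eq_mul_inv (sliceConst n δ * B),
        ← mul_assoc, mul_comm B]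
      gcongr
    · refine (hsnd x x' hx).2.trans ?_
      rw [hpow hx.symm, norm_sub_rev x', div_eq_mul_inv (sliceConst n δ * B),
        ← mul_assoc, mul_comm B]
      gcongr
  · intro f x hx
    obtain ⟨r, hr, hball⟩ := Metric.isOpen_iff.1 (isClosed_tsupport f).isOpen_compl x hx
    obtain ⟨h1, -, h3⟩ := hk.integral_swap_of_far hn hδ (x := x) hr f.integrable (fun x' hx' => by
      have : x' ∈ Metric.ball x r := by rwa [Metric.mem_ball, dist_eq_norm, norm_sub_rev]
      exact image_eq_zero_of_notMem_tsupport (hball this))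
    exact ⟨h1, h3⟩
  · intro f x ε hε
    have hs := measurableSet_far x ε
    obtain ⟨h1, -, -⟩ := hk.integral_swap_of_far hn hδ (x := x) hε
      (f.integrable.indicator hs) (fun x' hx' => indicator_of_notMem (by simpa using hx'.le) _)
    rw [← integrable_indicator_iff hs]
    refine h1.congr (.of_forall fun x' => ?_)
    by_cases hx' : x' ∈ {x' | ε < ‖x - x'‖}
    · simp only [indicator_of_mem hx']
    · simp only [indicator_of_notMem hx', mul_zero]
  · refine ⟨corr k, fun ε hε x => ?_, fun f x => hk.tendsto_truncated hn hδ hδ2 f x⟩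
    refine (hk.corr_bound hn hδ hε x).2.trans ?_
    rw [mul_comm]
    gcongr

end IsCZSlices

/-! ### The slice of a single coefficient: size and cancellation -/

section CompKernel

variable {n : ℕ}

/-- `F` decays like `(1 + |u|)^(-N)`. -/
def HasDecay {V : Type*} [NormedAddCommGroup V] (F : Eu n → V) (N : ℝ) : Prop :=
  ∃ D, 0 ≤ D ∧ ∀ u, ‖F u‖ ≤ D * (1 + ‖u‖) ^ (-N)

lemma HasDecay.mono {V : Type*} [NormedAddCommGroup V] {F : Eu n → V} {N N' : ℝ}
    (h : HasDecay F N) (hN : N' ≤ N) : HasDecay F N' := by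
  obtain ⟨D, hD, h⟩ := h
  refine ⟨D, hD, fun u => (h u).trans ?_⟩
  gcongr
  linarith [norm_nonneg u]

lemma HasDecay.exists_bound {V : Type*} [NormedAddCommGroup V] {F : Eu n → V} {N : ℝ}
    (h : HasDecay F N) (hN : 0 ≤ N) : ∃ D, 0 ≤ D ∧ ∀ u, ‖F u‖ ≤ D := by
  obtain ⟨D, hD, h⟩ := h
  refine ⟨D, hD, fun u => (h u).trans (mul_le_of_le_one_right hD ?_)⟩
  exact Real.rpow_le_one_of_one_le_of_nonpos (by linarith [norm_nonneg u]) (by linarith)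

lemma HasDecay.integrable {F : Eu n → ℂ} {N : ℝ} (h : HasDecay F N) (hN : (n : ℝ) < N)
    (hF : Continuous F) : Integrable F := by
  obtain ⟨D, -, h⟩ := h
  have hi : Integrable (fun u : Eu n => (1 + ‖u‖) ^ (-N)) :=
    integrable_one_add_norm (by simpa using hN)
  exact (hi.const_mul D).mono' hF.aestronglyMeasurable (.of_forall h)

/-- One of `|z - x|`, `|z - x'|` is at least `|x - x'| / 2`. Its weight comes out of the integral at
the cost of `2^N`, and the other weight integrates to a multiple of `y^n`. -/
lemma weight_mul_weight {N : ℝ} (hN : (n : ℝ) < N) {y : ℝ} (hy : 0 < y) (x x' : Eu n) :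
    Integrable (fun z : Eu n => (1 + ‖z - x'‖ / y) ^ (-N) * (1 + ‖z - x‖ / y) ^ (-N)) ∧
      ∫ z : Eu n, (1 + ‖z - x'‖ / y) ^ (-N) * (1 + ‖z - x‖ / y) ^ (-N) ≤
        (2 ^ N * 2 * ∫ u : Eu n, (1 + ‖u‖) ^ (-N)) * y ^ n * (1 + ‖x - x'‖ / y) ^ (-N) := by
  have hN0 : 0 ≤ N := (Nat.cast_nonneg n).trans hN.le
  obtain ⟨i1, i2⟩ := integrable_comp_norm_div hN hy
  have j : ∀ c : Eu n, Integrable (fun z : Eu n => (1 + ‖z - c‖ / y) ^ (-N)) := fun c =>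
    i1.comp_sub_right c
  have jv : ∀ c : Eu n, ∫ z : Eu n, (1 + ‖z - c‖ / y) ^ (-N) =
      y ^ n * ∫ u : Eu n, (1 + ‖u‖) ^ (-N) := fun c => by
    rw [← i2]; exact integral_sub_right_eq_self (fun z : Eu n => (1 + ‖z‖ / y) ^ (-N)) c
  have hb : ∀ z : Eu n, (1 + ‖z - x'‖ / y) ^ (-N) * (1 + ‖z - x‖ / y) ^ (-N) ≤
      2 ^ N * (1 + ‖x - x'‖ / y) ^ (-N) *
        ((1 + ‖z - x'‖ / y) ^ (-N) + (1 + ‖z - x‖ / y) ^ (-N)) := by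
    intro z
    have hd : ‖x - x'‖ / y ≤ ‖z - x'‖ / y + ‖z - x‖ / y := by
      rw [← add_div]
      gcongr
      rw [← norm_neg (z - x)]
      refine le_trans (le_of_eq ?_) (norm_add_le _ _)
      congr 1; abel
    have h2 : ∀ t : ℝ, (1 + ‖x - x'‖ / y) / 2 ≤ t →
        t ^ (-N) ≤ 2 ^ N * (1 + ‖x - x'‖ / y) ^ (-N) := by
      intro t ht
      refine (Real.rpow_le_rpow_of_nonpos (by positivity) ht (by linarith)).trans (le_of_eq ?_)
      rw [Real.div_rpow (by positivity) (by norm_num), Real.rpow_neg (by norm_num : (0:ℝ) ≤ 2),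
        div_inv_eq_mul, mul_comm]
    have p1 : 0 ≤ (1 + ‖z - x'‖ / y) ^ (-N) := by positivity
    have p2 : 0 ≤ (1 + ‖z - x‖ / y) ^ (-N) := by positivity
    have p3 : 0 ≤ 2 ^ N * (1 + ‖x - x'‖ / y) ^ (-N) := by positivity
    rcases le_total (‖z - x'‖ / y) (‖z - x‖ / y) with h | h
    · have := h2 (1 + ‖z - x‖ / y) (by linarith)
      nlinarith
    · have := h2 (1 + ‖z - x'‖ / y) (by linarith)
      nlinarith
  have hI : Integrable (fun z : Eu n => 2 ^ N * (1 + ‖x - x'‖ / y) ^ (-N) *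
        ((1 + ‖z - x'‖ / y) ^ (-N) + (1 + ‖z - x‖ / y) ^ (-N))) :=
    ((j x').add (j x)).const_mul _
  have hi : Integrable
      (fun z : Eu n => (1 + ‖z - x'‖ / y) ^ (-N) * (1 + ‖z - x‖ / y) ^ (-N)) := by
    refine hI.mono' (by fun_prop) (.of_forall fun z => ?_)
    rw [Real.norm_of_nonneg (by positivity)]
    exact hb z
  refine ⟨hi, (integral_mono hi hI hb).trans (le_of_eq ?_)⟩
  rw [integral_const_mul, integral_add (j x') (j x), jv, jv]
  ring

/-- The kernel slice `2 y ∫ a(x̄, y) y⁻ⁿ⁻¹ P((x̄ - x') / y) y⁻ⁿ⁻¹ Q((x̄ - x) / y) dx̄` of a single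
coefficient. -/
def compKernel (a : Eu n → ℝ → ℂ) (P Q : Eu n → ℂ) (y : ℝ) (x x' : Eu n) : ℂ :=
  ((2 * y * ((y ^ (n + 1))⁻¹) ^ 2 : ℝ) : ℂ) *
    ∫ z, a z y * (P (y⁻¹ • (z - x')) * Q (y⁻¹ • (z - x)))

lemma compKernel_swap (a : Eu n → ℝ → ℂ) (P Q : Eu n → ℂ) (y : ℝ) (x x' : Eu n) :
    compKernel a P Q y x x' = compKernel a Q P y x' x := by
  unfold compKernel
  simp only [mul_comm (P _)]

lemma measurable_compKernel {a : Eu n → ℝ → ℂ} (ha : Measurable (fun p : Eu n × ℝ => a p.1 p.2))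
    {P Q : Eu n → ℂ} (hP : Continuous P) (hQ : Continuous Q) :
    Measurable (fun p : ℝ × Eu n × Eu n => compKernel a P Q p.1 p.2.1 p.2.2) := by
  unfold compKernel
  refine Measurable.mul (by fun_prop) (StronglyMeasurable.measurable ?_)
  refine StronglyMeasurable.integral_prod_right (f := fun (p : ℝ × Eu n × Eu n) z =>
    a z p.1 * (P (p.1⁻¹ • (z - p.2.2)) * Q (p.1⁻¹ • (z - p.2.1)))) ?_
  refine Measurable.stronglyMeasurable ?_
  have hP' := hP.measurable
  have hQ' := hQ.measurable
  have ha' : Measurable (fun q : (ℝ × Eu n × Eu n) × Eu n => a q.2 q.1.1) :=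
    ha.comp (f := fun q : (ℝ × Eu n × Eu n) × Eu n => (q.2, q.1.1)) (by fun_prop)
  refine ha'.mul (Measurable.mul ?_ ?_)
  · exact hP'.comp (by fun_prop)
  · exact hQ'.comp (by fun_prop)

lemma norm_inv_smul {y : ℝ} (hy : 0 < y) (u : Eu n) : ‖y⁻¹ • u‖ = ‖u‖ / y := by
  rw [norm_smul, norm_inv, Real.norm_of_nonneg hy.le, div_eq_inv_mul]

/-- The powers of the height in a slice: `y` from the kernel, `y^(-n-1)` from each gradient and
`y^n` from the integration at scale `y`. In `scale_one` a derivative adds `y⁻¹`. -/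
lemma scale_zero {y : ℝ} (hy : 0 < y) :
    y * ((y ^ (n + 1))⁻¹) ^ 2 * y ^ n = y ^ (-(n : ℝ) - 1) := by
  rw [Real.rpow_sub_one hy.ne', Real.rpow_neg hy.le, Real.rpow_natCast]
  field_simp
  ring

lemma scale_one {y : ℝ} (hy : 0 < y) :
    y * ((y ^ (n + 1))⁻¹) ^ 2 * y⁻¹ * y ^ n = y ^ (-((n : ℝ) + 1) - 1) := by
  rw [show y * ((y ^ (n + 1))⁻¹) ^ 2 * y⁻¹ * y ^ n =
      y * ((y ^ (n + 1))⁻¹) ^ 2 * y ^ n * y⁻¹ by ring,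
    scale_zero hy, ← Real.rpow_neg_one, ← Real.rpow_add hy]
  ring_nf

lemma integral_weight_nonneg (N : ℝ) : 0 ≤ ∫ u : Eu n, (1 + ‖u‖) ^ (-N) :=
  integral_nonneg fun u => by positivity

/-- An integral bounded by a product of two weights at scale `y`. -/
lemma norm_integral_le_weight {V : Type*} [NormedAddCommGroup V] [NormedSpace ℝ V] {N : ℝ}
    (hN : (n : ℝ) < N) {y : ℝ} (hy : 0 < y) {x x' : Eu n} {F : Eu n → V} {D : ℝ} (hD : 0 ≤ D)
    (hF : ∀ z, ‖F z‖ ≤ D * ((1 + ‖z - x'‖ / y) ^ (-N) * (1 + ‖z - x‖ / y) ^ (-N))) :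
    ‖∫ z, F z‖ ≤ D * (2 ^ N * 2 * ∫ u : Eu n, (1 + ‖u‖) ^ (-N)) * y ^ n *
      (1 + ‖x - x'‖ / y) ^ (-N) := by
  obtain ⟨i1, i2⟩ := weight_mul_weight hN hy x x'
  refine (norm_integral_le_of_norm_le (i1.const_mul D) (.of_forall hF)).trans ?_
  rw [integral_const_mul]
  refine (mul_le_mul_of_nonneg_left i2 hD).trans (le_of_eq ?_)
  ring

lemma norm_compKernel_integrand_le {a : Eu n → ℝ → ℂ} {M : ℝ} (ha : ∀ x y, ‖a x y‖ ≤ M)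
    {P Q : Eu n → ℂ} {N D D' : ℝ} (hD : 0 ≤ D) (hP : ∀ u, ‖P u‖ ≤ D * (1 + ‖u‖) ^ (-N))
    (hQ : ∀ u, ‖Q u‖ ≤ D' * (1 + ‖u‖) ^ (-N)) {y : ℝ} (hy : 0 < y)
    (x x' z : Eu n) : ‖a z y * (P (y⁻¹ • (z - x')) * Q (y⁻¹ • (z - x)))‖ ≤
      (M * (D * D')) * ((1 + ‖z - x'‖ / y) ^ (-N) * (1 + ‖z - x‖ / y) ^ (-N)) := by
  have hM : 0 ≤ M := (norm_nonneg _).trans (ha 0 0)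
  have h1 := hP (y⁻¹ • (z - x'))
  have h2 := hQ (y⁻¹ • (z - x))
  rw [norm_inv_smul hy] at h1 h2
  rw [norm_mul, norm_mul]
  calc _ ≤ M * ((D * (1 + ‖z - x'‖ / y) ^ (-N)) * (D' * (1 + ‖z - x‖ / y) ^ (-N))) := by
        have := ha z y
        gcongr
    _ = _ := by ring

lemma aestronglyMeasurable_compKernel_integrand {a : Eu n → ℝ → ℂ}
    (hm : Measurable (fun p : Eu n × ℝ => a p.1 p.2)) {P Q : Eu n → ℂ} (hPc : Continuous P)
    (hQc : Continuous Q) (y : ℝ) (x x' : Eu n) :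
    AEStronglyMeasurable (fun z => a z y * (P (y⁻¹ • (z - x')) * Q (y⁻¹ • (z - x)))) := by
  refine AEStronglyMeasurable.mul ?_ (by fun_prop)
  exact (hm.comp (f := fun z => (z, y)) (by fun_prop)).aestronglyMeasurable

lemma integrable_compKernel_integrand {a : Eu n → ℝ → ℂ} {M : ℝ}
    (hm : Measurable (fun p : Eu n × ℝ => a p.1 p.2)) (ha : ∀ x y, ‖a x y‖ ≤ M)
    {P Q : Eu n → ℂ} {N : ℝ} (hN : (n : ℝ) < N) (hP : HasDecay P N) (hQ : HasDecay Q N)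
    (hPc : Continuous P) (hQc : Continuous Q) {y : ℝ} (hy : 0 < y) (x x' : Eu n) :
    Integrable (fun z => a z y * (P (y⁻¹ • (z - x')) * Q (y⁻¹ • (z - x)))) := by
  obtain ⟨D, hD, hP⟩ := hP
  obtain ⟨D', hD', hQ⟩ := hQ
  exact ((weight_mul_weight hN hy x x').1.const_mul (M * (D * D'))).mono'
    (aestronglyMeasurable_compKernel_integrand hm hPc hQc y x x')
    (.of_forall fun z => norm_compKernel_integrand_le ha hD hP hQ hy x x' z)

/-- The second estimate keeps the norm inside the integral. It gives the absolute convergence of the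
double integral defining the kernel. -/
lemma exists_size_compKernel {P Q : Eu n → ℂ} {δ : ℝ} (hδ : 0 < δ)
    (hP : HasDecay P (n + δ)) (hQ : HasDecay Q (n + δ)) :
    ∃ C, 0 ≤ C ∧ ∀ (a : Eu n → ℝ → ℂ) (M : ℝ), (∀ x y, ‖a x y‖ ≤ M) → ∀ y, 0 < y → ∀ x x',
      ‖compKernel a P Q y x x'‖ ≤ C * M * prof n δ ‖x - x'‖ y ∧
      2 * y * ((y ^ (n + 1))⁻¹) ^ 2 * ∫ z, ‖a z y * (P (y⁻¹ • (z - x')) * Q (y⁻¹ • (z - x)))‖ ≤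
        C * M * prof n δ ‖x - x'‖ y := by
  obtain ⟨D, hD, hP⟩ := hP
  obtain ⟨D', hD', hQ⟩ := hQ
  have hI := integral_weight_nonneg (n := n) (n + δ)
  refine ⟨2 * (D * D') * (2 ^ (n + δ) * 2 * ∫ u : Eu n, (1 + ‖u‖) ^ (-(n + δ))), by positivity,
    fun a M ha y hy x x' => ?_⟩
  have hM : 0 ≤ M := (norm_nonneg _).trans (ha 0 0)
  have e2 : 2 * y * ((y ^ (n + 1))⁻¹) ^ 2 *
      ∫ z, ‖a z y * (P (y⁻¹ • (z - x')) * Q (y⁻¹ • (z - x)))‖ ≤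
      2 * (D * D') * (2 ^ (n + δ) * 2 * ∫ u : Eu n, (1 + ‖u‖) ^ (-(n + δ))) * M *
        prof n δ ‖x - x'‖ y := by
    have key := norm_integral_le_weight (N := n + δ) (by linarith) hy (D := M * (D * D'))
      (by positivity) (x := x) (x' := x')
      (F := fun z => ‖a z y * (P (y⁻¹ • (z - x')) * Q (y⁻¹ • (z - x)))‖) (fun z => by
        rw [norm_norm]; exact norm_compKernel_integrand_le ha hD hP hQ hy x x' z)
    rw [Real.norm_of_nonneg (integral_nonneg fun z => norm_nonneg _)] at key
    refine (mul_le_mul_of_nonneg_left key (by positivity)).trans (le_of_eq ?_)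
    rw [prof, ← scale_zero hy]
    ring
  refine ⟨?_, e2⟩
  refine le_trans ?_ e2
  unfold compKernel
  rw [norm_mul, Complex.norm_real, Real.norm_of_nonneg (by positivity)]
  gcongr
  exact norm_integral_le_integral_norm _

lemma integrable_dilate {P : Eu n → ℂ} (hP : Integrable P) {y : ℝ} (hy : 0 < y) :
    Integrable (fun u => P (y⁻¹ • u)) :=
  hP.comp_smul (inv_ne_zero hy.ne')

lemma integral_dilate_eq_zero {P : Eu n → ℂ} (hP : ∫ u, P u = 0) {y : ℝ} (hy : 0 < y)
    (z : Eu n) : ∫ x', P (y⁻¹ • (z - x')) = 0 := by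
  rw [integral_sub_left_eq_self (fun u => P (y⁻¹ • u)) volume z,
    Measure.integral_comp_inv_smul_of_nonneg volume P hy.le, hP, smul_zero]

/-- Fubini's theorem for a dilated profile convolved with two integrable functions. -/
lemma integrable_prod_dilate {P h g : Eu n → ℂ} (hP : Integrable P) (hh : Integrable h)
    (hg : AEStronglyMeasurable g) {D : ℝ} (hgD : ∀ x, ‖g x‖ ≤ D) {y : ℝ} (hy : 0 < y) :
    Integrable (fun p : Eu n × Eu n => h p.2 * (P (y⁻¹ • (p.2 - p.1)) * g p.1))
      (volume.prod volume) := by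
  have h1 : Integrable (fun u => P (y⁻¹ • (-u))) := (integrable_dilate hP hy).comp_neg
  have h2 := Integrable.convolution_integrand (ContinuousLinearMap.mul ℂ ℂ) hh h1
    (μ := volume)
  simp only [neg_sub] at h2
  have h3 := h2.mul_bdd hg.comp_fst (.of_forall fun p => hgD p.1)
  refine h3.congr (.of_forall fun p => ?_)
  simp [mul_assoc]

/-- After Fubini the integral in `x'` meets only a dilate of `P`, which has mean zero. Nothing is
required of the mean of `Q` or of the regularity of `a`. -/
lemma integral_compKernel_eq_zero {a : Eu n → ℝ → ℂ} {M : ℝ}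
    (hm : Measurable (fun p : Eu n × ℝ => a p.1 p.2)) (ha : ∀ x y, ‖a x y‖ ≤ M)
    {P Q : Eu n → ℂ} (hP : Integrable P) (hQ : Integrable Q) (hP0 : ∫ u, P u = 0)
    {y : ℝ} (hy : 0 < y) (x : Eu n) : ∫ x', compKernel a P Q y x x' = 0 := by
  unfold compKernel
  rw [integral_const_mul]
  have hh : Integrable (fun z => a z y * Q (y⁻¹ • (z - x))) :=
    ((integrable_dilate hQ hy).comp_sub_right x).bdd_mul
      (hm.comp (f := fun z => (z, y)) (by fun_prop)).aestronglyMeasurable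
      (.of_forall fun z => ha z y)
  have hprod := integrable_prod_dilate hP hh (g := fun _ => 1) aestronglyMeasurable_const
    (D := 1) (by simp) hy
  have e : ∫ x', ∫ z, a z y * (P (y⁻¹ • (z - x')) * Q (y⁻¹ • (z - x))) =
      ∫ x', ∫ z, (a z y * Q (y⁻¹ • (z - x))) * (P (y⁻¹ • (z - x')) * 1) := by
    congr 1; funext x'; congr 1; funext z; ring
  rw [e, integral_integral_swap hprod]
  simp only [mul_one, integral_const_mul, integral_dilate_eq_zero hP0 hy, mul_zero, integral_zero]

end CompKernel

/-! ### Gradient bounds for a single coefficient -/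

section Gradient

variable {n : ℕ}

/-- The gradient bounds in both variables for the slices `compKernel a P Q`, uniformly over the
coefficients `a` that satisfy `R`. -/
def HasGradBound (R : (Eu n → ℝ → ℂ) → Prop) (P Q : Eu n → ℂ) (δ : ℝ) : Prop :=
  ∃ C, 0 ≤ C ∧ ∀ (a : Eu n → ℝ → ℂ) (M : ℝ), R a → Measurable (fun p : Eu n × ℝ => a p.1 p.2) →
    (∀ x y, ‖a x y‖ ≤ M) → ∀ y, 0 < y → ∀ x x',
      DifferentiableAt ℝ (fun z => compKernel a P Q y z x') x ∧
      ‖fderiv ℝ (fun z => compKernel a P Q y z x') x‖ ≤ C * M * prof (n + 1) δ ‖x - x'‖ y ∧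
      DifferentiableAt ℝ (fun z => compKernel a P Q y x z) x' ∧
      ‖fderiv ℝ (fun z => compKernel a P Q y x z) x'‖ ≤ C * M * prof (n + 1) δ ‖x - x'‖ y

lemma hasFDerivAt_dilate_sub {Q : Eu n → ℂ} (hQ : Differentiable ℝ Q) (y : ℝ) (w z : Eu n) :
    HasFDerivAt (fun z => Q (y⁻¹ • (w - z))) (-(y⁻¹ • fderiv ℝ Q (y⁻¹ • (w - z)))) z := by
  have h1 : HasFDerivAt (fun z : Eu n => y⁻¹ • (w - z))
      (y⁻¹ • (-ContinuousLinearMap.id ℝ (Eu n))) z :=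
    ((hasFDerivAt_id z).const_sub w).const_smul y⁻¹
  have h2 := (hQ (y⁻¹ • (w - z))).hasFDerivAt.comp z h1
  refine h2.congr_fderiv ?_
  ext v
  simp

/-- The first variable occurs only in `Q`, so no smoothness of `a` is needed and the derivative
costs a factor `y⁻¹`. The price is that `P` and the derivative of `Q` must each have the full `n + 1
+ δ` orders of decay. -/
lemma exists_grad_fst_of_decay {P Q : Eu n → ℂ} {δ : ℝ} (hδ : 0 < δ)
    (hPc : Continuous P) (hP : HasDecay P (n + 1 + δ))
    (hQd : Differentiable ℝ Q) (hQ' : HasDecay (fderiv ℝ Q) (n + 1 + δ))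
    (hQ : HasDecay Q (n + 1 + δ)) :
    ∃ C, 0 ≤ C ∧ ∀ (a : Eu n → ℝ → ℂ) (M : ℝ), Measurable (fun p : Eu n × ℝ => a p.1 p.2) →
      (∀ x y, ‖a x y‖ ≤ M) → ∀ y, 0 < y → ∀ x x',
      DifferentiableAt ℝ (fun z => compKernel a P Q y z x') x ∧
      ‖fderiv ℝ (fun z => compKernel a P Q y z x') x‖ ≤ C * M * prof (n + 1) δ ‖x - x'‖ y := by
  have hN : (n : ℝ) < n + 1 + δ := by linarith
  have hPi : Integrable P := hP.integrable hN hPc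
  obtain ⟨D, hD, hP1⟩ := id hP
  obtain ⟨D', hD', hQ1⟩ := id hQ'
  obtain ⟨S, hS, hQS⟩ := hQ'.exists_bound (by positivity)
  have hI := integral_weight_nonneg (n := n) (n + 1 + δ)
  refine ⟨2 * (D * D') * (2 ^ (n + 1 + δ) * 2 * ∫ u : Eu n, (1 + ‖u‖) ^ (-(n + 1 + δ))),
    by positivity, fun a M hm ha y hy x x' => ?_⟩
  have hM : 0 ≤ M := (norm_nonneg _).trans (ha 0 0)
  set F' : Eu n → Eu n → (Eu n →L[ℝ] ℂ) := fun z w =>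
    (a w y * P (y⁻¹ • (w - x'))) • (-(y⁻¹ • fderiv ℝ Q (y⁻¹ • (w - z)))) with hF'
  have hnorm : ∀ z w, ‖F' z w‖ = ‖a w y‖ * ‖P (y⁻¹ • (w - x'))‖ *
      (y⁻¹ * ‖fderiv ℝ Q (y⁻¹ • (w - z))‖) := by
    intro z w
    rw [hF']
    simp only [norm_smul, norm_neg, norm_mul, norm_inv, Real.norm_of_nonneg hy.le]
  have key : HasFDerivAt (fun z => ∫ w, a w y * (P (y⁻¹ • (w - x')) * Q (y⁻¹ • (w - z))))
      (∫ w, F' x w) x := by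
    refine hasFDerivAt_integral_of_dominated_of_fderiv_le (F' := F')
      (bound := fun w => M * ‖P (y⁻¹ • (w - x'))‖ * (y⁻¹ * S)) univ_mem
      (.of_forall fun z => aestronglyMeasurable_compKernel_integrand hm hPc hQd.continuous y z x')
      (integrable_compKernel_integrand hm ha hN hP hQ hPc hQd.continuous hy x x') ?_ ?_ ?_ ?_
    · have h1 : AEStronglyMeasurable (fun w => a w y * P (y⁻¹ • (w - x'))) :=
        (hm.comp (f := fun w => (w, y)) (by fun_prop)).aestronglyMeasurable.mul (by fun_prop)
      have h2 : Measurable (fun w => -(y⁻¹ • fderiv ℝ Q (y⁻¹ • (w - x)))) :=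
        (((measurable_fderiv ℝ Q).comp (f := fun w => y⁻¹ • (w - x)) (by fun_prop)).const_smul
          y⁻¹).neg
      exact h1.smul h2.aestronglyMeasurable
    · refine .of_forall fun w z _ => ?_
      rw [hnorm]
      have := ha w y
      have := hQS (y⁻¹ • (w - z))
      gcongr
    · exact (((integrable_dilate hPi hy).comp_sub_right x').norm.const_mul M).mul_const _
    · refine .of_forall fun w z _ => ?_
      have := (hasFDerivAt_dilate_sub hQd y w z).const_mul (a w y * P (y⁻¹ • (w - x')))
      simpa only [mul_assoc] using this
  have key2 := key.const_mul (((2 * y * ((y ^ (n + 1))⁻¹) ^ 2 : ℝ) : ℂ))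
  refine ⟨key2.differentiableAt, ?_⟩
  have e : fderiv ℝ (fun z => compKernel a P Q y z x') x = _ := key2.fderiv
  rw [e, norm_smul, Complex.norm_real, Real.norm_of_nonneg (by positivity)]
  have hb := norm_integral_le_weight (N := n + 1 + δ) hN hy (D := M * (D * D') * y⁻¹)
    (by positivity) (x := x) (x' := x') (F := F' x) (fun w => by
      rw [hnorm]
      have h1 := hP1 (y⁻¹ • (w - x'))
      have h2 := hQ1 (y⁻¹ • (w - x))
      rw [norm_inv_smul hy] at h1 h2
      have := ha w y
      calc _ ≤ M * (D * (1 + ‖w - x'‖ / y) ^ (-((n : ℝ) + 1 + δ))) *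
            (y⁻¹ * (D' * (1 + ‖w - x‖ / y) ^ (-((n : ℝ) + 1 + δ)))) := by gcongr
        _ = _ := by ring)
  refine (mul_le_mul_of_nonneg_left hb (by positivity)).trans (le_of_eq ?_)
  rw [prof, ← scale_one hy]
  ring

lemma hasGradBound_of_decay {P Q : Eu n → ℂ} {δ : ℝ} (hδ : 0 < δ)
    (hPd : Differentiable ℝ P) (hP : HasDecay P (n + 1 + δ))
    (hP' : HasDecay (fderiv ℝ P) (n + 1 + δ)) (hQd : Differentiable ℝ Q)
    (hQ : HasDecay Q (n + 1 + δ)) (hQ' : HasDecay (fderiv ℝ Q) (n + 1 + δ)) :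
    HasGradBound (fun _ => True) P Q δ := by
  obtain ⟨C₁, hC₁, h₁⟩ := exists_grad_fst_of_decay hδ hPd.continuous hP hQd hQ' hQ
  obtain ⟨C₂, hC₂, h₂⟩ := exists_grad_fst_of_decay hδ hQd.continuous hQ hPd hP' hP
  refine ⟨C₁ + C₂, by positivity, fun a M _ hm ha y hy x x' => ?_⟩
  have hM : 0 ≤ M := (norm_nonneg _).trans (ha 0 0)
  have hp := prof_nonneg (m := n + 1) (δ := δ) (norm_nonneg (x - x')) hy
  obtain ⟨d1, g1⟩ := h₁ a M hm ha y hy x x'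
  obtain ⟨d2, g2⟩ := h₂ a M hm ha y hy x' x
  have e : (fun z => compKernel a P Q y x z) = fun z => compKernel a Q P y z x := by
    funext z; exact compKernel_swap a P Q y x z
  rw [e]
  refine ⟨d1, g1.trans ?_, d2, g2.trans ?_⟩
  · gcongr; linarith
  · rw [norm_sub_rev x' x]; gcongr; linarith

/-- The correlation of two profiles. -/
def correlation (P Q : Eu n → ℂ) (u : Eu n) : ℂ := ∫ w, P (w + u) * Q w

/-- A coefficient constant in space leaves the integral, and what remains is translation invariant;
a translation by `x` and a dilation by `y` normalise it. -/
lemma compKernel_eq_correlation {a : Eu n → ℝ → ℂ} (ha : ∀ x x' y, a x y = a x' y)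
    (P Q : Eu n → ℂ) {y : ℝ} (hy : 0 < y) (x x' : Eu n) :
    compKernel a P Q y x x' = (((2 * y * ((y ^ (n + 1))⁻¹) ^ 2 * y ^ n : ℝ) : ℂ) * a 0 y) *
      correlation P Q (y⁻¹ • (x - x')) := by
  have e : ∫ z, a z y * (P (y⁻¹ • (z - x')) * Q (y⁻¹ • (z - x))) =
      a 0 y * (((y ^ n : ℝ) : ℂ) * correlation P Q (y⁻¹ • (x - x'))) := by
    have h1 : ∀ z, a z y * (P (y⁻¹ • (z - x')) * Q (y⁻¹ • (z - x))) =
        a 0 y * (fun w => P (y⁻¹ • w + y⁻¹ • (x - x')) * Q (y⁻¹ • w)) (z - x) := by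
      intro z
      rw [ha z 0 y]
      simp only [← smul_add, sub_add_sub_cancel]
    simp only [h1]
    rw [integral_const_mul, integral_sub_right_eq_self
      (fun w => P (y⁻¹ • w + y⁻¹ • (x - x')) * Q (y⁻¹ • w)) x]
    have h2 := Measure.integral_comp_inv_smul_of_nonneg volume
      (fun w : Eu n => P (w + y⁻¹ • (x - x')) * Q w) hy.le
    rw [h2]
    simp [correlation]
  rw [compKernel, e]
  push_cast
  ring

/-- Here only the correlation needs a derivative with `n + 1 + δ` orders of decay. The profiles
themselves may decay more slowly, as the height profile does. -/
lemma hasGradBound_of_correlation {P Q : Eu n → ℂ} {δ : ℝ}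
    (hG : Differentiable ℝ (correlation P Q))
    (hG' : HasDecay (fderiv ℝ (correlation P Q)) (n + 1 + δ)) :
    HasGradBound (fun a => ∀ x x' y, a x y = a x' y) P Q δ := by
  obtain ⟨D, hD, hG'⟩ := hG'
  refine ⟨2 * D, by positivity, fun a M hR _ ha y hy x x' => ?_⟩
  have hM : 0 ≤ M := (norm_nonneg _).trans (ha 0 0)
  set c : ℂ := ((2 * y * ((y ^ (n + 1))⁻¹) ^ 2 * y ^ n : ℝ) : ℂ) * a 0 y with hc
  have hcn : ‖c‖ ≤ 2 * y * ((y ^ (n + 1))⁻¹) ^ 2 * y ^ n * M := by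
    rw [hc, norm_mul, Complex.norm_real, Real.norm_of_nonneg (by positivity)]
    gcongr
    exact ha 0 y
  have hbound : ∀ L : Eu n →L[ℝ] ℂ, ‖L‖ = y⁻¹ * ‖fderiv ℝ (correlation P Q) (y⁻¹ • (x - x'))‖ →
      ‖c • L‖ ≤ 2 * D * M * prof (n + 1) δ ‖x - x'‖ y := by
    intro L hL
    have h1 := hG' (y⁻¹ • (x - x'))
    rw [norm_inv_smul hy] at h1
    rw [norm_smul, hL]
    calc _ ≤ (2 * y * ((y ^ (n + 1))⁻¹) ^ 2 * y ^ n * M) *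
          (y⁻¹ * (D * (1 + ‖x - x'‖ / y) ^ (-((n : ℝ) + 1 + δ)))) := by gcongr
      _ = _ := by rw [prof, ← scale_one hy]; ring
  have e1 : (fun z => compKernel a P Q y z x') =
      fun z => c * correlation P Q (y⁻¹ • (z - x')) := by
    funext z; exact compKernel_eq_correlation hR P Q hy z x'
  have e2 : (fun z => compKernel a P Q y x z) =
      fun z => c * correlation P Q (y⁻¹ • (x - z)) := by
    funext z; exact compKernel_eq_correlation hR P Q hy x z
  have d1 : HasFDerivAt (fun z => correlation P Q (y⁻¹ • (z - x')))
      (y⁻¹ • fderiv ℝ (correlation P Q) (y⁻¹ • (x - x'))) x := by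
    have h1 : HasFDerivAt (fun z : Eu n => y⁻¹ • (z - x'))
        (y⁻¹ • ContinuousLinearMap.id ℝ (Eu n)) x :=
      ((hasFDerivAt_id x).sub_const x').const_smul y⁻¹
    have h2 := (hG (y⁻¹ • (x - x'))).hasFDerivAt.comp x h1
    refine h2.congr_fderiv ?_
    ext v
    simp
  have d2 := hasFDerivAt_dilate_sub hG y x x'
  have hy' : ‖y⁻¹‖ = y⁻¹ := Real.norm_of_nonneg (by positivity)
  rw [e1, e2]
  refine ⟨(d1.const_mul c).differentiableAt, ?_, (d2.const_mul c).differentiableAt, ?_⟩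
  · rw [(d1.const_mul c).fderiv]
    exact hbound _ (by rw [norm_smul, hy'])
  · rw [(d2.const_mul c).fderiv]
    exact hbound _ (by rw [norm_neg, norm_smul, hy'])

end Gradient

/-! ### Plancherel's theorem for the Fourier integral -/

section Plancherel

open FourierTransform

variable {n : ℕ}

lemma integral_fourier_mul_eq {f g : Eu n → ℂ} (hf : Integrable f) (hg : Integrable g) :
    ∫ ξ, 𝓕 f ξ * g ξ = ∫ x, f x * 𝓕 g x := by
  have := VectorFourier.integral_fourierIntegral_smul_eq_flip (μ := volume) (ν := volume)
    (L := innerₗ (Eu n)) Real.continuous_fourierChar continuous_inner hf hg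
  simp only [flip_innerₗ] at this
  exact this

lemma continuous_fourier {f : Eu n → ℂ} (hf : Integrable f) : Continuous (𝓕 f) :=
  VectorFourier.fourierIntegral_continuous Real.continuous_fourierChar
    (by exact continuous_inner) hf

lemma norm_fourier_le {f : Eu n → ℂ} (ξ : Eu n) : ‖𝓕 f ξ‖ ≤ ∫ x, ‖f x‖ :=
  VectorFourier.norm_fourierIntegral_le_integral_norm _ _ _ _ _

/-- Plancherel's theorem for the Fourier integral on `L¹ ∩ L²`. -/
lemma eLpNorm_fourier {f : Eu n → ℂ} (hf : Integrable f) (hf2 : MemLp f 2 volume) :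
    eLpNorm (𝓕 f) 2 volume = eLpNorm f 2 volume := by
  set F : Lp ℂ 2 (volume : Measure (Eu n)) := 𝓕 (hf2.toLp) with hF
  have hae : ∀ᵐ x, (F : Eu n → ℂ) x = 𝓕 f x := by
    -- Against a test function `G`, both transforms pair as `∫ 𝓕 G * f`: the `L²` transform by its
    -- compatibility with tempered distributions, the Fourier integral by `integral_fourier_mul_eq`.
    refine ae_eq_of_integral_contDiff_smul_eq
      ((Lp.memLp F).locallyIntegrable (by norm_num))
      (continuous_fourier hf).locallyIntegrable fun g hg hgs => ?_
    obtain ⟨G, hG⟩ : ∃ G : 𝓢(Eu n, ℂ), ∀ x, G x = (g x : ℂ) := by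
      have hgs' : HasCompactSupport (⇑Complex.ofRealCLM ∘ g) := hgs.comp_left (by simp)
      have hgc := Complex.ofRealCLM.contDiff.comp hg
      exact ⟨hgs'.toSchwartzMap hgc, fun x => rfl⟩
    have h1 : (𝓕 ((hf2.toLp : Lp ℂ 2 (volume : Measure (Eu n))) : 𝓢'(Eu n, ℂ))) G =
        (F : 𝓢'(Eu n, ℂ)) G := by
      rw [Lp.fourier_toTemperedDistribution_eq]
    rw [TemperedDistribution.fourier_apply, Lp.toTemperedDistribution_apply,
      Lp.toTemperedDistribution_apply] at h1
    have h2 : ∫ x, g x • (F : Eu n → ℂ) x = ∫ x, G x • (F : Eu n → ℂ) x := by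
      refine integral_congr_ae (.of_forall fun x => ?_)
      simp [hG]
    rw [h2, ← h1]
    have h3 : ∫ x, (𝓕 G) x • (hf2.toLp : Eu n → ℂ) x = ∫ x, 𝓕 (G : Eu n → ℂ) x * f x := by
      refine integral_congr_ae ?_
      filter_upwards [hf2.coeFn_toLp] with x hx
      rw [hx, smul_eq_mul, SchwartzMap.fourier_coe]
    rw [h3, integral_fourier_mul_eq G.integrable hf]
    refine integral_congr_ae (.of_forall fun x => ?_)
    simp [hG]
  have h1 : eLpNorm (𝓕 f) 2 volume = eLpNorm F 2 volume :=
    eLpNorm_congr_ae (hae.mono fun x hx => hx.symm)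
  have h2 : eLpNorm f 2 volume = eLpNorm (hf2.toLp : Eu n → ℂ) 2 volume :=
    eLpNorm_congr_ae hf2.coeFn_toLp.symm
  have h3 : ‖F‖ = ‖(hf2.toLp : Lp ℂ 2 (volume : Measure (Eu n)))‖ := Lp.norm_fourier_eq _
  rw [h1, h2]
  rw [Lp.norm_def, Lp.norm_def] at h3
  exact (ENNReal.toReal_eq_toReal_iff' (Lp.eLpNorm_ne_top _) (Lp.eLpNorm_ne_top _)).1 h3

end Plancherel

/-! ### Profiles and their square functions -/

section SquareFunction

open FourierTransform

variable {n : ℕ}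

/-- A profile: a continuous function with `n + δ` orders of decay whose Fourier transform vanishes
at the origin and at infinity to a positive order. -/
structure IsProfile (P : Eu n → ℂ) (δ : ℝ) : Prop where
  continuous : Continuous P
  decay : HasDecay P (n + δ)
  fourier : ∃ D, 0 ≤ D ∧ ∀ ξ, ‖𝓕 P ξ‖ ≤ D * (‖ξ‖ ^ (δ / 2) * (1 + ‖ξ‖) ^ (-δ))

lemma IsProfile.integrable {P : Eu n → ℂ} {δ : ℝ} (hP : IsProfile P δ) (hδ : 0 < δ) :
    Integrable P :=
  hP.decay.integrable (by linarith) hP.continuous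

lemma IsProfile.integral_eq_zero {P : Eu n → ℂ} {δ : ℝ} (hP : IsProfile P δ) (hδ : 0 < δ) :
    ∫ u, P u = 0 := by
  obtain ⟨D, -, h⟩ := hP.fourier
  have h0 := h 0
  rw [norm_zero, Real.zero_rpow (by positivity), zero_mul, mul_zero] at h0
  have h1 : 𝓕 P 0 = 0 := norm_le_zero_iff.1 h0
  rw [Real.fourier_eq] at h1
  simpa using h1

/-- The convolution of `f` with the profile `P` at scale `y`. -/
def profConv (P f : Eu n → ℂ) (y : ℝ) (z : Eu n) : ℂ := ∫ x', P (y⁻¹ • (z - x')) * f x'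

lemma profConv_eq_convolution (P f : Eu n → ℂ) (y : ℝ) :
    profConv P f y =
      MeasureTheory.convolution f (fun u => P (y⁻¹ • u)) (ContinuousLinearMap.mul ℂ ℂ) volume := by
  funext z
  simp only [profConv, convolution_def, ContinuousLinearMap.mul_apply']
  congr 1; funext x'; ring

lemma fourier_dilate (P : Eu n → ℂ) {y : ℝ} (hy : 0 < y) (ξ : Eu n) :
    𝓕 (fun u => P (y⁻¹ • u)) ξ = ((y ^ n : ℝ) : ℂ) * 𝓕 P (y • ξ) := by
  rw [Real.fourier_eq, Real.fourier_eq]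
  have h := Measure.integral_comp_inv_smul_of_nonneg volume
    (fun w : Eu n => Real.fourierChar (-inner ℝ w (y • ξ)) • P w) hy.le
  rw [finrank_euclideanSpace_fin] at h
  have e : (fun v : Eu n => Real.fourierChar (-inner ℝ v ξ) • P (y⁻¹ • v)) =
      fun v => Real.fourierChar (-inner ℝ (y⁻¹ • v) (y • ξ)) • P (y⁻¹ • v) := by
    funext v
    rw [real_inner_smul_left, real_inner_smul_right, inv_mul_cancel_left₀ hy.ne']
  rw [e]
  refine h.trans ?_
  rw [Complex.real_smul]

lemma fourier_profConv {P f : Eu n → ℂ} (hP : Integrable P) (hf : Integrable f) {y : ℝ}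
    (hy : 0 < y) (ξ : Eu n) :
    𝓕 (profConv P f y) ξ = 𝓕 f ξ * (((y ^ n : ℝ) : ℂ) * 𝓕 P (y • ξ)) := by
  rw [profConv_eq_convolution, Real.fourier_mul_convolution_eq hf (integrable_dilate hP hy),
    fourier_dilate P hy]

lemma integrable_profConv {P f : Eu n → ℂ} (hP : Integrable P) (hf : Integrable f) {y : ℝ}
    (hy : 0 < y) : Integrable (profConv P f y) := by
  rw [profConv_eq_convolution]
  exact hf.integrable_convolution _ (integrable_dilate hP hy)

lemma norm_profConv_le {P f : Eu n → ℂ} {D : ℝ} (hP : ∀ u, ‖P u‖ ≤ D)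
    (hf : Integrable f) (y : ℝ) (z : Eu n) : ‖profConv P f y z‖ ≤ D * ∫ x, ‖f x‖ := by
  rw [← integral_const_mul]
  refine norm_integral_le_of_norm_le (hf.norm.const_mul D) (.of_forall fun x => ?_)
  rw [norm_mul]
  gcongr
  exact hP _

lemma memLp_profConv {P f : Eu n → ℂ} {D : ℝ} (hP : Integrable P) (hPD : ∀ u, ‖P u‖ ≤ D)
    (hf : Integrable f) {y : ℝ} (hy : 0 < y) : MemLp (profConv P f y) 2 volume := by
  have hi := integrable_profConv hP hf hy
  rw [memLp_two_iff_integrable_sq_norm hi.aestronglyMeasurable]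
  refine (hi.norm.const_mul (D * ∫ x, ‖f x‖)).mono' (hi.norm.aestronglyMeasurable.pow 2)
    (.of_forall fun z => ?_)
  rw [Real.norm_of_nonneg (by positivity), sq]
  gcongr
  exact norm_profConv_le hPD hf y z

/-- The measure `dy / y` is scale invariant, so the bound cannot depend on `|ξ|`. Vanishing of `m`
at the origin gives convergence at small heights, and its decay gives convergence at large ones. -/
lemma lintegral_multiplier_le {m : Eu n → ℂ} {δ D : ℝ} (hδ : 0 < δ)
    (hm : ∀ ξ, ‖m ξ‖ ≤ D * (‖ξ‖ ^ (δ / 2) * (1 + ‖ξ‖) ^ (-δ))) (ξ : Eu n) :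
    ∫⁻ y in Ioi (0 : ℝ), ENNReal.ofReal y⁻¹ * ‖m (y • ξ)‖ₑ ^ 2 ≤
      ENNReal.ofReal (D ^ 2 * (1 / δ + 1 / δ)) := by
  rcases eq_or_ne ξ 0 with rfl | hξ
  · have h0 : m 0 = 0 := by
      have := hm 0
      rw [norm_zero, Real.zero_rpow (by positivity), zero_mul, mul_zero] at this
      exact norm_le_zero_iff.1 this
    simp [h0]
  have hs : 0 < ‖ξ‖ := norm_pos_iff.2 hξ
  obtain ⟨i1, i2⟩ := integrableOn_prof hδ hδ (inv_pos.2 hs)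
  have hb : ∀ y ∈ Ioi (0 : ℝ), ENNReal.ofReal y⁻¹ * ‖m (y • ξ)‖ₑ ^ 2 ≤
      ENNReal.ofReal (D ^ 2 * ‖ξ‖ ^ (-δ) * prof δ δ ‖ξ‖⁻¹ y) := by
    intro y hy
    have hy : 0 < y := hy
    rw [← ofReal_norm, ← ENNReal.ofReal_pow (norm_nonneg _), ← ENNReal.ofReal_mul (by positivity)]
    refine ENNReal.ofReal_le_ofReal ?_
    have h1 := hm (y • ξ)
    rw [norm_smul, Real.norm_of_nonneg hy.le] at h1
    have hys : 0 < y * ‖ξ‖ := by positivity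
    calc y⁻¹ * ‖m (y • ξ)‖ ^ 2
        ≤ y⁻¹ * (D * ((y * ‖ξ‖) ^ (δ / 2) * (1 + y * ‖ξ‖) ^ (-δ))) ^ 2 := by gcongr
      _ = D ^ 2 * (y⁻¹ * ((y * ‖ξ‖) ^ (δ / 2)) ^ 2 * ((1 + y * ‖ξ‖) ^ (-δ)) ^ 2) := by ring
      _ = _ := by
        -- With `t = y|ξ|`, writing `1 + t = t (1 + 1/t)` turns `t^δ (1 + t)^(-2δ) / y` into `prof δ
        -- δ` at distance `|ξ|⁻¹`, whose integral is known.
        have e1 : 1 + y * ‖ξ‖ = (y * ‖ξ‖) * (1 + ‖ξ‖⁻¹ / y) := by field_simp; ring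
        have h2 : 0 < 1 + ‖ξ‖⁻¹ / y := by positivity
        rw [e1, ← Real.rpow_natCast (_ ^ (δ / 2)), ← Real.rpow_natCast (_ ^ (-δ)),
          ← Real.rpow_mul hys.le, ← Real.rpow_mul (by positivity), prof,
          Real.mul_rpow hys.le h2.le, Real.mul_rpow hy.le hs.le, Real.mul_rpow hy.le hs.le,
          Real.rpow_sub_one hy.ne']
        have e2 : (δ / 2 * ((2 : ℕ) : ℝ)) = δ := by push_cast; ring
        have e3 : (-δ * ((2 : ℕ) : ℝ)) = -(δ + δ) := by push_cast; ring
        have e4 : ∀ t : ℝ, 0 < t → t ^ δ * t ^ (-(δ + δ)) = t ^ (-δ) := fun t ht => by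
          rw [← Real.rpow_add ht]; ring_nf
        rw [e2, e3]
        rw [← e4 y hy, ← e4 ‖ξ‖ hs]
        field_simp
  refine (setLIntegral_mono' measurableSet_Ioi hb).trans ?_
  rw [← ofReal_integral_eq_lintegral_ofReal (i1.const_mul _) ?_]
  · refine ENNReal.ofReal_le_ofReal ?_
    rw [integral_const_mul]
    refine (mul_le_mul_of_nonneg_left i2 (by positivity)).trans (le_of_eq ?_)
    have : ‖ξ‖ ^ (-δ) * (‖ξ‖⁻¹) ^ (-δ) = 1 := by
      rw [← Real.mul_rpow hs.le (by positivity), mul_inv_cancel₀ hs.ne', Real.one_rpow]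
    linear_combination (D ^ 2 * (1 / δ + 1 / δ)) * this
  · filter_upwards [ae_restrict_mem measurableSet_Ioi] with y hy
    have := prof_nonneg (m := δ) (δ := δ) (inv_pos.2 hs).le hy
    simp only [Pi.zero_apply]
    positivity

end SquareFunction

/-! ### The `L²` bound for a single coefficient -/

section L2Bound

open FourierTransform

variable {n : ℕ}

/-- The square of the vertical square function of `f` at height `y`, on the Fourier side. -/
def sqFourier (P f : Eu n → ℂ) (y : ℝ) : ℝ≥0∞ :=
  ∫⁻ ξ, ‖𝓕 f ξ‖ₑ ^ 2 * (ENNReal.ofReal y⁻¹ * ‖𝓕 P (y • ξ)‖ₑ ^ 2)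

lemma measurable_sqFourier_integrand {P f : Eu n → ℂ} (hP : Integrable P) (hf : Integrable f) :
    Measurable (fun p : ℝ × Eu n =>
      ‖𝓕 f p.2‖ₑ ^ 2 * (ENNReal.ofReal p.1⁻¹ * ‖𝓕 P (p.1 • p.2)‖ₑ ^ 2)) := by
  have h1 : Measurable (fun p : ℝ × Eu n => 𝓕 f p.2) :=
    (continuous_fourier hf).measurable.comp _root_.measurable_snd
  have h2 : Measurable (fun p : ℝ × Eu n => 𝓕 P (p.1 • p.2)) :=
    (continuous_fourier hP).measurable.comp (by fun_prop)
  fun_prop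

lemma measurable_sqFourier {P f : Eu n → ℂ} (hP : Integrable P) (hf : Integrable f) :
    Measurable (sqFourier P f) :=
  (measurable_sqFourier_integrand hP hf).lintegral_prod_right'

/-- Plancherel. The dilation contributes `y^(2n)` to the squared norm, and with the weight `y ·
y^(-2n-2)` this leaves exactly `y⁻¹`. -/
lemma sqFourier_eq {P f : Eu n → ℂ} {D : ℝ} (hP : Integrable P) (hPD : ∀ u, ‖P u‖ ≤ D)
    (hf : Integrable f) {y : ℝ} (hy : 0 < y) :
    ENNReal.ofReal (y * ((y ^ (n + 1))⁻¹) ^ 2) * eLpNorm (profConv P f y) 2 volume ^ 2 =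
      sqFourier P f y := by
  rw [← eLpNorm_fourier (integrable_profConv hP hf hy) (memLp_profConv hP hPD hf hy),
    eLpNorm_two_sq, ← lintegral_const_mul' _ _ ENNReal.ofReal_ne_top, sqFourier]
  refine lintegral_congr fun ξ => ?_
  rw [fourier_profConv hP hf hy, enorm_mul, enorm_mul, mul_pow, mul_pow]
  have e : ‖((y ^ n : ℝ) : ℂ)‖ₑ = ENNReal.ofReal (y ^ n) := by
    rw [← ofReal_norm, Complex.norm_real, Real.norm_of_nonneg (by positivity)]
  have e2 : ENNReal.ofReal (y * ((y ^ (n + 1))⁻¹) ^ 2) * ENNReal.ofReal (y ^ n) ^ 2 =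
      ENNReal.ofReal y⁻¹ := by
    rw [← ENNReal.ofReal_pow (by positivity), ← ENNReal.ofReal_mul (by positivity)]
    congr 1
    field_simp
    ring
  rw [e, ← e2]
  ring

lemma lintegral_sqFourier_le {P f : Eu n → ℂ} {δ D : ℝ} (hδ : 0 < δ)
    (hm : ∀ ξ, ‖𝓕 P ξ‖ ≤ D * (‖ξ‖ ^ (δ / 2) * (1 + ‖ξ‖) ^ (-δ))) (hP : Integrable P)
    (hf : Integrable f) (hf2 : MemLp f 2 volume) :
    ∫⁻ y in Ioi (0 : ℝ), sqFourier P f y ≤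
      ENNReal.ofReal (D ^ 2 * (1 / δ + 1 / δ)) * eLpNorm f 2 volume ^ 2 := by
  unfold sqFourier
  rw [lintegral_lintegral_swap (measurable_sqFourier_integrand hP hf).aemeasurable]
  have h1 : ∀ ξ : Eu n, ∫⁻ y in Ioi (0 : ℝ),
      ‖𝓕 f ξ‖ₑ ^ 2 * (ENNReal.ofReal y⁻¹ * ‖𝓕 P (y • ξ)‖ₑ ^ 2) ≤
      ENNReal.ofReal (D ^ 2 * (1 / δ + 1 / δ)) * ‖𝓕 f ξ‖ₑ ^ 2 := by
    intro ξ
    rw [lintegral_const_mul' _ _ (by simp), mul_comm]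
    gcongr
    exact lintegral_multiplier_le hδ hm ξ
  refine (lintegral_mono h1).trans (le_of_eq ?_)
  rw [lintegral_const_mul' _ _ ENNReal.ofReal_ne_top, ← eLpNorm_two_sq, eLpNorm_fourier hf hf2]

lemma integrable_prod_of_bounded {P h g : Eu n → ℂ} (hP : Continuous P) {D : ℝ}
    (hPD : ∀ u, ‖P u‖ ≤ D) (hh : Integrable h) (hg : Integrable g) (y : ℝ) :
    Integrable (fun p : Eu n × Eu n => h p.2 * (P (y⁻¹ • (p.2 - p.1)) * g p.1))
      (volume.prod volume) := by
  have h1 : Integrable (fun p : Eu n × Eu n => g p.1 * h p.2) (volume.prod volume) :=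
    hg.mul_prod hh
  have h2 := h1.bdd_mul (f := fun p : Eu n × Eu n => P (y⁻¹ • (p.2 - p.1))) (by fun_prop)
    (.of_forall fun p => hPD _)
  refine h2.congr (.of_forall fun p => ?_)
  simp only
  ring

lemma integral_swap_profConv {P h g : Eu n → ℂ} (hP : Continuous P) {D : ℝ}
    (hPD : ∀ u, ‖P u‖ ≤ D) (hh : Integrable h) (hg : Integrable g) (y : ℝ) :
    ∫ x, (∫ z, h z * P (y⁻¹ • (z - x))) * g x = ∫ z, h z * profConv P g y z := by
  have e : ∀ x, (∫ z, h z * P (y⁻¹ • (z - x))) * g x =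
      ∫ z, h z * (P (y⁻¹ • (z - x)) * g x) := by
    intro x
    rw [← integral_mul_const]
    simp only [mul_assoc]
  simp only [e]
  rw [integral_integral_swap (integrable_prod_of_bounded hP hPD hh hg y)]
  simp only [integral_const_mul, profConv]

/-- Two applications of Fubini leave the integral over the common point `z` outermost, so that the
coefficient only multiplies and can be estimated by its supremum. -/
lemma integral_compKernel_mul_mul {a : Eu n → ℝ → ℂ} {M : ℝ}
    (hm : Measurable (fun p : Eu n × ℝ => a p.1 p.2)) (ha : ∀ x y, ‖a x y‖ ≤ M)
    {P Q : Eu n → ℂ} {D : ℝ} (hP : Integrable P) (hQ : Integrable Q) (hPc : Continuous P)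
    (hQc : Continuous Q) (hPD : ∀ u, ‖P u‖ ≤ D) (hQD : ∀ u, ‖Q u‖ ≤ D) {f g : Eu n → ℂ}
    (hf : Integrable f) (hg : Integrable g) {y : ℝ} (hy : 0 < y) :
    ∫ x, (∫ x', compKernel a P Q y x x' * f x') * g x =
      ((2 * y * ((y ^ (n + 1))⁻¹) ^ 2 : ℝ) : ℂ) *
        ∫ z, a z y * (profConv P f y z * profConv Q g y z) := by
  have ham : AEStronglyMeasurable (fun z => a z y) :=
    (hm.comp (f := fun z => (z, y)) (by fun_prop)).aestronglyMeasurable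
  have h1 : ∀ x, ∫ x', compKernel a P Q y x x' * f x' =
      ((2 * y * ((y ^ (n + 1))⁻¹) ^ 2 : ℝ) : ℂ) *
        ∫ z, (a z y * profConv P f y z) * Q (y⁻¹ • (z - x)) := by
    intro x
    have hh : Integrable (fun z => a z y * Q (y⁻¹ • (z - x))) :=
      ((integrable_dilate hQ hy).comp_sub_right x).bdd_mul ham (.of_forall fun z => ha z y)
    have := integral_swap_profConv hPc hPD hh hf y
    simp only [compKernel, mul_assoc, integral_const_mul]
    congr 1
    have e1 : ∀ z x', a z y * (P (y⁻¹ • (z - x')) * Q (y⁻¹ • (z - x))) =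
        a z y * Q (y⁻¹ • (z - x)) * P (y⁻¹ • (z - x')) := fun z x' => by ring
    simp only [e1]
    rw [this]
    congr 1; funext z; ring
  have hh : Integrable (fun z => a z y * profConv P f y z) :=
    (integrable_profConv hP hf hy).bdd_mul ham (.of_forall fun z => ha z y)
  have := integral_swap_profConv hQc hQD hh hg y
  simp only [h1, mul_assoc, integral_const_mul] at this ⊢
  rw [this]

lemma enorm_integral_mul_mul_le {X : Type*} [MeasurableSpace X] {μ : Measure X} {a u v : X → ℂ}
    {M : ℝ} (ha : ∀ x, ‖a x‖ ≤ M) (hu : AEStronglyMeasurable u μ) (hv : AEStronglyMeasurable v μ) :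
    ‖∫ x, a x * (u x * v x) ∂μ‖ₑ ≤ ENNReal.ofReal M * (eLpNorm u 2 μ * eLpNorm v 2 μ) := by
  refine (enorm_integral_le_lintegral_enorm _).trans ?_
  have h1 : ∀ x, ‖a x * (u x * v x)‖ₑ ≤ ENNReal.ofReal M * (‖u x‖ₑ * ‖v x‖ₑ) := by
    intro x
    rw [enorm_mul, enorm_mul]
    gcongr
    rw [← ofReal_norm]
    exact ENNReal.ofReal_le_ofReal (ha x)
  refine (lintegral_mono h1).trans ?_
  rw [lintegral_const_mul' _ _ ENNReal.ofReal_ne_top]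
  gcongr
  have := ENNReal.lintegral_mul_le_Lp_mul_Lq μ (p := 2) (q := 2) Real.HolderConjugate.two_two
    hu.enorm hv.enorm
  simp only [eLpNorm_eq_lintegral_rpow_enorm_toReal two_ne_zero ENNReal.ofNat_ne_top]
  exact this

/-- Cauchy–Schwarz in space at each height, then Cauchy–Schwarz in the height. Each factor is a
square function, bounded on `L²` by `lintegral_sqFourier_le`. -/
lemma lintegral_compKernel_le {P Q : Eu n → ℂ} {δ : ℝ} (hδ : 0 < δ) (hP : IsProfile P δ)
    (hQ : IsProfile Q δ) :
    ∃ C, 0 ≤ C ∧ ∀ (a : Eu n → ℝ → ℂ) (M : ℝ), Measurable (fun p : Eu n × ℝ => a p.1 p.2) →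
      (∀ x y, ‖a x y‖ ≤ M) → ∀ (f g : Eu n → ℂ), Integrable f → MemLp f 2 volume →
      Integrable g → MemLp g 2 volume →
      ∫⁻ y in Ioi (0 : ℝ), ‖∫ x, (∫ x', compKernel a P Q y x x' * f x') * g x‖ₑ ≤
        ENNReal.ofReal (C * M) * eLpNorm f 2 volume * eLpNorm g 2 volume := by
  have hPi := hP.integrable hδ
  have hQi := hQ.integrable hδ
  obtain ⟨D₁, -, h₁⟩ := hP.fourier
  obtain ⟨D₂, -, h₂⟩ := hQ.fourier
  obtain ⟨S₁, -, hS₁⟩ := hP.decay.exists_bound (by positivity)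
  obtain ⟨S₂, -, hS₂⟩ := hQ.decay.exists_bound (by positivity)
  set A₁ := D₁ ^ 2 * (1 / δ + 1 / δ) with hA₁
  set A₂ := D₂ ^ 2 * (1 / δ + 1 / δ) with hA₂
  have hA₁0 : 0 ≤ A₁ := by positivity
  have hA₂0 : 0 ≤ A₂ := by positivity
  refine ⟨2 * (Real.sqrt A₁ * Real.sqrt A₂), by positivity,
    fun a M hm ha f g hf hf2 hg hg2 => ?_⟩
  have hM : 0 ≤ M := (norm_nonneg _).trans (ha 0 0)
  have hpt : ∀ y ∈ Ioi (0 : ℝ), ‖∫ x, (∫ x', compKernel a P Q y x x' * f x') * g x‖ₑ ≤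
      ENNReal.ofReal (2 * M) *
        (sqFourier P f y ^ (1 / 2 : ℝ) * sqFourier Q g y ^ (1 / 2 : ℝ)) := by
    intro y hy
    have hy : 0 < y := hy
    rw [integral_compKernel_mul_mul hm ha hPi hQi hP.continuous hQ.continuous
      (D := max S₁ S₂) (fun u => (hS₁ u).trans (le_max_left _ _))
      (fun u => (hS₂ u).trans (le_max_right _ _)) hf hg hy, enorm_mul]
    set w := y * ((y ^ (n + 1))⁻¹) ^ 2 with hw
    have hw0 : 0 ≤ w := by positivity
    -- The weight is split into two equal square roots, one for each square function.
    have e : ‖((2 * y * ((y ^ (n + 1))⁻¹) ^ 2 : ℝ) : ℂ)‖ₑ =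
        ENNReal.ofReal 2 * (ENNReal.ofReal w ^ (1 / 2 : ℝ) * ENNReal.ofReal w ^ (1 / 2 : ℝ)) := by
      rw [← ofReal_norm, Complex.norm_real, Real.norm_of_nonneg (by positivity),
        ← ENNReal.rpow_add_of_nonneg _ _ (by norm_num) (by norm_num),
        show (1 / 2 + 1 / 2 : ℝ) = 1 by norm_num, ENNReal.rpow_one,
        ← ENNReal.ofReal_mul (by norm_num), hw]
      congr 1
      ring
    have hsq : ∀ t : ℝ≥0∞, (t ^ 2) ^ (1 / 2 : ℝ) = t := fun t => by
      rw [← ENNReal.rpow_natCast, ← ENNReal.rpow_mul]; norm_num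
    rw [e, ← sqFourier_eq hPi hS₁ hf hy, ← sqFourier_eq hQi hS₂ hg hy,
      ENNReal.mul_rpow_of_nonneg _ _ (by norm_num), ENNReal.mul_rpow_of_nonneg _ _ (by norm_num),
      hsq, hsq, ENNReal.ofReal_mul (q := M) zero_le_two]
    refine (mul_le_mul_right (enorm_integral_mul_mul_le (fun z => ha z y)
      (integrable_profConv hPi hf hy).aestronglyMeasurable
      (integrable_profConv hQi hg hy).aestronglyMeasurable) _).trans (le_of_eq ?_)
    rw [← hw]
    ring
  refine (setLIntegral_mono' measurableSet_Ioi hpt).trans ?_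
  rw [lintegral_const_mul' _ _ ENNReal.ofReal_ne_top]
  have hH := ENNReal.lintegral_mul_le_Lp_mul_Lq (volume.restrict (Ioi (0 : ℝ)))
    (p := 2) (q := 2) Real.HolderConjugate.two_two
    ((measurable_sqFourier hPi hf).pow_const (1 / 2 : ℝ)).aemeasurable
    ((measurable_sqFourier hQi hg).pow_const (1 / 2 : ℝ)).aemeasurable
  have hroot : ∀ t : ℝ≥0∞, (t ^ (1 / 2 : ℝ)) ^ (2 : ℝ) = t := fun t => by
    rw [← ENNReal.rpow_mul]; norm_num
  simp only [Pi.mul_apply, hroot] at hH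
  have hfin : ∀ (A : ℝ) (N : ℝ≥0∞), 0 ≤ A → (ENNReal.ofReal A * N ^ 2) ^ (1 / 2 : ℝ) =
      ENNReal.ofReal (Real.sqrt A) * N := by
    intro A N hA
    rw [ENNReal.mul_rpow_of_nonneg _ _ (by norm_num), ← ENNReal.rpow_natCast N,
      ← ENNReal.rpow_mul, ENNReal.ofReal_rpow_of_nonneg hA (by norm_num), Real.sqrt_eq_rpow]
    norm_num
  have h3 : (∫⁻ y in Ioi (0 : ℝ), sqFourier P f y) ^ (1 / 2 : ℝ) ≤
      ENNReal.ofReal (Real.sqrt A₁) * eLpNorm f 2 volume := by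
    rw [← hfin _ _ hA₁0]
    exact ENNReal.rpow_le_rpow (lintegral_sqFourier_le hδ h₁ hPi hf hf2) (by norm_num)
  have h4 : (∫⁻ y in Ioi (0 : ℝ), sqFourier Q g y) ^ (1 / 2 : ℝ) ≤
      ENNReal.ofReal (Real.sqrt A₂) * eLpNorm g 2 volume := by
    rw [← hfin _ _ hA₂0]
    exact ENNReal.rpow_le_rpow (lintegral_sqFourier_le hδ h₂ hQi hg hg2) (by norm_num)
  calc _ ≤ ENNReal.ofReal (2 * M) * ((ENNReal.ofReal (Real.sqrt A₁) * eLpNorm f 2 volume) *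
        (ENNReal.ofReal (Real.sqrt A₂) * eLpNorm g 2 volume)) := by
        gcongr
        exact hH.trans (mul_le_mul' h3 h4)
    _ = _ := by
        rw [show 2 * (Real.sqrt A₁ * Real.sqrt A₂) * M =
          2 * M * (Real.sqrt A₁ * Real.sqrt A₂) by ring,
          ENNReal.ofReal_mul (p := 2 * M) (by positivity),
          ENNReal.ofReal_mul (p := Real.sqrt A₁) (by positivity)]
        ring

/-- The slices of a single coefficient form a Calderón–Zygmund family. -/
theorem exists_isCZSlices_compKernel {R : (Eu n → ℝ → ℂ) → Prop} {P Q : Eu n → ℂ} {δ : ℝ}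
    (hδ : 0 < δ) (hP : IsProfile P δ) (hQ : IsProfile Q δ) (hgrad : HasGradBound R P Q δ) :
    ∃ C, 0 ≤ C ∧ ∀ (a : Eu n → ℝ → ℂ) (M : ℝ), R a →
      Measurable (fun p : Eu n × ℝ => a p.1 p.2) → (∀ x y, ‖a x y‖ ≤ M) →
      IsCZSlices (compKernel a P Q) (C * M) δ := by
  obtain ⟨C₁, hC₁, h₁⟩ := exists_size_compKernel hδ hP.decay hQ.decay
  obtain ⟨C₂, hC₂, h₂⟩ := hgrad
  obtain ⟨C₃, hC₃, h₃⟩ := lintegral_compKernel_le hδ hP hQ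
  refine ⟨C₁ + C₂ + C₃, by positivity, fun a M hR hm ha => ?_⟩
  have hM : 0 ≤ M := (norm_nonneg _).trans (ha 0 0)
  have hprof : ∀ (m : ℝ) (y : ℝ), 0 < y → ∀ x x' : Eu n, 0 ≤ prof m δ ‖x - x'‖ y :=
    fun m y hy x x' => prof_nonneg (norm_nonneg _) hy
  have hle₂ : ∀ y, 0 < y → ∀ x x' : Eu n, C₂ * M * prof (n + 1) δ ‖x - x'‖ y ≤
      (C₁ + C₂ + C₃) * M * prof (n + 1) δ ‖x - x'‖ y := fun y hy x x' => by
    have := hprof (n + 1) y hy x x'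
    gcongr
    linarith
  refine ⟨by positivity, measurable_compKernel hm hP.continuous hQ.continuous,
    fun y hy x x' => ((h₁ a M ha y hy x x').1).trans ?_,
    fun y hy x => integral_compKernel_eq_zero hm ha (hP.integrable hδ) (hQ.integrable hδ)
      (hP.integral_eq_zero hδ) hy x,
    fun y hy x x' => (h₂ a M hR hm ha y hy x x').1,
    fun y hy x x' => (h₂ a M hR hm ha y hy x x').2.2.1,
    fun y hy x x' => (h₂ a M hR hm ha y hy x x').2.1.trans (hle₂ y hy x x'),
    fun y hy x x' => (h₂ a M hR hm ha y hy x x').2.2.2.trans (hle₂ y hy x x'),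
    fun f g hg hg2 => (h₃ a M hm ha f g f.integrable (f.memLp 2 volume) hg hg2).trans ?_⟩
  · have := hprof n y hy x x'
    gcongr
    linarith
  · gcongr
    linarith

end L2Bound

/-! ### Finite sums of slice families -/

namespace IsCZSlices

variable {n : ℕ}

lemma zero (δ : ℝ) : IsCZSlices (fun (_ : ℝ) (_ _ : Eu n) => (0 : ℂ)) 0 δ := by
  refine ⟨le_rfl, measurable_const, ?_, ?_, ?_, ?_, ?_, ?_, ?_⟩ <;> intros <;> simp

lemma integrable_slice_mul {k : ℝ → Eu n → Eu n → ℂ} {B δ : ℝ} (hk : IsCZSlices k B δ)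
    (hδ : 0 < δ) {y : ℝ} (hy : 0 < y) (f : 𝓢(Eu n, ℂ)) {g : Eu n → ℂ} (hg : Integrable g) :
    Integrable (fun x => (∫ x', k y x x' * f x') * g x) := by
  refine hg.bdd_mul (c := B * y ^ (-(n : ℝ) - 1) * ∫ x', ‖f x'‖) ?_ (.of_forall fun x => ?_)
  · exact ((hk.stronglyMeasurable_slice_integral_univ f).comp_measurable
      (g := fun x => (y, x)) (by fun_prop)).aestronglyMeasurable
  · rw [← integral_const_mul]
    refine norm_integral_le_of_norm_le (f.integrable.norm.const_mul _) (.of_forall fun x' => ?_)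
    rw [norm_mul]
    gcongr
    exact hk.size_le hδ hy x x'

lemma add {k₁ k₂ : ℝ → Eu n → Eu n → ℂ} {B₁ B₂ δ : ℝ} (hδ : 0 < δ) (h₁ : IsCZSlices k₁ B₁ δ)
    (h₂ : IsCZSlices k₂ B₂ δ) :
    IsCZSlices (fun y x x' => k₁ y x x' + k₂ y x x') (B₁ + B₂) δ := by
  refine ⟨add_nonneg h₁.nonneg h₂.nonneg, h₁.measurable.add h₂.measurable, ?_, ?_, ?_, ?_, ?_, ?_,
    ?_⟩
  · intro y hy x x'
    rw [add_mul]
    exact (norm_add_le _ _).trans (add_le_add (h₁.size y hy x x') (h₂.size y hy x x'))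
  · intro y hy x
    rw [integral_add (h₁.integrable hδ hy x) (h₂.integrable hδ hy x), h₁.cancel y hy,
      h₂.cancel y hy, add_zero]
  · exact fun y hy x x' => (h₁.diff_fst y hy x x').add (h₂.diff_fst y hy x x')
  · exact fun y hy x x' => (h₁.diff_snd y hy x x').add (h₂.diff_snd y hy x x')
  · intro y hy x x'
    rw [add_mul, fderiv_fun_add (h₁.diff_fst y hy x x') (h₂.diff_fst y hy x x')]
    exact (norm_add_le _ _).trans (add_le_add (h₁.grad_fst y hy x x') (h₂.grad_fst y hy x x'))
  · intro y hy x x'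
    rw [add_mul, fderiv_fun_add (h₁.diff_snd y hy x x') (h₂.diff_snd y hy x x')]
    exact (norm_add_le _ _).trans (add_le_add (h₁.grad_snd y hy x x') (h₂.grad_snd y hy x x'))
  · intro f g hg hg2
    have hpt : ∀ y ∈ Ioi (0 : ℝ), ‖∫ x, (∫ x', (k₁ y x x' + k₂ y x x') * f x') * g x‖ₑ ≤
        ‖∫ x, (∫ x', k₁ y x x' * f x') * g x‖ₑ + ‖∫ x, (∫ x', k₂ y x x' * f x') * g x‖ₑ := by
      intro y hy
      refine le_trans (le_of_eq ?_) (enorm_add_le _ _)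
      rw [← integral_add (h₁.integrable_slice_mul hδ hy f hg) (h₂.integrable_slice_mul hδ hy f hg)]
      congr 2
      funext x
      rw [← add_mul, ← integral_add (h₁.integrable_mul hδ hy x f.integrable)
        (h₂.integrable_mul hδ hy x f.integrable)]
      simp only [add_mul]
    refine (setLIntegral_mono' measurableSet_Ioi hpt).trans ?_
    rw [lintegral_add_left']
    · rw [ENNReal.ofReal_add h₁.nonneg h₂.nonneg, add_mul, add_mul]
      exact add_le_add (h₁.l2 f g hg hg2) (h₂.l2 f g hg hg2)
    · refine AEStronglyMeasurable.enorm ?_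
      have hm : AEStronglyMeasurable (fun p : ℝ × Eu n => (∫ x', k₁ p.1 p.2 x' * f x') * g p.2)
          ((volume.restrict (Ioi (0 : ℝ))).prod volume) :=
        (h₁.stronglyMeasurable_slice_integral_univ f).aestronglyMeasurable.mul
          hg.aestronglyMeasurable.comp_snd
      exact hm.integral_prod_right'

lemma sum {ι : Type*} (s : Finset ι) {k : ι → ℝ → Eu n → Eu n → ℂ} {B : ι → ℝ} {δ : ℝ}
    (hδ : 0 < δ) (h : ∀ i ∈ s, IsCZSlices (k i) (B i) δ) :
    IsCZSlices (fun y x x' => ∑ i ∈ s, k i y x x') (∑ i ∈ s, B i) δ := by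
  classical
  induction s using Finset.induction_on with
  | empty => simpa using zero δ
  | insert i s hi ih =>
    simp only [Finset.sum_insert hi]
    exact add hδ (h i (Finset.mem_insert_self i s))
      (ih fun j hj => h j (Finset.mem_insert_of_mem hj))

end IsCZSlices

/-! ### Iterated differences -/

section Differences

/-- Each difference at most doubles the bound and moves the argument by at most `‖h‖`. -/
lemma norm_iterate_fwdDiff_le {V : Type*} [NormedAddCommGroup V] (h : V) (K : ℕ) (r : V → ℂ)
    (ξ : V) {b : ℝ} (hb : ∀ u, ‖u - ξ‖ ≤ K * ‖h‖ → ‖r u‖ ≤ b) :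
    ‖(fwdDiff h)^[K] r ξ‖ ≤ 2 ^ K * b := by
  induction K generalizing r b with
  | zero => simpa using hb ξ (by simp)
  | succ K ih =>
    rw [Function.iterate_succ_apply]
    refine (ih (fwdDiff h r) (b := 2 * b) fun u hu => ?_).trans (le_of_eq (by ring))
    have h1 : ‖r (u + h)‖ ≤ b := hb _ (by
      rw [add_sub_right_comm]
      refine (norm_add_le _ _).trans ?_
      push_cast
      linarith)
    have h2 : ‖r u‖ ≤ b := hb _ (by
      push_cast
      linarith [norm_nonneg h])
    have := norm_sub_le (r (u + h)) (r u)
    rw [fwdDiff]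
    linarith

/-- Cauchy estimate for iterated differences of a holomorphic function. -/
lemma norm_iterate_fwdDiff_one_le {s : ℝ} (hs : 1 < s) (K : ℕ) {F : ℂ → ℂ} {b : ℝ}
    (hF : DifferentiableOn ℂ F (Metric.ball 0 ((K + 1) * s)))
    (hb : ∀ t ∈ Metric.ball (0 : ℂ) ((K + 1) * s), ‖F t‖ ≤ b) :
    ‖(fwdDiff (1 : ℂ))^[K] F 0‖ ≤ b * (2 / (s - 1)) ^ K := by
  induction K generalizing F b with
  | zero => simpa using hb 0 (by simp; linarith)
  | succ K ih =>
    rw [Function.iterate_succ_apply]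
    -- One difference uses a segment of length `1` and, for Cauchy's bound on the derivative,
    -- circles of radius `(s - 1) / 2`. Together that is `(s + 1) / 2`, less than the `s` by which
    -- the radius drops.
    have hsub : ∀ t ∈ Metric.ball (0 : ℂ) ((K + 1) * s), ∀ u ∈ segment ℝ t (t + 1),
        Metric.closedBall u ((s - 1) / 2) ⊆ Metric.ball 0 (((K + 1 : ℕ) + 1) * s) := by
      intro t ht u hu z hz
      rw [Metric.mem_ball, dist_zero_right] at ht ⊢
      rw [Metric.mem_closedBall, dist_eq_norm] at hz
      have h1 : ‖u - t‖ ≤ 1 := by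
        have := norm_sub_le_of_mem_segment hu
        simpa using this
      have h2 : ‖z‖ ≤ ‖z - u‖ + ‖u - t‖ + ‖t‖ := by
        have : z = (z - u) + (u - t) + t := by ring
        conv_lhs => rw [this]
        exact norm_add₃_le
      push_cast
      linarith
    have hshift : ∀ t ∈ Metric.ball (0 : ℂ) ((K + 1) * s),
        t ∈ Metric.ball (0 : ℂ) (((K + 1 : ℕ) + 1) * s) ∧
        t + 1 ∈ Metric.ball (0 : ℂ) (((K + 1 : ℕ) + 1) * s) := fun t ht =>
      ⟨hsub t ht t (left_mem_segment ℝ _ _) (Metric.mem_closedBall_self (by linarith)),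
        hsub t ht (t + 1) (right_mem_segment ℝ _ _) (Metric.mem_closedBall_self (by linarith))⟩
    have hball := Metric.isOpen_ball (x := (0 : ℂ)) (ε := ((K + 1 : ℕ) + 1) * s)
    have hF' : ∀ t ∈ Metric.ball (0 : ℂ) (((K + 1 : ℕ) + 1) * s), DifferentiableAt ℂ F t :=
      fun t ht => hF.differentiableAt (hball.mem_nhds ht)
    have hd : DifferentiableOn ℂ (fwdDiff (1 : ℂ) F) (Metric.ball 0 ((K + 1) * s)) := by
      intro t ht
      refine DifferentiableAt.differentiableWithinAt ?_
      refine DifferentiableAt.sub ?_ (hF' t (hshift t ht).1)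
      exact (hF' (t + 1) (hshift t ht).2).comp t (by fun_prop)
    have hbd : ∀ t ∈ Metric.ball (0 : ℂ) ((K + 1) * s),
        ‖fwdDiff (1 : ℂ) F t‖ ≤ b * (2 / (s - 1)) := by
      intro t ht
      have hmv := (convex_segment t (t + 1)).norm_image_sub_le_of_norm_deriv_le (𝕜 := ℂ) (f := F)
        (C := b / ((s - 1) / 2))
        (fun u hu => hF' u (hsub t ht u hu (Metric.mem_closedBall_self (by linarith))))
        (fun u hu => Complex.norm_deriv_le_of_forall_mem_sphere_norm_le (by linarith)
          ((hF.mono (hsub t ht u hu)).diffContOnCl_ball subset_rfl)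
          (fun z hz => hb z (hsub t ht u hu (Metric.sphere_subset_closedBall hz))))
        (left_mem_segment ℝ _ _) (right_mem_segment ℝ _ _)
      rw [fwdDiff]
      refine hmv.trans (le_of_eq ?_)
      rw [add_sub_cancel_left, norm_one, mul_one]
      field_simp
    refine (ih hd hbd).trans (le_of_eq (by ring))

end Differences

/-! ### Decay of inverse Fourier transforms by differences -/

section FourierDecay

open FourierTransform

variable {n : ℕ}

/-- The step `h` is half a period of the character at `x`: translating `m` by it only changes the
sign of the inverse transform, so the two terms of the difference add up instead of cancelling. -/
lemma fourierInv_fwdDiff {m : Eu n → ℂ} (hm : Integrable m) (h x : Eu n)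
    (hx : inner ℝ h x = 1 / 2) : 𝓕⁻ (fwdDiff h m) x = -2 * 𝓕⁻ m x := by
  have h_int : ∀ {f : Eu n → ℂ}, Integrable f →
      Integrable (fun v => Real.fourierChar (inner ℝ v x) • f v) := fun {f} hf => by
    have := (Real.fourierIntegral_convergent_iff (μ := volume) (f := f) (-x)).2 hf
    simpa using this
  have hm' : Integrable (fun v => m (v + h)) := hm.comp_add_right h
  rw [Real.fourierInv_eq, Real.fourierInv_eq]
  simp only [fwdDiff, smul_sub]
  rw [integral_sub (h_int hm') (h_int hm)]
  have e : ∫ v, Real.fourierChar (inner ℝ v x) • m (v + h) =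
      - ∫ v, Real.fourierChar (inner ℝ v x) • m v := by
    rw [← integral_neg, ← integral_add_right_eq_self
      (fun v => -(Real.fourierChar (inner ℝ v x) • m v)) h]
    refine integral_congr_ae (.of_forall fun v => ?_)
    have hhalf : (Real.fourierChar (1 / 2 : ℝ) : ℂ) = -1 := by
      rw [Real.fourierChar_apply]
      have : ((2 * Real.pi * (1 / 2) : ℝ) : ℂ) * Complex.I = Real.pi * Complex.I := by
        push_cast; ring
      rw [this, Complex.exp_pi_mul_I]
    simp only [inner_add_left, hx, AddChar.map_add_eq_mul, Circle.smul_def, Circle.coe_mul, hhalf]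
    simp
  rw [e]
  ring

lemma integrable_iterate_fwdDiff {m : Eu n → ℂ} (hm : Integrable m) (h : Eu n) (K : ℕ) :
    Integrable ((fwdDiff h)^[K] m) := by
  induction K with
  | zero => simpa using hm
  | succ K ih =>
    rw [Function.iterate_succ_apply']
    exact (ih.comp_add_right h).sub ih

lemma fourierInv_iterate_fwdDiff {m : Eu n → ℂ} (hm : Integrable m) (h x : Eu n)
    (hx : inner ℝ h x = 1 / 2) (K : ℕ) : 𝓕⁻ ((fwdDiff h)^[K] m) x = (-2) ^ K * 𝓕⁻ m x := by
  induction K with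
  | zero => simp
  | succ K ih =>
    rw [Function.iterate_succ_apply', fourierInv_fwdDiff (integrable_iterate_fwdDiff hm h K) h x hx,
      ih]
    ring

/-- The product of linear forms times a radial function. -/
def polyRadial {l : ℕ} (v : Fin l → Eu n) (g : ℂ → ℂ) (ξ : Eu n) : ℂ :=
  (∏ i, ((inner ℝ (v i) ξ : ℝ) : ℂ)) * g ((‖ξ‖ ^ 2 : ℝ) : ℂ)

lemma norm_prod_inner_le {l : ℕ} {v : Fin l → Eu n} (hv : ∀ i, ‖v i‖ ≤ 1) (ξ : Eu n) :
    ‖∏ i, ((inner ℝ (v i) ξ : ℝ) : ℂ)‖ ≤ ‖ξ‖ ^ l := by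
  rw [norm_prod]
  calc _ ≤ ∏ _i : Fin l, ‖ξ‖ := by
        refine Finset.prod_le_prod (fun i _ => norm_nonneg _) fun i _ => ?_
        rw [Complex.norm_real]
        refine (norm_inner_le_norm _ _).trans ?_
        exact mul_le_of_le_one_left (norm_nonneg _) (hv i)
    _ = _ := by simp

lemma norm_polyRadial_le {l : ℕ} {v : Fin l → Eu n} (hv : ∀ i, ‖v i‖ ≤ 1) {g : ℂ → ℂ} {C a : ℝ}
    (ha : 0 ≤ a) (hgb : ∀ w : ℂ, 0 ≤ w.re → ‖g w‖ ≤ C * ‖w‖ ^ (a / 2)) (ξ : Eu n) :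
    ‖polyRadial v g ξ‖ ≤ C * ‖ξ‖ ^ (l + a) := by
  have h2 := hgb ((‖ξ‖ ^ 2 : ℝ) : ℂ) (by rw [Complex.ofReal_re]; positivity)
  have hpow : (‖ξ‖ ^ 2) ^ (a / 2) = ‖ξ‖ ^ a := by
    rw [← Real.rpow_natCast, ← Real.rpow_mul (norm_nonneg _)]
    congr 1
    push_cast
    ring
  rw [Complex.norm_real, Real.norm_of_nonneg (by positivity), hpow] at h2
  rw [polyRadial, norm_mul, Real.rpow_add_of_nonneg (norm_nonneg _) (by positivity) ha,
    Real.rpow_natCast]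
  calc _ ≤ ‖ξ‖ ^ l * (C * ‖ξ‖ ^ a) :=
        mul_le_mul (norm_prod_inner_le hv ξ) h2 (norm_nonneg _) (by positivity)
    _ = _ := by ring

/-- An iterated difference sees only the points `ξ + j h`, so any `F` that interpolates them may be
used: a polynomial or a holomorphic extension. -/
lemma iterate_fwdDiff_eq_line (r : Eu n → ℂ) (F : ℂ → ℂ) (h ξ : Eu n)
    (hrF : ∀ j : ℕ, r (ξ + j • h) = F j) (K : ℕ) :
    (fwdDiff h)^[K] r ξ = (fwdDiff (1 : ℂ))^[K] F 0 := by
  rw [fwdDiff_iter_eq_sum_shift, fwdDiff_iter_eq_sum_shift]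
  refine Finset.sum_congr rfl fun j _ => ?_
  rw [hrF]
  simp

/-- Along a line the product is a polynomial of degree at most `l`. Hence a polynomial part of a
multiplier has no influence on the decay. -/
lemma iterate_fwdDiff_prod_inner {l : ℕ} (v : Fin l → Eu n) {K : ℕ} (hK : l < K) (h ξ : Eu n) :
    (fwdDiff h)^[K] (fun ξ => ∏ i, ((inner ℝ (v i) ξ : ℝ) : ℂ)) ξ = 0 := by
  let p : Polynomial ℂ := ∏ i, (Polynomial.C ((inner ℝ (v i) ξ : ℝ) : ℂ) +
    Polynomial.C ((inner ℝ (v i) h : ℝ) : ℂ) * Polynomial.X)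
  have hp : p.natDegree ≤ l := by
    refine (Polynomial.natDegree_prod_le _ _).trans ?_
    calc _ ≤ ∑ _i : Fin l, 1 := Finset.sum_le_sum fun i _ => by compute_degree
      _ = l := by simp
  rw [iterate_fwdDiff_eq_line _ (fun t => p.eval t) h ξ]
  · have := Polynomial.fwdDiff_iter_eq_zero_of_degree_lt (hp.trans_lt hK)
    exact congrFun this 0
  · intro j
    simp only [p, Polynomial.eval_prod]
    refine Finset.prod_congr rfl fun i _ => ?_
    rw [inner_add_right, ← Nat.cast_smul_eq_nsmul ℝ, inner_smul_right]
    simp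
    ring

/-- On a line that stays away from the origin a radial function extends holomorphically, which
bounds its differences. -/
lemma norm_iterate_fwdDiff_polyRadial_far {l : ℕ} {v : Fin l → Eu n} (hv : ∀ i, ‖v i‖ ≤ 1)
    {g : ℂ → ℂ} {C a : ℝ} (hC : 0 ≤ C) (ha : 0 ≤ a)
    (hg : DifferentiableOn ℂ g {w | 0 < w.re})
    (hgb : ∀ w : ℂ, 0 ≤ w.re → ‖g w‖ ≤ C * ‖w‖ ^ (a / 2)) (K : ℕ) {h ξ : Eu n} (hh : h ≠ 0)
    (hξ : 8 * (K + 1) * ‖h‖ ≤ ‖ξ‖) :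
    ‖(fwdDiff h)^[K] (polyRadial v g) ξ‖ ≤
      (2 ^ l * (C * 2 ^ (a / 2)) * ‖ξ‖ ^ (l + a)) * (16 * (K + 1) * ‖h‖ / ‖ξ‖) ^ K := by
  have hh0 : 0 < ‖h‖ := norm_pos_iff.2 hh
  have hξ0 : 0 < ‖ξ‖ := lt_of_lt_of_le (by positivity) hξ
  -- Chosen so that the disc of radius `(K + 1) s` moves `ξ` by at most `|ξ| / 4`; the hypothesis
  -- `hξ` gives `s ≥ 2`.
  set s : ℝ := ‖ξ‖ / (4 * (K + 1) * ‖h‖) with hs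
  have hs2 : 2 ≤ s := by
    rw [hs, le_div_iff₀ (by positivity)]
    linarith
  have hT : ((K : ℝ) + 1) * s * ‖h‖ = ‖ξ‖ / 4 := by rw [hs]; field_simp
  -- The holomorphic continuation of `t ↦ |ξ + t h|²`.
  set q : ℂ → ℂ := fun t => ((‖ξ‖ ^ 2 : ℝ) : ℂ) + 2 * t * ((inner ℝ ξ h : ℝ) : ℂ) +
    t ^ 2 * ((‖h‖ ^ 2 : ℝ) : ℂ) with hq
  set F : ℂ → ℂ := fun t =>
    (∏ i, (((inner ℝ (v i) ξ : ℝ) : ℂ) + t * ((inner ℝ (v i) h : ℝ) : ℂ))) * g (q t) with hF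
  have hth : ∀ t ∈ Metric.ball (0 : ℂ) ((K + 1) * s), ‖t‖ * ‖h‖ ≤ ‖ξ‖ / 4 := by
    intro t ht
    rw [Metric.mem_ball, dist_zero_right] at ht
    rw [← hT]
    gcongr
  -- `9/16 = 2 · (1/4) + (1/4)²`. As it is below `1`, `q` stays in the right half-plane, where `g`
  -- is holomorphic.
  have hqd : ∀ t ∈ Metric.ball (0 : ℂ) ((K + 1) * s),
      ‖q t - ((‖ξ‖ ^ 2 : ℝ) : ℂ)‖ ≤ 9 / 16 * ‖ξ‖ ^ 2 := by
    intro t ht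
    have h1 := hth t ht
    have h2 : |inner ℝ ξ h| ≤ ‖ξ‖ * ‖h‖ := abs_real_inner_le_norm ξ h
    have e : q t - ((‖ξ‖ ^ 2 : ℝ) : ℂ) =
        2 * t * ((inner ℝ ξ h : ℝ) : ℂ) + t ^ 2 * ((‖h‖ ^ 2 : ℝ) : ℂ) := by
      rw [hq]; ring
    rw [e]
    refine (norm_add_le _ _).trans ?_
    rw [norm_mul, norm_mul, norm_mul, norm_pow, Complex.norm_real, Complex.norm_real,
      Real.norm_eq_abs, Real.norm_of_nonneg (by positivity : 0 ≤ ‖h‖ ^ 2), Complex.norm_ofNat]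
    have h3 : 2 * ‖t‖ * |inner ℝ ξ h| ≤ 2 * ‖t‖ * (‖ξ‖ * ‖h‖) := by gcongr
    have h4 : 0 ≤ ‖t‖ * ‖h‖ := by positivity
    nlinarith
  have hqre : ∀ t ∈ Metric.ball (0 : ℂ) ((K + 1) * s), 0 < (q t).re := by
    intro t ht
    have h1 := hqd t ht
    have h2 := (Complex.abs_re_le_norm (q t - ((‖ξ‖ ^ 2 : ℝ) : ℂ))).trans h1
    rw [Complex.sub_re, Complex.ofReal_re] at h2
    have h3 := (abs_le.1 h2).1
    have : 0 < ‖ξ‖ ^ 2 := by positivity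
    linarith
  have hqn : ∀ t ∈ Metric.ball (0 : ℂ) ((K + 1) * s), ‖q t‖ ≤ 2 * ‖ξ‖ ^ 2 := by
    intro t ht
    have h1 := hqd t ht
    have h2 : ‖q t‖ ≤ ‖q t - ((‖ξ‖ ^ 2 : ℝ) : ℂ)‖ + ‖((‖ξ‖ ^ 2 : ℝ) : ℂ)‖ := by
      have := norm_add_le (q t - ((‖ξ‖ ^ 2 : ℝ) : ℂ)) ((‖ξ‖ ^ 2 : ℝ) : ℂ)
      rwa [sub_add_cancel] at this
    rw [Complex.norm_real, Real.norm_of_nonneg (by positivity)] at h2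
    have : 0 < ‖ξ‖ ^ 2 := by positivity
    linarith
  have hprod : ∀ t ∈ Metric.ball (0 : ℂ) ((K + 1) * s),
      ‖∏ i, (((inner ℝ (v i) ξ : ℝ) : ℂ) + t * ((inner ℝ (v i) h : ℝ) : ℂ))‖ ≤
        (2 * ‖ξ‖) ^ l := by
    intro t ht
    have h1 := hth t ht
    rw [norm_prod]
    calc _ ≤ ∏ _i : Fin l, (2 * ‖ξ‖) := by
          refine Finset.prod_le_prod (fun i _ => norm_nonneg _) fun i _ => ?_
          refine (norm_add_le _ _).trans ?_
          rw [norm_mul, Complex.norm_real, Complex.norm_real, Real.norm_eq_abs, Real.norm_eq_abs]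
          have h2 : |inner ℝ (v i) ξ| ≤ ‖ξ‖ := (abs_real_inner_le_norm _ _).trans
            (mul_le_of_le_one_left (norm_nonneg _) (hv i))
          have h3 : |inner ℝ (v i) h| ≤ ‖h‖ := (abs_real_inner_le_norm _ _).trans
            (mul_le_of_le_one_left (norm_nonneg _) (hv i))
          have h4 : ‖t‖ * |inner ℝ (v i) h| ≤ ‖t‖ * ‖h‖ := by gcongr
          linarith
      _ = _ := by simp
  have hFb : ∀ t ∈ Metric.ball (0 : ℂ) ((K + 1) * s),
      ‖F t‖ ≤ 2 ^ l * (C * 2 ^ (a / 2)) * ‖ξ‖ ^ (l + a) := by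
    intro t ht
    have hpow : (‖ξ‖ ^ 2) ^ (a / 2) = ‖ξ‖ ^ a := by
      rw [← Real.rpow_natCast, ← Real.rpow_mul (norm_nonneg _)]
      congr 1
      push_cast
      ring
    have h2 : ‖g (q t)‖ ≤ C * (2 ^ (a / 2) * ‖ξ‖ ^ a) := by
      refine (hgb _ (hqre t ht).le).trans ?_
      rw [← hpow, ← Real.mul_rpow (by norm_num) (by positivity)]
      have := hqn t ht
      gcongr
    rw [hF]
    simp only [norm_mul]
    refine (mul_le_mul (hprod t ht) h2 (norm_nonneg _) (by positivity)).trans (le_of_eq ?_)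
    rw [Real.rpow_add_of_nonneg (norm_nonneg _) (by positivity) ha, Real.rpow_natCast, mul_pow]
    ring
  have hFd : DifferentiableOn ℂ F (Metric.ball 0 ((K + 1) * s)) := by
    rw [hF]
    refine DifferentiableOn.mul (by fun_prop) ?_
    exact hg.comp (by rw [hq]; fun_prop) fun t ht => hqre t ht
  rw [iterate_fwdDiff_eq_line (polyRadial v g) F h ξ ?_ K]
  · refine (norm_iterate_fwdDiff_one_le (by linarith) K hFd hFb).trans ?_
    have e : 16 * ((K : ℝ) + 1) * ‖h‖ / ‖ξ‖ = 4 / s := by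
      rw [hs]; field_simp; ring
    have e2 : 2 / (s - 1) ≤ 16 * ((K : ℝ) + 1) * ‖h‖ / ‖ξ‖ := by
      rw [e, div_le_div_iff₀ (by linarith) (by linarith)]
      linarith
    exact mul_le_mul_of_nonneg_left
      (pow_le_pow_left₀ (div_nonneg (by norm_num) (by linarith)) e2 K) (by positivity)
  · intro j
    simp only [hF, hq, polyRadial]
    congr 1
    · refine Finset.prod_congr rfl fun i _ => ?_
      rw [inner_add_right, ← Nat.cast_smul_eq_nsmul ℝ, inner_smul_right]
      push_cast
      ring
    · congr 1
      rw [← Nat.cast_smul_eq_nsmul ℝ, norm_add_sq_real, inner_smul_right, norm_smul,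
        Real.norm_of_nonneg (Nat.cast_nonneg j)]
      push_cast
      ring

/-- For `|ξ|` below a fixed multiple of `|h|` the growth bound at the points involved suffices.
Beyond it, Cauchy's estimate gives `|ξ|^(l+a) (|h| / |ξ|)^K`. Both have the homogeneity `|h|^(l+a)`,
which becomes the decay rate of the inverse transform. -/
lemma norm_iterate_fwdDiff_polyRadial_le {l : ℕ} {v : Fin l → Eu n} (hv : ∀ i, ‖v i‖ ≤ 1)
    {g : ℂ → ℂ} {C a : ℝ} (hC : 0 ≤ C) (ha : 0 ≤ a)
    (hg : DifferentiableOn ℂ g {w | 0 < w.re})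
    (hgb : ∀ w : ℂ, 0 ≤ w.re → ‖g w‖ ≤ C * ‖w‖ ^ (a / 2)) {K : ℕ} (hK : l + a < K) :
    ∃ D, 0 ≤ D ∧ ∀ h ξ : Eu n, h ≠ 0 → ‖(fwdDiff h)^[K] (polyRadial v g) ξ‖ ≤
      D * ‖h‖ ^ (l + a) * (1 + ‖ξ‖ / ‖h‖) ^ (-(K - (l + a))) := by
  set d : ℝ := l + a with hd
  have hd0 : 0 ≤ d := by positivity
  set R : ℝ := 8 * (K + 1) with hR
  have hR1 : 1 ≤ R := by
    have : (0 : ℝ) ≤ K := Nat.cast_nonneg K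
    rw [hR]; linarith
  have hKd : 0 < K - d := by linarith
  set D₁ : ℝ := 2 ^ K * (C * (R + K) ^ d) * (1 + R) ^ (K - d) with hD₁
  set D₂ : ℝ := 2 ^ l * (C * 2 ^ (a / 2)) * (16 * (K + 1)) ^ K * 2 ^ (K - d) with hD₂
  have hD₁0 : 0 ≤ D₁ := by positivity
  have hD₂0 : 0 ≤ D₂ := by positivity
  refine ⟨D₁ + D₂, by positivity, fun h ξ hh => ?_⟩
  have hh0 : 0 < ‖h‖ := norm_pos_iff.2 hh
  set τ := ‖ξ‖ / ‖h‖ with hτ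
  have hτ0 : 0 ≤ τ := by positivity
  have hξτ : ‖ξ‖ = τ * ‖h‖ := by rw [hτ]; field_simp
  rcases lt_or_ge τ R with hlt | hge
  · have h1 := norm_iterate_fwdDiff_le h K (polyRadial v g) ξ (b := C * ((R + K) * ‖h‖) ^ d)
      (fun u hu => by
        refine (norm_polyRadial_le hv ha hgb u).trans ?_
        have : ‖u‖ ≤ (R + K) * ‖h‖ := by
          have h2 := norm_add_le (u - ξ) ξ
          rw [sub_add_cancel] at h2
          have h3 : ‖ξ‖ ≤ R * ‖h‖ := by rw [hξτ]; gcongr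
          linarith
        gcongr)
    have h2 : 1 ≤ (1 + R) ^ (K - d) * (1 + τ) ^ (-(K - d)) := by
      rw [Real.rpow_neg (by positivity), ← div_eq_mul_inv, ← Real.div_rpow (by positivity)
        (by positivity)]
      refine Real.one_le_rpow ?_ hKd.le
      rw [le_div_iff₀ (by positivity)]
      linarith
    have h3 : 0 ≤ 2 ^ K * (C * (R + K) ^ d) * ‖h‖ ^ d := by positivity
    have h4 : 0 ≤ D₂ * ‖h‖ ^ d * (1 + τ) ^ (-(K - d)) := by positivity
    calc _ ≤ 2 ^ K * (C * ((R + K) * ‖h‖) ^ d) := h1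
      _ = 2 ^ K * (C * (R + K) ^ d) * ‖h‖ ^ d * 1 := by
          rw [Real.mul_rpow (by positivity) hh0.le]; ring
      _ ≤ 2 ^ K * (C * (R + K) ^ d) * ‖h‖ ^ d * ((1 + R) ^ (K - d) * (1 + τ) ^ (-(K - d))) := by
          gcongr
      _ = D₁ * ‖h‖ ^ d * (1 + τ) ^ (-(K - d)) := by rw [hD₁]; ring
      _ ≤ _ := by linarith
  · have hτ1 : 1 ≤ τ := hR1.trans hge
    have h1 := norm_iterate_fwdDiff_polyRadial_far hv hC ha hg hgb K hh (ξ := ξ) (by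
      rw [hξτ]; gcongr)
    have h2 : τ ^ (-(K - d)) ≤ 2 ^ (K - d) * (1 + τ) ^ (-(K - d)) := by
      rw [Real.rpow_neg hτ0, Real.rpow_neg (by positivity), ← div_eq_mul_inv,
        ← Real.div_rpow (by norm_num) (by positivity), ← Real.inv_rpow hτ0]
      refine Real.rpow_le_rpow (by positivity) ?_ hKd.le
      rw [inv_le_comm₀ (by linarith) (by positivity), inv_div, div_le_iff₀ (by norm_num)]
      linarith
    have h3 : 0 ≤ D₁ * ‖h‖ ^ d * (1 + τ) ^ (-(K - d)) := by positivity
    calc _ ≤ (2 ^ l * (C * 2 ^ (a / 2)) * ‖ξ‖ ^ d) * (16 * (K + 1) * ‖h‖ / ‖ξ‖) ^ K := h1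
      _ = 2 ^ l * (C * 2 ^ (a / 2)) * (16 * (K + 1)) ^ K * ‖h‖ ^ d * τ ^ (-(K - d)) := by
          have e1 : 16 * ((K : ℝ) + 1) * ‖h‖ / ‖ξ‖ = 16 * (K + 1) * τ⁻¹ := by
            rw [hτ]; field_simp
          rw [e1, mul_pow, hξτ, Real.mul_rpow hτ0 hh0.le, neg_sub, Real.rpow_sub (by linarith),
            Real.rpow_natCast, inv_pow]
          ring
      _ ≤ 2 ^ l * (C * 2 ^ (a / 2)) * (16 * (K + 1)) ^ K * ‖h‖ ^ d *
            (2 ^ (K - d) * (1 + τ) ^ (-(K - d))) := by gcongr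
      _ = D₂ * ‖h‖ ^ d * (1 + τ) ^ (-(K - d)) := by rw [hD₂]; ring
      _ ≤ _ := by linarith

lemma norm_fourierInv_le {m : Eu n → ℂ} (x : Eu n) : ‖𝓕⁻ m x‖ ≤ ∫ ξ, ‖m ξ‖ := by
  rw [Real.fourierInv_eq_fourier_neg]
  exact norm_fourier_le _

set_option maxHeartbeats 800000 in
/-- Decay of the inverse Fourier transform of a function which, up to terms killed by high
differences, is a homogeneous-type radial function times linear forms. -/
theorem hasDecay_fourierInv {m : Eu n → ℂ} (hm : Integrable m) {l : ℕ} {v : Fin l → Eu n}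
    (hv : ∀ i, ‖v i‖ ≤ 1) {g : ℂ → ℂ} {C a : ℝ} (hC : 0 ≤ C) (ha : 0 ≤ a)
    (hg : DifferentiableOn ℂ g {w | 0 < w.re})
    (hgb : ∀ w : ℂ, 0 ≤ w.re → ‖g w‖ ≤ C * ‖w‖ ^ (a / 2))
    (hdiff : ∀ K, l < K → ∀ h ξ, (fwdDiff h)^[K] m ξ = (fwdDiff h)^[K] (polyRadial v g) ξ) :
    HasDecay (𝓕⁻ m) (n + (l + a)) := by
  -- So many differences that `K - (l + a) > n`, which makes the bound on the difference integrable.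
  obtain ⟨K, hK⟩ := exists_nat_gt ((n : ℝ) + (l + a))
  have hn0 : (0 : ℝ) ≤ n := Nat.cast_nonneg n
  have hlK : l < K := by
    have : (l : ℝ) < K := by linarith
    exact_mod_cast this
  obtain ⟨D, hD, hb⟩ := norm_iterate_fwdDiff_polyRadial_le hv hC ha hg hgb (K := K) (by linarith)
  set d : ℝ := l + a with hd
  have hd0 : 0 ≤ d := by positivity
  set c := ∫ u : Eu n, (1 + ‖u‖) ^ (-(K - d)) with hc
  have hc0 : 0 ≤ c := integral_weight_nonneg _
  set I := ∫ ξ, ‖m ξ‖ with hI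
  have hI0 : 0 ≤ I := integral_nonneg fun ξ => norm_nonneg _
  refine ⟨I * 2 ^ (n + d) + D * c, by positivity, fun x => ?_⟩
  have hw0 : 0 ≤ (1 + ‖x‖) ^ (-(n + d)) := by positivity
  rcases le_total ‖x‖ 1 with hx | hx
  · refine (norm_fourierInv_le x).trans ?_
    have h1 : 1 ≤ 2 ^ (n + d) * (1 + ‖x‖) ^ (-(n + d)) := by
      rw [Real.rpow_neg (by positivity), ← div_eq_mul_inv, ← Real.div_rpow (by norm_num)
        (by positivity)]
      refine Real.one_le_rpow ?_ (by positivity)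
      rw [le_div_iff₀ (by positivity)]
      linarith
    have h2 : 0 ≤ D * c * (1 + ‖x‖) ^ (-(n + d)) := by positivity
    calc I = I * 1 := (mul_one _).symm
      _ ≤ I * (2 ^ (n + d) * (1 + ‖x‖) ^ (-(n + d))) := by gcongr
      _ ≤ _ := by linarith
  · have hx0 : 0 < ‖x‖ := by linarith
    -- The shortest `h` with `⟨h, x⟩ = 1/2`. As `|h| = 1 / (2|x|)`, the `L¹` norm `|h|^(n+l+a)` of
    -- the difference is the claimed decay.
    set h : Eu n := (2 * ‖x‖ ^ 2)⁻¹ • x with hh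
    have hhn : ‖h‖ = (2 * ‖x‖)⁻¹ := by
      rw [hh, norm_smul, Real.norm_of_nonneg (by positivity)]
      field_simp
    have hh0 : h ≠ 0 := by
      rw [← norm_pos_iff, hhn]; positivity
    have hhx : inner ℝ h x = 1 / 2 := by
      rw [hh, real_inner_smul_left, real_inner_self_eq_norm_sq]
      field_simp
    have hhpos : 0 < ‖h‖ := norm_pos_iff.2 hh0
    obtain ⟨i1, i2⟩ := integrable_comp_norm_div (n := n) (N := K - d) (by linarith) hhpos
    have key := congrArg norm (fourierInv_iterate_fwdDiff hm h x hhx K)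
    rw [norm_mul, norm_pow, norm_neg, Complex.norm_ofNat] at key
    have h1 : ‖𝓕⁻ ((fwdDiff h)^[K] m) x‖ ≤ D * ‖h‖ ^ d * (‖h‖ ^ n * c) := by
      refine (norm_fourierInv_le x).trans ?_
      rw [← i2, ← integral_const_mul]
      refine integral_mono (integrable_iterate_fwdDiff hm h K).norm (i1.const_mul _) fun ξ => ?_
      simp only
      rw [hdiff K hlK]
      exact hb h ξ hh0
    have h2 : ‖𝓕⁻ m x‖ ≤ 2 ^ K * ‖𝓕⁻ m x‖ :=
      le_mul_of_one_le_left (norm_nonneg _) (one_le_pow₀ (by norm_num))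
    have h3 : ‖h‖ ^ d * ‖h‖ ^ n ≤ (1 + ‖x‖) ^ (-(n + d)) := by
      rw [← Real.rpow_natCast, ← Real.rpow_add hhpos, hhn, Real.inv_rpow (by positivity),
        Real.rpow_neg (by positivity), add_comm d]
      gcongr
      linarith
    have h4 : 0 ≤ I * 2 ^ (n + d) * (1 + ‖x‖) ^ (-(n + d)) := by positivity
    rw [key] at h1
    calc ‖𝓕⁻ m x‖ ≤ D * ‖h‖ ^ d * (‖h‖ ^ n * c) := h2.trans h1
      _ = D * c * (‖h‖ ^ d * ‖h‖ ^ n) := by ring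
      _ ≤ D * c * (1 + ‖x‖) ^ (-(n + d)) := mul_le_mul_of_nonneg_left h3 (mul_nonneg hD hc0)
      _ ≤ _ := by
          rw [add_mul]
          exact le_add_of_nonneg_left h4

end FourierDecay

/-! ### The multipliers of the stable density and its derivatives -/

section StableMultiplier

open FourierTransform

variable {n l : ℕ}

/-- The multiplier `c · ∏ ⟨vᵢ, ξ⟩ · |ξ|^(kα) · exp(-b |ξ|^α)`. -/
def stab (b α : ℝ) (c : ℂ) (v : Fin l → Eu n) (k : ℕ) (ξ : Eu n) : ℂ :=
  c * (∏ i, ((inner ℝ (v i) ξ : ℝ) : ℂ)) *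
    (((‖ξ‖ ^ α) ^ k * Real.exp (-(b * ‖ξ‖ ^ α)) : ℝ) : ℂ)

lemma continuous_stab {b α : ℝ} (hα : 0 < α) (c : ℂ) (v : Fin l → Eu n) (k : ℕ) :
    Continuous (stab b α c v k) := by
  have h1 : Continuous (fun ξ : Eu n => ‖ξ‖ ^ α) :=
    continuous_norm.rpow_const fun _ => Or.inr hα.le
  unfold stab
  fun_prop

/-- The exponential of `b t^α` dominates its `k`-th Taylor term, of order `t^(αk)`, and `k` is taken
with `α k ≥ N`. -/
lemma exists_exp_neg_rpow_le {b α : ℝ} (hb : 0 < b) (hα : 0 < α) (N : ℝ) :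
    ∃ D, 0 ≤ D ∧ ∀ t : ℝ, 0 ≤ t → Real.exp (-(b * t ^ α)) ≤ D * (1 + t) ^ (-N) := by
  obtain ⟨k, hk⟩ := exists_nat_ge (N / α)
  have hkN : N ≤ α * k := by
    rw [div_le_iff₀ hα] at hk
    linarith
  refine ⟨2 ^ (α * k) * (1 + k.factorial / b ^ k), by positivity, fun t ht => ?_⟩
  have h1 : (1 + t) ^ N * Real.exp (-(b * t ^ α)) ≤
      2 ^ (α * k) * (1 + k.factorial / b ^ k) := by
    have h2 : (1 + t) ^ N ≤ (1 + t) ^ (α * k) :=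
      Real.rpow_le_rpow_of_exponent_le (by linarith) hkN
    have h3 : (1 + t) ^ (α * k) ≤ 2 ^ (α * k) * (1 + t ^ (α * k)) := by
      rcases le_total t 1 with h | h
      · calc (1 + t) ^ (α * k) ≤ 2 ^ (α * k) := by
              refine Real.rpow_le_rpow (by positivity) (by linarith) (by positivity)
          _ = 2 ^ (α * k) * 1 := (mul_one _).symm
          _ ≤ _ := by
              gcongr
              linarith [Real.rpow_nonneg ht (α * k)]
      · calc (1 + t) ^ (α * k) ≤ (2 * t) ^ (α * k) := by
              refine Real.rpow_le_rpow (by positivity) (by linarith) (by positivity)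
          _ = 2 ^ (α * k) * t ^ (α * k) := Real.mul_rpow (by norm_num) ht
          _ ≤ _ := by
              gcongr
              linarith
    have h4 : t ^ (α * k) * Real.exp (-(b * t ^ α)) ≤ k.factorial / b ^ k := by
      have h5 := Real.pow_div_factorial_le_exp (x := b * t ^ α) (by positivity) k
      rw [Real.rpow_mul ht, Real.rpow_natCast, Real.exp_neg, ← div_eq_mul_inv,
        div_le_div_iff₀ (Real.exp_pos _) (by positivity)]
      rw [div_le_iff₀ (by positivity), mul_pow] at h5
      linarith
    have h6 : Real.exp (-(b * t ^ α)) ≤ 1 := Real.exp_le_one_iff.2 (by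
      have : 0 ≤ b * t ^ α := by positivity
      linarith)
    calc _ ≤ 2 ^ (α * k) * (1 + t ^ (α * k)) * Real.exp (-(b * t ^ α)) := by
          gcongr
          exact h2.trans h3
      _ = 2 ^ (α * k) * (Real.exp (-(b * t ^ α)) + t ^ (α * k) * Real.exp (-(b * t ^ α))) := by
          ring
      _ ≤ _ := by gcongr
  rw [Real.rpow_neg (by positivity), ← div_eq_mul_inv, le_div_iff₀ (by positivity)]
  linarith

lemma norm_stab_le {b α : ℝ} (hα : 0 < α) (c : ℂ) {v : Fin l → Eu n} (hv : ∀ i, ‖v i‖ ≤ 1)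
    (k : ℕ) (ξ : Eu n) :
    ‖stab b α c v k ξ‖ ≤ ‖c‖ * (‖ξ‖ ^ (l + k * α) * Real.exp (-(b * ‖ξ‖ ^ α))) := by
  have h := norm_prod_inner_le hv ξ
  rw [stab, norm_mul, norm_mul, Complex.norm_real, Real.norm_of_nonneg (by positivity),
    Real.rpow_add_of_nonneg (norm_nonneg _) (by positivity) (by positivity), Real.rpow_natCast,
    mul_comm (k : ℝ) α, Real.rpow_mul (norm_nonneg _), Real.rpow_natCast]
  calc _ ≤ ‖c‖ * ‖ξ‖ ^ l * ((‖ξ‖ ^ α) ^ k * Real.exp (-(b * ‖ξ‖ ^ α))) := by gcongr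
    _ = _ := by ring

lemma exists_stab_le {b α : ℝ} (hb : 0 < b) (hα : 0 < α) (c : ℂ) {v : Fin l → Eu n}
    (hv : ∀ i, ‖v i‖ ≤ 1) (k : ℕ) {s : ℝ} (hs0 : 0 ≤ s) (hs : s ≤ l + k * α) (N : ℝ) :
    ∃ D, 0 ≤ D ∧ ∀ ξ, ‖stab b α c v k ξ‖ ≤ D * (‖ξ‖ ^ s * (1 + ‖ξ‖) ^ (-N)) := by
  obtain ⟨D, hD, h⟩ := exists_exp_neg_rpow_le hb hα (N + (l + k * α - s))
  refine ⟨‖c‖ * D, by positivity, fun ξ => (norm_stab_le hα c hv k ξ).trans ?_⟩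
  rw [mul_assoc]
  refine mul_le_mul_of_nonneg_left ?_ (norm_nonneg c)
  have h1 : ‖ξ‖ ^ (l + k * α) = ‖ξ‖ ^ s * ‖ξ‖ ^ (l + k * α - s) := by
    rw [← Real.rpow_add_of_nonneg (norm_nonneg _) hs0 (by linarith)]
    congr 1
    ring
  have h2 : ‖ξ‖ ^ (l + k * α - s) ≤ (1 + ‖ξ‖) ^ (l + k * α - s) :=
    Real.rpow_le_rpow (norm_nonneg _) (by linarith) (by linarith)
  have hpos : 0 < 1 + ‖ξ‖ := by positivity
  calc _ ≤ ‖ξ‖ ^ s * (1 + ‖ξ‖) ^ (l + k * α - s) *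
        (D * (1 + ‖ξ‖) ^ (-(N + (l + k * α - s)))) := by
        rw [h1]
        gcongr
        exact h _ (norm_nonneg _)
    _ = D * (‖ξ‖ ^ s * ((1 + ‖ξ‖) ^ (l + k * α - s) *
        (1 + ‖ξ‖) ^ (-(N + (l + k * α - s))))) := by ring
    _ = _ := by
        rw [← Real.rpow_add hpos]
        congr 3
        ring

lemma hasDecay_stab {b α : ℝ} (hb : 0 < b) (hα : 0 < α) (c : ℂ) {v : Fin l → Eu n}
    (hv : ∀ i, ‖v i‖ ≤ 1) (k : ℕ) (N : ℝ) : HasDecay (stab b α c v k) N := by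
  obtain ⟨D, hD, h⟩ := exists_stab_le hb hα c hv k le_rfl (by positivity) N
  exact ⟨D, hD, fun ξ => by simpa using h ξ⟩

lemma integrable_stab {b α : ℝ} (hb : 0 < b) (hα : 0 < α) (c : ℂ) {v : Fin l → Eu n}
    (hv : ∀ i, ‖v i‖ ≤ 1) (k : ℕ) : Integrable (stab b α c v k) :=
  (hasDecay_stab hb hα c hv k (n + 1)).integrable (by linarith) (continuous_stab hα c v k)

lemma integrable_norm_mul_stab {b α : ℝ} (hb : 0 < b) (hα : 0 < α) (c : ℂ) {v : Fin l → Eu n}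
    (hv : ∀ i, ‖v i‖ ≤ 1) (k : ℕ) : Integrable (fun ξ => ‖ξ‖ * ‖stab b α c v k ξ‖) := by
  obtain ⟨D, hD, h⟩ := hasDecay_stab hb hα c hv k (n + 2)
  have hi : Integrable (fun u : Eu n => (1 + ‖u‖) ^ (-((n : ℝ) + 1))) :=
    integrable_one_add_norm (by simp)
  refine (hi.const_mul D).mono'
    (continuous_norm.mul (continuous_stab hα c v k).norm).aestronglyMeasurable
    (.of_forall fun ξ => ?_)
  have hpos : 0 < 1 + ‖ξ‖ := by positivity
  rw [Real.norm_of_nonneg (by positivity)]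
  calc _ ≤ (1 + ‖ξ‖) * (D * (1 + ‖ξ‖) ^ (-((n : ℝ) + 2))) := by
        gcongr
        · linarith
        · exact h ξ
    _ = D * ((1 + ‖ξ‖) ^ (1 : ℝ) * (1 + ‖ξ‖) ^ (-((n : ℝ) + 2))) := by
        rw [Real.rpow_one]; ring
    _ = _ := by
        rw [← Real.rpow_add hpos]
        congr 2
        ring

/-- The power multiplies the argument by `β ≤ 1`, which keeps it within `π/2`. With `β = α / 2` this
is where `α ≤ 2` enters the decay: `exp(-b w^β)` stays bounded on the half-plane. -/
lemma cpow_re_nonneg {β : ℝ} (hβ0 : 0 ≤ β) (hβ1 : β ≤ 1) {w : ℂ} (hw : 0 ≤ w.re) :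
    0 ≤ (w ^ (β : ℂ)).re := by
  rcases eq_or_ne w 0 with rfl | h0
  · rcases hβ0.eq_or_lt with rfl | h
    · simp
    · rw [Complex.zero_cpow (by exact_mod_cast h.ne')]
      simp
  · have harg : |w.arg| ≤ Real.pi / 2 := Complex.abs_arg_le_pi_div_two_iff.2 hw
    rw [Complex.cpow_def_of_ne_zero h0, Complex.exp_re]
    refine mul_nonneg (Real.exp_pos _).le (Real.cos_nonneg_of_neg_pi_div_two_le_of_le ?_ ?_)
    all_goals
      rw [Complex.im_mul_ofReal, Complex.log_im]
      have h1 : |w.arg * β| ≤ Real.pi / 2 := by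
        rw [abs_mul, abs_of_nonneg hβ0]
        exact (mul_le_of_le_one_right (abs_nonneg _) hβ1).trans harg
      linarith [abs_le.1 h1]

lemma norm_exp_neg_le_one {z : ℂ} (hz : 0 ≤ z.re) : ‖Complex.exp (-z)‖ ≤ 1 := by
  rw [Complex.norm_exp, Real.exp_le_one_iff]
  simpa using hz

lemma norm_exp_neg_sub_one_le {z : ℂ} (hz : 0 ≤ z.re) : ‖Complex.exp (-z) - 1‖ ≤ 2 * ‖z‖ := by
  rcases le_total ‖z‖ 1 with h | h
  · simpa using Complex.norm_exp_sub_one_le (x := -z) (by simpa using h)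
  · have := norm_sub_le (Complex.exp (-z)) 1
    rw [norm_one] at this
    linarith [norm_exp_neg_le_one hz]

lemma differentiableOn_cpow (β : ℝ) :
    DifferentiableOn ℂ (fun w : ℂ => w ^ (β : ℂ)) {w | 0 < w.re} := fun _ hw =>
  (DifferentiableAt.cpow_const differentiableAt_id (Or.inl hw)).differentiableWithinAt

lemma norm_sq_cpow (α : ℝ) (ξ : Eu n) :
    (((‖ξ‖ ^ 2 : ℝ) : ℂ)) ^ ((α / 2 : ℝ) : ℂ) = ((‖ξ‖ ^ α : ℝ) : ℂ) := by
  rw [← Complex.ofReal_cpow (by positivity), ← Real.rpow_natCast, ← Real.rpow_mul (norm_nonneg _)]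
  congr 2
  push_cast
  ring

/-- Each power of `|ξ|^α` or linear form in the multiplier improves the decay on the other side;
without any power of `|ξ|^α` it is the singularity of the exponential that limits the decay. -/
theorem hasDecay_fourierInv_stab {b α : ℝ} (hb : 0 < b) (hα : 0 < α) (hα2 : α ≤ 2) (c : ℂ)
    {v : Fin l → Eu n} (hv : ∀ i, ‖v i‖ ≤ 1) (k : ℕ) :
    HasDecay (𝓕⁻ (stab b α c v k)) (n + (l + α)) := by
  set β : ℝ := α / 2 with hβ
  have hre : ∀ w : ℂ, 0 ≤ w.re → 0 ≤ ((b : ℂ) * w ^ (β : ℂ)).re := fun w hw => by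
    rw [Complex.re_ofReal_mul]
    exact mul_nonneg hb.le (cpow_re_nonneg (by positivity) (by linarith) hw)
  have hnorm : ∀ w : ℂ, 0 ≤ w.re → ‖w ^ (β : ℂ)‖ = ‖w‖ ^ β := fun w _ =>
    Complex.norm_cpow_real _ _
  have hd := differentiableOn_cpow β
  have hpow := fun ξ : Eu n => norm_sq_cpow α ξ
  rcases Nat.eq_zero_or_pos k with rfl | hk
  -- Without a power of `|ξ|^α` the exponential does not vanish at the origin. Subtracting `1` makes
  -- it `O(|ξ|^α)` and changes the multiplier only by a polynomial of degree at most `l`, which the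
  -- differences kill.
  · refine hasDecay_fourierInv (integrable_stab hb hα c hv 0) hv (C := ‖c‖ * (2 * b))
      (g := fun w => c * (Complex.exp (-((b : ℂ) * w ^ (β : ℂ))) - 1)) (by positivity) hα.le
      (by fun_prop) (fun w hw => ?_) fun K hK h ξ => ?_
    · rw [norm_mul, mul_assoc]
      gcongr
      refine (norm_exp_neg_sub_one_le (hre w hw)).trans (le_of_eq ?_)
      rw [norm_mul, hnorm w hw, Complex.norm_real, Real.norm_of_nonneg hb.le]
      ring
    · have e : stab b α c v 0 = polyRadial v
          (fun w => c * (Complex.exp (-((b : ℂ) * w ^ (β : ℂ))) - 1)) +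
          c • (fun ξ => ∏ i, ((inner ℝ (v i) ξ : ℝ) : ℂ)) := by
        funext ξ
        simp only [stab, polyRadial, Pi.add_apply, Pi.smul_apply, smul_eq_mul, hpow, hβ]
        push_cast
        ring
      rw [e, fwdDiff_iter_add, fwdDiff_iter_const_smul, Pi.add_apply, Pi.smul_apply,
        iterate_fwdDiff_prod_inner v hK]
      simp
  · have hk1 : (1 : ℝ) ≤ k := by exact_mod_cast hk
    have := hasDecay_fourierInv (integrable_stab hb hα c hv k) hv (C := ‖c‖) (a := k * α)
      (g := fun w => c * ((w ^ (β : ℂ)) ^ k * Complex.exp (-((b : ℂ) * w ^ (β : ℂ)))))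
      (norm_nonneg c) (by positivity)
      (by fun_prop) (fun w hw => ?_) fun K hK h ξ => ?_
    · refine this.mono ?_
      have : α ≤ k * α := le_mul_of_one_le_left hα.le hk1
      linarith
    · rw [norm_mul, norm_mul, norm_pow, hnorm w hw]
      gcongr
      refine (mul_le_of_le_one_right (by positivity) (norm_exp_neg_le_one (hre w hw))).trans
        (le_of_eq ?_)
      rw [← Real.rpow_natCast, ← Real.rpow_mul (norm_nonneg _)]
      congr 1
      rw [hβ]
      ring
    · have e : stab b α c v k = polyRadial v
          (fun w => c * ((w ^ (β : ℂ)) ^ k * Complex.exp (-((b : ℂ) * w ^ (β : ℂ))))) := by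
        funext ξ
        simp only [stab, polyRadial, hpow, hβ]
        push_cast
        ring
      rw [e]

lemma continuous_fourierInv {m : Eu n → ℂ} (hm : Integrable m) : Continuous (𝓕⁻ m) := by
  have : 𝓕⁻ m = fun x => 𝓕 m (-x) := funext fun x => Real.fourierInv_eq_fourier_neg m x
  rw [this]
  exact (continuous_fourier hm).comp continuous_neg

lemma hasFDerivAt_fourierInv {m : Eu n → ℂ} (hm : Integrable m)
    (hm' : Integrable (fun ξ => ‖ξ‖ * ‖m ξ‖)) (x : Eu n) :
    ∃ L : Eu n →L[ℝ] ℂ, HasFDerivAt (𝓕⁻ m) L x ∧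
      ∀ w, L w = 𝓕⁻ (fun ξ => 2 * Real.pi * Complex.I * ((inner ℝ w ξ : ℝ) : ℂ) * m ξ) x := by
  have e : 𝓕⁻ m = fun x => 𝓕 m (-x) := funext fun x => Real.fourierInv_eq_fourier_neg m x
  have h1 := Real.hasFDerivAt_fourier hm hm' (-x)
  have h2 := h1.comp x (hasFDerivAt_id x).neg
  refine ⟨_, h2.congr_of_eventuallyEq (.of_forall fun z => congrFun e z), fun w => ?_⟩
  have h_int : Integrable (VectorFourier.fourierSMulRight (innerSL ℝ) m) := by
    refine (hm'.const_mul (2 * Real.pi * ‖(innerSL ℝ : Eu n →L[ℝ] _)‖)).mono'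
      hm.1.fourierSMulRight (.of_forall fun ξ => ?_)
    refine (VectorFourier.norm_fourierSMulRight_le (innerSL ℝ) m ξ).trans (le_of_eq ?_)
    ring
  rw [Real.fourierInv_eq_fourier_neg]
  simp only [ContinuousLinearMap.comp_apply, neg_apply,
    ContinuousLinearMap.id_apply]
  rw [Real.fourier_eq, Real.fourier_eq, ContinuousLinearMap.integral_apply]
  · refine integral_congr_ae (.of_forall fun ξ => ?_)
    have e3 : (innerSL ℝ ξ : Eu n →L[ℝ] ℝ) w = inner ℝ w ξ := by
      rw [innerSL_apply_apply, real_inner_comm]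
    simp [VectorFourier.fourierSMulRight_apply, Circle.smul_def, e3]
    ring
  · exact (Real.fourierIntegral_convergent_iff (-x)).2 h_int

lemma norm_clm_le_sum (L : Eu n →L[ℝ] ℂ) : ‖L‖ ≤ ∑ i, ‖L (EuclideanSpace.single i 1)‖ := by
  refine L.opNorm_le_bound (Finset.sum_nonneg fun i _ => norm_nonneg _) fun x => ?_
  have hx : x = ∑ i, x i • EuclideanSpace.single i (1 : ℝ) := by
    ext j
    simp [Pi.single_apply]
  conv_lhs => rw [hx]
  rw [map_sum, Finset.sum_mul]
  refine (norm_sum_le _ _).trans (Finset.sum_le_sum fun i _ => ?_)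
  rw [map_smul, norm_smul, mul_comm]
  gcongr
  exact PiLp.norm_apply_le x i

lemma hasDecay_clm {F : Eu n → (Eu n →L[ℝ] ℂ)} {N : ℝ}
    (h : ∀ i, HasDecay (fun x => F x (EuclideanSpace.single i 1)) N) : HasDecay F N := by
  choose D hD h using h
  refine ⟨∑ i, D i, Finset.sum_nonneg fun i _ => hD i, fun u => ?_⟩
  refine (norm_clm_le_sum _).trans ?_
  rw [Finset.sum_mul]
  exact Finset.sum_le_sum fun i _ => h i u

/-- A directional derivative adds one linear form, so the class of multipliers is stable under
differentiation. -/
lemma two_pi_I_mul_stab (b α : ℝ) (c : ℂ) (v : Fin l → Eu n) (k : ℕ) (w : Eu n) :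
    (fun ξ => 2 * Real.pi * Complex.I * ((inner ℝ w ξ : ℝ) : ℂ) * stab b α c v k ξ) =
      stab b α (2 * Real.pi * Complex.I * c) (Fin.cons w v : Fin (l + 1) → Eu n) k := by
  funext ξ
  simp only [stab, Fin.prod_univ_succ, Fin.cons_zero, Fin.cons_succ]
  ring

lemma differentiable_fourierInv_stab {b α : ℝ} (hb : 0 < b) (hα : 0 < α) (c : ℂ)
    {v : Fin l → Eu n} (hv : ∀ i, ‖v i‖ ≤ 1) (k : ℕ) :
    Differentiable ℝ (𝓕⁻ (stab b α c v k)) := fun x => by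
  obtain ⟨L, hL, -⟩ := hasFDerivAt_fourierInv (integrable_stab hb hα c hv k)
    (integrable_norm_mul_stab hb hα c hv k) x
  exact hL.differentiableAt

lemma fderiv_fourierInv_stab {b α : ℝ} (hb : 0 < b) (hα : 0 < α) (c : ℂ)
    {v : Fin l → Eu n} (hv : ∀ i, ‖v i‖ ≤ 1) (k : ℕ) (x w : Eu n) :
    fderiv ℝ (𝓕⁻ (stab b α c v k)) x w =
      𝓕⁻ (stab b α (2 * Real.pi * Complex.I * c) (Fin.cons w v : Fin (l + 1) → Eu n) k) x := by
  obtain ⟨L, hL, h⟩ := hasFDerivAt_fourierInv (integrable_stab hb hα c hv k)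
    (integrable_norm_mul_stab hb hα c hv k) x
  rw [hL.fderiv, h, two_pi_I_mul_stab]

/-- The linear form that the derivative adds gives the order `+ 1` even when `l = 0`. -/
lemma hasDecay_fderiv_fourierInv_stab {b α : ℝ} (hb : 0 < b) (hα : 0 < α) (hα2 : α ≤ 2) (c : ℂ)
    {v : Fin l → Eu n} (hv : ∀ i, ‖v i‖ ≤ 1) (k : ℕ) :
    HasDecay (fderiv ℝ (𝓕⁻ (stab b α c v k))) (n + 1 + α) := by
  refine hasDecay_clm fun i => ?_
  simp only [fderiv_fourierInv_stab hb hα c hv k]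
  refine (hasDecay_fourierInv_stab hb hα hα2 _
    (Fin.cases (by simp) fun j => by simpa using hv j) k).mono ?_
  have : (0 : ℝ) ≤ l := Nat.cast_nonneg l
  push_cast
  linarith

lemma integrable_fourierInv_stab {b α : ℝ} (hb : 0 < b) (hα : 0 < α) (hα2 : α ≤ 2) (c : ℂ)
    {v : Fin l → Eu n} (hv : ∀ i, ‖v i‖ ≤ 1) (k : ℕ) : Integrable (𝓕⁻ (stab b α c v k)) := by
  refine (hasDecay_fourierInv_stab hb hα hα2 c hv k).integrable ?_
    (continuous_fourierInv (integrable_stab hb hα c hv k))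
  have : (0 : ℝ) ≤ l := Nat.cast_nonneg l
  linarith

lemma fourier_fourierInv_stab {b α : ℝ} (hb : 0 < b) (hα : 0 < α) (hα2 : α ≤ 2) (c : ℂ)
    {v : Fin l → Eu n} (hv : ∀ i, ‖v i‖ ≤ 1) (k : ℕ) :
    𝓕 (𝓕⁻ (stab b α c v k)) = stab b α c v k := by
  refine (continuous_stab hα c v k).fourier_fourierInv_eq (integrable_stab hb hα c hv k) ?_
  have h := (integrable_fourierInv_stab hb hα hα2 c hv k).comp_neg
  refine h.congr (.of_forall fun x => ?_)
  simp [Real.fourierInv_eq_fourier_neg]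

lemma isProfile_fourierInv_stab {b α : ℝ} (hb : 0 < b) (hα : 0 < α) (hα2 : α ≤ 2) (c : ℂ)
    {v : Fin l → Eu n} (hv : ∀ i, ‖v i‖ ≤ 1) {k : ℕ} (hlk : 1 ≤ l + k) :
    IsProfile (𝓕⁻ (stab b α c v k)) α where
  continuous := continuous_fourierInv (integrable_stab hb hα c hv k)
  decay := (hasDecay_fourierInv_stab hb hα hα2 c hv k).mono (by
    have : (0 : ℝ) ≤ l := Nat.cast_nonneg l
    linarith)
  fourier := by
    rw [fourier_fourierInv_stab hb hα hα2 c hv k]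
    refine exists_stab_le hb hα c hv k (by positivity) ?_ α
    -- The multiplier vanishes to order `l + kα ≥ α / 2` at the origin: a linear form contributes `1
    -- ≥ α/2` as `α ≤ 2`, a radial factor contributes `α`.
    have h : (1 : ℝ) ≤ l + k := by exact_mod_cast hlk
    have : (0 : ℝ) ≤ l := Nat.cast_nonneg l
    have : (0 : ℝ) ≤ k := Nat.cast_nonneg k
    nlinarith

/-- A correlation becomes a product on the Fourier side, with one transform reflected; the proof
moves the transform across the integral by `integral_fourier_mul_eq`. -/
lemma correlation_fourierInv {m Q : Eu n → ℂ} (hm : Integrable m) (hQ : Integrable Q) :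
    correlation (𝓕⁻ m) Q = 𝓕⁻ (fun ξ => m ξ * 𝓕 Q (-ξ)) := by
  funext u
  have hm' : Integrable (fun ξ => Real.fourierChar (inner ℝ ξ u) • m ξ) := by
    have := (Real.fourierIntegral_convergent_iff (μ := volume) (f := m) (-u)).2 hm
    simpa using this
  have h := integral_fourier_mul_eq hm' hQ.comp_neg
  have e1 : correlation (𝓕⁻ m) Q u =
      ∫ x, 𝓕 (fun ξ => Real.fourierChar (inner ℝ ξ u) • m ξ) x * Q (-x) := by
    rw [correlation, ← integral_neg_eq_self]
    refine integral_congr_ae (.of_forall fun w => ?_)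
    simp only
    congr 1
    rw [Real.fourierInv_eq, Real.fourier_eq]
    refine integral_congr_ae (.of_forall fun ξ => ?_)
    simp only
    rw [smul_smul, ← AddChar.map_add_eq_mul, inner_add_right, inner_neg_right]
  have e2 : ∀ ξ, 𝓕 (fun x => Q (-x)) ξ = 𝓕 Q (-ξ) := by
    intro ξ
    rw [Real.fourier_eq, Real.fourier_eq, ← integral_neg_eq_self]
    simp
  rw [e1, h, Real.fourierInv_eq]
  refine integral_congr_ae (.of_forall fun ξ => ?_)
  simp only [e2, Circle.smul_def, smul_eq_mul]
  ring

/-- The class of multipliers is closed under this product too, with `b` doubled. Hence correlations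
of profiles inherit all the decay estimates. -/
lemma stab_mul_stab_neg {l' : ℕ} (b α : ℝ) (c c' : ℂ) (v : Fin l → Eu n) (v' : Fin l' → Eu n)
    (k k' : ℕ) (ξ : Eu n) :
    stab b α c v k ξ * stab b α c' v' k' (-ξ) =
      stab (2 * b) α (c * c' * (-1) ^ l') (Fin.append v v') (k + k') ξ := by
  have h1 : ∏ i, ((inner ℝ (v' i) (-ξ) : ℝ) : ℂ) =
      (-1) ^ l' * ∏ i, ((inner ℝ (v' i) ξ : ℝ) : ℂ) := by
    simp [inner_neg_right, Finset.prod_neg]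
  have h2 : Real.exp (-(2 * b * ‖ξ‖ ^ α)) =
      Real.exp (-(b * ‖ξ‖ ^ α)) * Real.exp (-(b * ‖ξ‖ ^ α)) := by
    rw [← Real.exp_add]
    congr 1
    ring
  simp only [stab, Fin.prod_univ_add, Fin.append_left, Fin.append_right, h1, norm_neg, h2, pow_add]
  push_cast
  ring

/-- `P` is the inverse Fourier transform of one of the multipliers `stab`. -/
def IsStableProfile (b α : ℝ) (P : Eu n → ℂ) : Prop :=
  ∃ (l : ℕ) (c : ℂ) (v : Fin l → Eu n) (k : ℕ), (∀ i, ‖v i‖ ≤ 1) ∧ 1 ≤ l + k ∧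
    P = 𝓕⁻ (stab b α c v k)

lemma IsStableProfile.isProfile {b α : ℝ} (hb : 0 < b) (hα : 0 < α) (hα2 : α ≤ 2)
    {P : Eu n → ℂ} (hP : IsStableProfile b α P) : IsProfile P α := by
  obtain ⟨l, c, v, k, hv, hlk, rfl⟩ := hP
  exact isProfile_fourierInv_stab hb hα hα2 c hv hlk

/-- For coefficients that depend on the height only, the slice kernel is a dilate of the
correlation of the two profiles, and this is smooth enough for every pair of profiles. -/
lemma IsStableProfile.hasGradBound {b α : ℝ} (hb : 0 < b) (hα : 0 < α) (hα2 : α ≤ 2)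
    {P Q : Eu n → ℂ} (hP : IsStableProfile b α P) (hQ : IsStableProfile b α Q) :
    HasGradBound (fun a => ∀ x x' y, a x y = a x' y) P Q α := by
  obtain ⟨l, c, v, k, hv, -, rfl⟩ := hP
  obtain ⟨l', c', v', k', hv', -, rfl⟩ := hQ
  have hvv : ∀ i, ‖Fin.append v v' i‖ ≤ 1 :=
    Fin.addCases (fun i => by simpa using hv i) fun i => by simpa using hv' i
  have e : correlation (𝓕⁻ (stab b α c v k)) (𝓕⁻ (stab b α c' v' k')) =
      𝓕⁻ (stab (2 * b) α (c * c' * (-1) ^ l') (Fin.append v v') (k + k')) := by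
    rw [correlation_fourierInv (integrable_stab hb hα c hv k)
      (integrable_fourierInv_stab hb hα hα2 c' hv' k'), fourier_fourierInv_stab hb hα hα2 c' hv' k']
    simp only [stab_mul_stab_neg]
  refine hasGradBound_of_correlation ?_ ?_ <;> rw [e]
  · exact differentiable_fourierInv_stab (by positivity) hα _ hvv _
  · exact hasDecay_fderiv_fourierInv_stab (by positivity) hα hα2 _ hvv _

/-- Exactly one linear form on each side: this already gives the profiles `n + 1 + α` orders of
decay, so arbitrary bounded coefficients are allowed. -/
lemma hasGradBound_fourierInv_stab {b α : ℝ} (hb : 0 < b) (hα : 0 < α) (hα2 : α ≤ 2) (c c' : ℂ)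
    {v v' : Fin 1 → Eu n} (hv : ∀ i, ‖v i‖ ≤ 1) (hv' : ∀ i, ‖v' i‖ ≤ 1) (k k' : ℕ) :
    HasGradBound (fun _ => True) (𝓕⁻ (stab b α c v k)) (𝓕⁻ (stab b α c' v' k')) α := by
  have h : ∀ (c : ℂ) {v : Fin 1 → Eu n} (_ : ∀ i, ‖v i‖ ≤ 1) (k : ℕ),
      HasDecay (𝓕⁻ (stab b α c v k)) (n + 1 + α) := fun c v hv k =>
    (hasDecay_fourierInv_stab hb hα hα2 c hv k).mono (by push_cast; linarith)
  exact hasGradBound_of_decay hα (differentiable_fourierInv_stab hb hα c hv k) (h c hv k)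
    (hasDecay_fderiv_fourierInv_stab hb hα hα2 c hv k)
    (differentiable_fourierInv_stab hb hα c' hv' k') (h c' hv' k')
    (hasDecay_fderiv_fourierInv_stab hb hα hα2 c' hv' k')

end StableMultiplier

/-! ### The gradient of the dilated density as a dilate of profiles -/

section Density

open FourierTransform

variable {n : ℕ}

/-- The profiles of the full gradient of `φ_y`: the space derivatives and, last, the derivative
in the height. -/
def stableProfile (n : ℕ) (α : ℝ) : Fin (n + 1) → Eu n → ℂ :=
  Fin.snoc (α := fun _ => Eu n → ℂ)
    (fun i : Fin n => 𝓕⁻ (stab ((2 * Real.pi) ^ α) α (2 * Real.pi * Complex.I)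
      (fun _ : Fin 1 => EuclideanSpace.single i (1 : ℝ)) 0))
    (𝓕⁻ (stab ((2 * Real.pi) ^ α) α (-(α * (2 * Real.pi) ^ α : ℝ)) Fin.elim0 1))

lemma isStableProfile_stableProfile (α : ℝ) (i : Fin (n + 1)) :
    IsStableProfile ((2 * Real.pi) ^ α) α (stableProfile n α i) := by
  refine Fin.lastCases ?_ (fun i => ?_) i
  · rw [stableProfile, Fin.snoc_last]
    exact ⟨0, _, _, 1, fun i => i.elim0, le_rfl, rfl⟩
  · rw [stableProfile, Fin.snoc_castSucc]
    exact ⟨1, _, _, 0, fun _ => by simp, le_rfl, rfl⟩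

lemma hasGradBound_stableProfile {α : ℝ} (hα : 0 < α) (hα2 : α ≤ 2) {i j : Fin (n + 1)}
    (hi : i ≠ Fin.last n) (hj : j ≠ Fin.last n) :
    HasGradBound (fun _ => True) (stableProfile n α i) (stableProfile n α j) α := by
  obtain ⟨i, rfl⟩ := Fin.exists_castSucc_eq.2 hi
  obtain ⟨j, rfl⟩ := Fin.exists_castSucc_eq.2 hj
  rw [stableProfile, Fin.snoc_castSucc, Fin.snoc_castSucc]
  exact hasGradBound_fourierInv_stab (by positivity) hα hα2 _ _ (fun _ => by simp)
    (fun _ => by simp) _ _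

lemma IsContDensity.integrable {Ω : Type*} [MeasurableSpace Ω] {P : Measure Ω}
    [IsProbabilityMeasure P] {Y : Ω → Eu n} {φ : Eu n → ℝ} (hφ : IsContDensity φ Y P) :
    Integrable φ := by
  refine ⟨hφ.continuous.aestronglyMeasurable, ?_⟩
  rw [hasFiniteIntegral_iff_ofReal (.of_forall hφ.nonneg)]
  have h : volume.withDensity (fun x => ENNReal.ofReal (φ x)) univ < ∞ := by
    rw [← hφ.map_eq]
    exact measure_lt_top _ _
  rwa [withDensity_apply _ MeasurableSet.univ, Measure.restrict_univ] at h

/-- The transform `𝓕` uses `exp(-2πi⟨x, ξ⟩)`, while `charFun` uses `exp(i⟨x, ξ⟩)`; the rescaling is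
the origin of the constant `b = (2π)^α`. -/
lemma IsContDensity.charFun_eq {Ω : Type*} [MeasurableSpace Ω] {P : Measure Ω}
    {Y : Ω → Eu n} {φ : Eu n → ℝ} (hφ : IsContDensity φ Y P) (ξ : Eu n) :
    charFun (P.map Y) (-(2 * Real.pi) • ξ) = 𝓕 (fun x => (φ x : ℂ)) ξ := by
  rw [charFun_apply, hφ.map_eq, integral_withDensity_eq_integral_toReal_smul
    (by have := hφ.continuous; fun_prop) (.of_forall fun x => ENNReal.ofReal_lt_top),
    Real.fourier_eq]
  refine integral_congr_ae (.of_forall fun x => ?_)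
  simp only
  rw [ENNReal.toReal_ofReal (hφ.nonneg x), Circle.smul_def, Real.fourierChar_apply,
    inner_smul_right, Complex.real_smul, smul_eq_mul, mul_comm]
  congr 3
  push_cast
  ring

/-- Inversion holds at every point because the density is continuous and its transform is
integrable. Hence `φ` depends on `n` and `α` only, and so can the constants. -/
lemma density_eq_fourierInv {Ω : Type*} [MeasurableSpace Ω] {P : Measure Ω}
    [IsProbabilityMeasure P] {X : ℝ≥0 → Ω → Eu n} {α : ℝ} (hα : 0 < α)
    (hX : IsRotInvStable α X P) {φ : Eu n → ℝ} (hφ : IsContDensity φ (X 1) P) :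
    (fun x => (φ x : ℂ)) = 𝓕⁻ (stab ((2 * Real.pi) ^ α) α 1 (Fin.elim0 : Fin 0 → Eu n) 0) := by
  have hF : 𝓕 (fun x => (φ x : ℂ)) =
      stab ((2 * Real.pi) ^ α) α 1 (Fin.elim0 : Fin 0 → Eu n) 0 := by
    funext ξ
    rw [← hφ.charFun_eq, hX.charFun_eq, norm_smul, norm_neg, Real.norm_of_nonneg (by positivity),
      Real.mul_rpow (by positivity) (norm_nonneg _), stab]
    simp
  rw [← hF]
  symm
  refine (Complex.continuous_ofReal.comp hφ.continuous).fourierInv_fourier_eq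
    hφ.integrable.ofReal ?_
  have := integrable_stab (b := (2 * Real.pi) ^ α) (by positivity) hα 1
    (v := (Fin.elim0 : Fin 0 → Eu n)) (fun i => i.elim0) 0
  rwa [← hF] at this

lemma fourierInv_dilate (m : Eu n → ℂ) {s : ℝ} (hs : 0 < s) (x : Eu n) :
    𝓕⁻ (fun ξ => m (s • ξ)) x = (((s ^ n)⁻¹ : ℝ) : ℂ) * 𝓕⁻ m (s⁻¹ • x) := by
  rw [Real.fourierInv_eq, Real.fourierInv_eq]
  have h := Measure.integral_comp_smul_of_nonneg volume
    (fun w : Eu n => Real.fourierChar (inner ℝ w (s⁻¹ • x)) • m w) s (hR := hs.le)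
  rw [finrank_euclideanSpace_fin, Complex.real_smul] at h
  rw [← h]
  refine integral_congr_ae (.of_forall fun ξ => ?_)
  simp only
  rw [inner_smul_left, inner_smul_right]
  congr 2
  simp only [conj_trivial]
  field_simp

lemma hasDerivAt_exp_neg_rpow (b t : ℝ) (α : ℝ) {s : ℝ} (hs : 0 < s) :
    HasDerivAt (fun s : ℝ => Real.exp (-(b * (s ^ α * t))))
      (s⁻¹ * (-(α * b) * (s ^ α * t) * Real.exp (-(b * (s ^ α * t))))) s := by
  have h1 : HasDerivAt (fun s : ℝ => Real.exp (-(b * (s ^ α * t))))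
      (Real.exp (-(b * (s ^ α * t))) * -(b * (α * s ^ (α - 1) * t))) s :=
    ((((Real.hasDerivAt_rpow_const (x := s) (p := α) (Or.inl hs.ne')).mul_const
      t).const_mul b).neg).exp
  refine h1.congr_deriv ?_
  rw [Real.rpow_sub_one hs.ne']
  field_simp

/-- The derivative in the height of the dilated density. -/
lemma hasDerivAt_fourierInv_dilate {b α : ℝ} (hb : 0 < b) (hα : 0 < α) {y : ℝ} (hy : 0 < y)
    (x : Eu n) :
    HasDerivAt (fun s : ℝ => 𝓕⁻ (fun ξ => stab b α 1 (Fin.elim0 : Fin 0 → Eu n) 0 (s • ξ)) x)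
      (𝓕⁻ (fun ξ => ((y⁻¹ : ℝ) : ℂ) *
        stab b α (-(α * b : ℝ)) (Fin.elim0 : Fin 0 → Eu n) 1 (y • ξ)) x) y := by
  have hnorm : ∀ s : ℝ, 0 < s → ∀ ξ : Eu n, ‖s • ξ‖ ^ α = s ^ α * ‖ξ‖ ^ α := fun s hs ξ => by
    rw [norm_smul, Real.norm_of_nonneg hs.le, Real.mul_rpow hs.le (norm_nonneg _)]
  have h0 : ∀ s : ℝ, 0 < s → ∀ ξ : Eu n, stab b α 1 (Fin.elim0 : Fin 0 → Eu n) 0 (s • ξ) =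
      ((Real.exp (-(b * (s ^ α * ‖ξ‖ ^ α))) : ℝ) : ℂ) := fun s hs ξ => by
    rw [stab, hnorm s hs]
    simp
  have h1 : ∀ s : ℝ, 0 < s → ∀ ξ : Eu n, ((s⁻¹ : ℝ) : ℂ) *
      stab b α (-(α * b : ℝ)) (Fin.elim0 : Fin 0 → Eu n) 1 (s • ξ) =
      ((s⁻¹ * (-(α * b) * (s ^ α * ‖ξ‖ ^ α) * Real.exp (-(b * (s ^ α * ‖ξ‖ ^ α)))) : ℝ) : ℂ) :=
    fun s hs ξ => by
      rw [stab, hnorm s hs]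
      push_cast
      simp only [Finset.univ_eq_empty, Finset.prod_empty]
      ring
  -- For heights between `y / 2` and `2 y` each factor of the derivative is replaced by its worst
  -- endpoint; the result is again a multiple of some `stab`, with a smaller `b`.
  set B : Eu n → ℝ := fun ξ => (y / 2)⁻¹ * (α * b) * (2 * y) ^ α *
    ‖stab (b * (y / 2) ^ α) α 1 (Fin.elim0 : Fin 0 → Eu n) 1 ξ‖ with hB
  have hBi : Integrable B := (integrable_stab (by positivity) hα 1 (fun i => i.elim0)
    1).norm.const_mul _
  have hcont : ∀ (c : ℂ) (k : ℕ) (s : ℝ), Continuous (fun ξ : Eu n =>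
      Real.fourierChar (inner ℝ ξ x) • stab b α c (Fin.elim0 : Fin 0 → Eu n) k (s • ξ)) := by
    intro c k s
    have h2 : Continuous (fun ξ : Eu n => stab b α c (Fin.elim0 : Fin 0 → Eu n) k (s • ξ)) :=
      (continuous_stab hα c _ k).comp (continuous_const_smul s)
    have h3 : Continuous (fun ξ : Eu n => Real.fourierChar (inner ℝ ξ x)) :=
      Real.continuous_fourierChar.comp (by fun_prop)
    exact h3.smul h2
  simp only [Real.fourierInv_eq]
  refine (hasDerivAt_integral_of_dominated_loc_of_deriv_le (bound := B)
    (F' := fun s ξ => Real.fourierChar (inner ℝ ξ x) • (((s⁻¹ : ℝ) : ℂ) *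
        stab b α (-(α * b : ℝ)) (Fin.elim0 : Fin 0 → Eu n) 1 (s • ξ)))
    (Ioo_mem_nhds (show y / 2 < y by linarith) (show y < 2 * y by linarith))
    (.of_forall fun s => (hcont 1 0 s).aestronglyMeasurable) ?_ ?_ ?_ hBi ?_).2
  · have h2 : Integrable (fun ξ : Eu n => stab b α 1 (Fin.elim0 : Fin 0 → Eu n) 0 (y • ξ)) :=
      (integrable_stab hb hα 1 (fun i => i.elim0) 0).comp_smul hy.ne'
    have := (Real.fourierIntegral_convergent_iff (μ := volume) (-x)).2 h2
    simpa using this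
  · refine Continuous.aestronglyMeasurable ?_
    have := (hcont (-(α * b : ℝ)) 1 y).const_smul (((y⁻¹ : ℝ) : ℂ))
    refine this.congr fun ξ => ?_
    simp only [Pi.smul_apply, Circle.smul_def, smul_eq_mul]
    ring
  · refine .of_forall fun ξ s hs => ?_
    have hs0 : 0 < s := by linarith [hs.1]
    rw [Circle.norm_smul, h1 s hs0, Complex.norm_real, hB]
    simp only [stab, Finset.univ_eq_empty, Finset.prod_empty, one_mul, pow_one, Complex.norm_real]
    rw [norm_mul, norm_mul, norm_mul, norm_neg, Real.norm_of_nonneg (by positivity),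
      Real.norm_of_nonneg (by positivity), Real.norm_of_nonneg (by positivity),
      Real.norm_of_nonneg (by positivity), Real.norm_of_nonneg (by positivity)]
    have e1 : s⁻¹ ≤ (y / 2)⁻¹ := inv_anti₀ (by positivity) hs.1.le
    have e2 : s ^ α ≤ (2 * y) ^ α := Real.rpow_le_rpow hs0.le hs.2.le hα.le
    have e3 : (y / 2) ^ α ≤ s ^ α := Real.rpow_le_rpow (by positivity) hs.1.le hα.le
    have e4 : Real.exp (-(b * (s ^ α * ‖ξ‖ ^ α))) ≤
        Real.exp (-(b * (y / 2) ^ α * ‖ξ‖ ^ α)) := by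
      rw [Real.exp_le_exp, neg_le_neg_iff, mul_assoc]
      gcongr
    calc _ ≤ (y / 2)⁻¹ * (α * b * ((2 * y) ^ α * ‖ξ‖ ^ α) *
          Real.exp (-(b * (y / 2) ^ α * ‖ξ‖ ^ α))) := by gcongr
      _ = _ := by ring
  · refine .of_forall fun ξ s hs => ?_
    have hs0 : 0 < s := by linarith [hs.1]
    have h2 := (hasDerivAt_exp_neg_rpow b (‖ξ‖ ^ α) α hs0).ofReal_comp
    rw [← h1 s hs0] at h2
    have h3 : HasDerivAt (fun s : ℝ => stab b α 1 (Fin.elim0 : Fin 0 → Eu n) 0 (s • ξ))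
        (((s⁻¹ : ℝ) : ℂ) * stab b α (-(α * b : ℝ)) (Fin.elim0 : Fin 0 → Eu n) 1 (s • ξ)) s :=
      h2.congr_of_eventuallyEq ((lt_mem_nhds hs0).mono fun t ht => h0 t ht ξ)
    have h4 := h3.const_mul (Real.fourierChar (inner ℝ ξ x) : ℂ)
    simpa only [Circle.smul_def, smul_eq_mul] using h4

/-- The full gradient of the dilated density is a dilate of the profiles. -/
theorem fullGrad_eq {φ : Eu n → ℝ} {α : ℝ} (hα : 0 < α)
    (hφ : (fun x => (φ x : ℂ)) =
      𝓕⁻ (stab ((2 * Real.pi) ^ α) α 1 (Fin.elim0 : Fin 0 → Eu n) 0))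
    {y : ℝ} (hy : 0 < y) (x : Eu n) (i : Fin (n + 1)) :
    fullGrad φ y x i = (((y ^ (n + 1))⁻¹ : ℝ) : ℂ) * stableProfile n α i (y⁻¹ • x) := by
  have hb : 0 < (2 * Real.pi) ^ α := by positivity
  have hv : ∀ i, ‖(Fin.elim0 : Fin 0 → Eu n) i‖ ≤ 1 := fun i => i.elim0
  refine Fin.lastCases ?_ (fun i => ?_) i
  · rw [fullGrad, stableProfile, Fin.snoc_last, Fin.snoc_last]
    set D : ℂ := (((y ^ (n + 1))⁻¹ : ℝ) : ℂ) * 𝓕⁻ (stab ((2 * Real.pi) ^ α) α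
      (-(α * (2 * Real.pi) ^ α : ℝ)) (Fin.elim0 : Fin 0 → Eu n) 1) (y⁻¹ • x) with hD
    have h1 : HasDerivAt (fun s : ℝ => ((dil φ s x : ℝ) : ℂ)) D y := by
      have h2 := hasDerivAt_fourierInv_dilate hb hα hy x
      have h3 : 𝓕⁻ (fun ξ => ((y⁻¹ : ℝ) : ℂ) * stab ((2 * Real.pi) ^ α) α
          (-(α * (2 * Real.pi) ^ α : ℝ)) (Fin.elim0 : Fin 0 → Eu n) 1 (y • ξ)) x = D := by
        have h4 := fourierInv_dilate (fun ξ => ((y⁻¹ : ℝ) : ℂ) * stab ((2 * Real.pi) ^ α) α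
          (-(α * (2 * Real.pi) ^ α : ℝ)) (Fin.elim0 : Fin 0 → Eu n) 1 ξ) hy x
        rw [h4, hD, Real.fourierInv_eq, Real.fourierInv_eq]
        simp only [Circle.smul_def, smul_eq_mul, mul_left_comm _ ((y⁻¹ : ℝ) : ℂ)]
        rw [integral_const_mul, ← mul_assoc]
        congr 1
        push_cast
        rw [pow_succ, mul_inv]
      rw [h3] at h2
      refine h2.congr_of_eventuallyEq ((lt_mem_nhds hy).mono fun s hs => ?_)
      simp only
      rw [fourierInv_dilate _ hs, ← hφ, dil, Complex.ofReal_mul]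
    -- The derivative is computed for the complexified function. Its real part is the real
    -- derivative, and uniqueness of derivatives shows that `D` is real.
    have h2 : HasDerivAt (fun s : ℝ => dil φ s x) D.re y := by
      have := Complex.reCLM.hasFDerivAt.comp_hasDerivAt y h1
      exact this
    rw [h2.deriv]
    exact h2.ofReal_comp.unique h1
  · rw [fullGrad, stableProfile, Fin.snoc_castSucc, Fin.snoc_castSucc]
    have hd : Differentiable ℝ φ := by
      have h1 := differentiable_fourierInv_stab hb hα 1 hv 0
      rw [← hφ] at h1
      exact Complex.reCLM.differentiable.comp h1
    have h1 : HasFDerivAt (dil φ y) ((y ^ n)⁻¹ • (y⁻¹ • fderiv ℝ φ (y⁻¹ • x))) x := by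
      have h2 : HasFDerivAt (fun z : Eu n => y⁻¹ • z) (y⁻¹ • ContinuousLinearMap.id ℝ (Eu n)) x :=
        (hasFDerivAt_id x).const_smul y⁻¹
      have h3 := ((hd (y⁻¹ • x)).hasFDerivAt.comp x h2).const_mul ((y ^ n)⁻¹)
      refine h3.congr_fderiv ?_
      ext v
      simp
    have h2 : ∀ u w : Eu n, ((fderiv ℝ φ u w : ℝ) : ℂ) =
        fderiv ℝ (fun x => (φ x : ℂ)) u w := fun u w => by
      have := (Complex.ofRealCLM.hasFDerivAt.comp u (hd u).hasFDerivAt).fderiv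
      have e : fderiv ℝ (fun x => (φ x : ℂ)) u = Complex.ofRealCLM ∘SL fderiv ℝ φ u := this
      rw [e]
      rfl
    rw [h1.fderiv]
    simp only [FunLike.coe_smul, Pi.smul_apply, smul_eq_mul, Complex.ofReal_mul]
    rw [h2, hφ, fderiv_fourierInv_stab hb hα 1 hv 0, ← mul_assoc, mul_one]
    have e : (Fin.cons (EuclideanSpace.single i (1 : ℝ)) (Fin.elim0 : Fin 0 → Eu n) :
        Fin 1 → Eu n) = fun _ => EuclideanSpace.single i (1 : ℝ) := by
      funext j
      rw [Fin.fin_one_eq_zero j]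
      rfl
    rw [e]
    congr 1
    push_cast
    rw [pow_succ, mul_inv]

end Density

/-! ### Bounded measurable versions of the coefficients -/

section Coefficients

variable {n : ℕ}

lemma norm_entry_le_toEuclideanCLM {m : ℕ} (A : Matrix (Fin m) (Fin m) ℂ) (i j : Fin m) :
    ‖A i j‖ ≤ ‖Matrix.toEuclideanCLM (n := Fin m) (𝕜 := ℂ) A‖ := by
  have h1 : A i j = (Matrix.toEuclideanCLM (n := Fin m) (𝕜 := ℂ) A
      (EuclideanSpace.single j 1)) i := by
    rw [EuclideanSpace.single, Matrix.toEuclideanCLM_toLp]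
    simp
  rw [h1]
  refine (PiLp.norm_apply_le _ i).trans ((ContinuousLinearMap.le_opNorm _ _).trans ?_)
  simp

lemma ae_norm_entry_le {A : Eu n → ℝ → Matrix (Fin (n + 1)) (Fin (n + 1)) ℂ}
    (hA : coeffNorm A < ∞) :
    ∀ᵐ p ∂halfMeasure n, ∀ i j, ‖A p.1 p.2 i j‖ ≤ (coeffNorm A).toReal := by
  have h := ae_le_eLpNormEssSup (μ := halfMeasure n) (f := fun p : Eu n × ℝ =>
    Matrix.toEuclideanCLM (n := Fin (n + 1)) (𝕜 := ℂ) (A p.1 p.2))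
  filter_upwards [h] with p hp i j
  refine (norm_entry_le_toEuclideanCLM _ i j).trans ?_
  rw [← toReal_enorm]
  refine ENNReal.toReal_mono hA.ne ?_
  rw [coeffNorm, eLpNorm_exponent_top]
  exact hp

lemma ae_half_height_pos : ∀ᵐ p ∂halfMeasure n, 0 < p.2 := by
  have h : ∀ᵐ y ∂(volume.restrict (Ioi (0 : ℝ))), 0 < y :=
    ae_restrict_mem measurableSet_Ioi
  exact Measure.quasiMeasurePreserving_snd.ae h

lemma ae_slice_of_ae_half {p : Eu n × ℝ → Prop} (h : ∀ᵐ q ∂halfMeasure n, p q) :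
    ∀ᵐ y ∂(volume.restrict (Ioi (0 : ℝ))), ∀ᵐ x, p (x, y) := by
  have h1 : ∀ᵐ q ∂((volume.restrict (Ioi (0 : ℝ))).prod (volume : Measure (Eu n))), p q.swap :=
    Measure.measurePreserving_swap.quasiMeasurePreserving.ae h
  exact Measure.ae_ae_of_ae_prod h1

/-- A coefficient which does not depend on `x` has a measurable version which does not either. -/
lemma exists_measurable_height_version {h : ℝ → ℂ}
    (hh : AEMeasurable (fun p : Eu n × ℝ => h p.2) (halfMeasure n)) :
    ∃ g : ℝ → ℂ, Measurable g ∧ ∀ᵐ p ∂halfMeasure n, h p.2 = g p.2 := by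
  have h1 := Measure.ae_ae_of_ae_prod hh.ae_eq_mk
  -- On almost every vertical line the jointly measurable version agrees with `h` at almost every
  -- height; one such line is frozen.
  obtain ⟨x, hx⟩ := h1.exists
  refine ⟨fun y => hh.mk _ (x, y), hh.measurable_mk.comp (by fun_prop), ?_⟩
  exact Measure.quasiMeasurePreserving_snd.ae hx

/-- Bounded measurable versions of the entries of the coefficient matrix. -/
lemma exists_coeff_version {A : Eu n → ℝ → Matrix (Fin (n + 1)) (Fin (n + 1)) ℂ}
    (hm : ∀ i j, AEMeasurable (fun p : Eu n × ℝ => A p.1 p.2 i j) (halfMeasure n))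
    (hA : coeffNorm A < ∞)
    (hconst : ∀ i j, (i = Fin.last n ∨ j = Fin.last n) →
      ∀ y, 0 < y → ∀ x x', A x y i j = A x' y i j) (i j : Fin (n + 1)) :
    ∃ a : Eu n → ℝ → ℂ, ((i = Fin.last n ∨ j = Fin.last n) → ∀ x x' y, a x y = a x' y) ∧
      Measurable (fun p : Eu n × ℝ => a p.1 p.2) ∧ (∀ x y, ‖a x y‖ ≤ (coeffNorm A).toReal) ∧
      ∀ᵐ p ∂halfMeasure n, A p.1 p.2 i j = a p.1 p.2 := by
  have hex : ∃ g : Eu n → ℝ → ℂ,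
      ((i = Fin.last n ∨ j = Fin.last n) → ∀ x x' y, g x y = g x' y) ∧
      Measurable (fun p : Eu n × ℝ => g p.1 p.2) ∧
      ∀ᵐ p ∂halfMeasure n, A p.1 p.2 i j = g p.1 p.2 := by
    by_cases hij : i = Fin.last n ∨ j = Fin.last n
    · have h0 : ∀ᵐ p ∂halfMeasure n, A p.1 p.2 i j = A 0 p.2 i j :=
        ae_half_height_pos.mono fun p hp => hconst i j hij p.2 hp p.1 0
      obtain ⟨g, hg, hAg⟩ := exists_measurable_height_version (h := fun y => A 0 y i j)
        ((hm i j).congr h0)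
      exact ⟨fun _ y => g y, fun _ _ _ _ => rfl, by fun_prop,
        by filter_upwards [h0, hAg] with p h1 h2 using h1.trans h2⟩
    · exact ⟨fun x y => (hm i j).mk _ (x, y), fun h => absurd h hij, (hm i j).measurable_mk,
        (hm i j).ae_eq_mk⟩
  obtain ⟨g, hg1, hg2, hg3⟩ := hex
  -- The cut changes the entry on a null set only and makes the bound hold everywhere, as the slice
  -- estimates require. It depends on the value of `g` alone, so independence of `x` survives.
  refine ⟨fun x y => if ‖g x y‖ ≤ (coeffNorm A).toReal then g x y else 0, fun h x x' y => ?_,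
    ?_, fun x y => ?_, ?_⟩
  · simp only [hg1 h x x' y]
  · exact Measurable.ite (measurableSet_le hg2.norm measurable_const) hg2 measurable_const
  · dsimp only
    split_ifs with h
    · exact h
    · simp
  · filter_upwards [hg3, ae_norm_entry_le hA] with p h1 h2
    have h3 := h2 i j
    rw [h1] at h3
    rw [if_pos h3, h1]

end Coefficients

/-! ### Assembling the slices of the matrix -/

section Assembly

open FourierTransform

variable {n : ℕ}

/-- The integrand of `compKernel` on the half-space. -/
def compIntegrand (a : Eu n → ℝ → ℂ) (P Q : Eu n → ℂ) (x x' z : Eu n) (y : ℝ) : ℂ :=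
  ((2 * y * ((y ^ (n + 1))⁻¹) ^ 2 : ℝ) : ℂ) *
    (a z y * (P (y⁻¹ • (z - x')) * Q (y⁻¹ • (z - x))))

lemma integral_compIntegrand (a : Eu n → ℝ → ℂ) (P Q : Eu n → ℂ) (x x' : Eu n) (y : ℝ) :
    ∫ z, compIntegrand a P Q x x' z y = compKernel a P Q y x x' :=
  integral_const_mul _ _

lemma integrable_compIntegrand_slice {a : Eu n → ℝ → ℂ} {M δ : ℝ} {P Q : Eu n → ℂ}
    (hm : Measurable (fun p : Eu n × ℝ => a p.1 p.2)) (ha : ∀ x y, ‖a x y‖ ≤ M) (hδ : 0 < δ)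
    (hP : IsProfile P δ) (hQ : IsProfile Q δ) {y : ℝ} (hy : 0 < y) (x x' : Eu n) :
    Integrable (fun z => compIntegrand a P Q x x' z y) :=
  (integrable_compKernel_integrand hm ha (by linarith) hP.decay hQ.decay hP.continuous
    hQ.continuous hy x x').const_mul _

lemma integrable_compIntegrand {a : Eu n → ℝ → ℂ} {M δ : ℝ} {P Q : Eu n → ℂ} (hn : 1 ≤ n)
    (hm : Measurable (fun p : Eu n × ℝ => a p.1 p.2)) (ha : ∀ x y, ‖a x y‖ ≤ M) (hδ : 0 < δ)
    (hP : IsProfile P δ) (hQ : IsProfile Q δ) {x x' : Eu n} (hx : x ≠ x') :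
    Integrable (fun p : Eu n × ℝ => compIntegrand a P Q x x' p.1 p.2) (halfMeasure n) := by
  have hmeas : Measurable (fun p : Eu n × ℝ => compIntegrand a P Q x x' p.1 p.2) := by
    have h1 := hP.continuous.measurable
    have h2 := hQ.continuous.measurable
    unfold compIntegrand
    refine Measurable.mul (by fun_prop) (hm.mul (Measurable.mul ?_ ?_))
    · exact h1.comp (by fun_prop)
    · exact h2.comp (by fun_prop)
  obtain ⟨C, -, hC⟩ := exists_size_compKernel hδ hP.decay hQ.decay
  rw [halfMeasure, integrable_prod_iff' hmeas.aestronglyMeasurable]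
  have hpos : ∀ᵐ y ∂(volume.restrict (Ioi (0 : ℝ))), 0 < y := ae_restrict_mem measurableSet_Ioi
  refine ⟨hpos.mono fun y hy => integrable_compIntegrand_slice hm ha hδ hP hQ hy x x', ?_⟩
  refine ((integrableOn_prof (m := n) (r := ‖x - x'‖) (by exact_mod_cast hn) hδ
    (norm_pos_iff.2 (sub_ne_zero.2 hx))).1.const_mul (C * M)).mono' ?_ (hpos.mono fun y hy => ?_)
  · exact (hmeas.norm.stronglyMeasurable.comp_measurable
      measurable_swap).integral_prod_right'.aestronglyMeasurable
  · rw [Real.norm_of_nonneg (integral_nonneg fun z => norm_nonneg _)]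
    refine le_trans (le_of_eq ?_) (hC a M ha y hy x x').2
    rw [← integral_const_mul]
    refine integral_congr_ae (.of_forall fun z => ?_)
    simp only [compIntegrand]
    rw [norm_mul, Complex.norm_real, Real.norm_of_nonneg (by positivity)]

/-- The coefficients admitted at position `(i, j)`. -/
def IsAdmissible (i j : Fin (n + 1)) (a : Eu n → ℝ → ℂ) : Prop :=
  (i = Fin.last n ∨ j = Fin.last n) → ∀ x x' y, a x y = a x' y

lemma isProfile_stableProfile {α : ℝ} (hα : 0 < α) (hα2 : α ≤ 2) (i : Fin (n + 1)) :
    IsProfile (stableProfile n α i) α :=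
  (isStableProfile_stableProfile α i).isProfile (by positivity) hα hα2

/-- The two routes to the gradient bound meet here: the correlation if an index is last,
differentiation of the profiles otherwise. The column index `j` goes with `x'`, the gradient to
which the matrix is applied, and the row index `i` with `x`. -/
lemma exists_isCZSlices_stableProfile {α : ℝ} (hα : 0 < α) (hα2 : α ≤ 2) (i j : Fin (n + 1)) :
    ∃ C, 0 ≤ C ∧ ∀ (a : Eu n → ℝ → ℂ) (M : ℝ), IsAdmissible i j a →
      Measurable (fun p : Eu n × ℝ => a p.1 p.2) → (∀ x y, ‖a x y‖ ≤ M) →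
      IsCZSlices (compKernel a (stableProfile n α j) (stableProfile n α i)) (C * M) α := by
  refine exists_isCZSlices_compKernel hα (isProfile_stableProfile hα hα2 j)
    (isProfile_stableProfile hα hα2 i) ?_
  by_cases hij : i = Fin.last n ∨ j = Fin.last n
  · obtain ⟨C, hC, h⟩ := (isStableProfile_stableProfile α j).hasGradBound (by positivity) hα hα2
      (isStableProfile_stableProfile α i)
    exact ⟨C, hC, fun a M ha => h a M (ha hij)⟩
  · push Not at hij
    obtain ⟨C, hC, h⟩ := hasGradBound_stableProfile hα hα2 hij.2 hij.1
    exact ⟨C, hC, fun a M _ => h a M trivial⟩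

lemma kernelIntegrand_eq_sum {φ : Eu n → ℝ} {Φ : Fin (n + 1) → Eu n → ℂ} {y : ℝ}
    (hφ : ∀ x i, fullGrad φ y x i = (((y ^ (n + 1))⁻¹ : ℝ) : ℂ) * Φ i (y⁻¹ • x))
    {A : Eu n → ℝ → Matrix (Fin (n + 1)) (Fin (n + 1)) ℂ} {a : Fin (n + 1) → Fin (n + 1) →
      Eu n → ℝ → ℂ} {z : Eu n} (hA : ∀ i j, A z y i j = a i j z y) (x x' : Eu n) :
    kernelIntegrand φ A x x' z y = ∑ p : Fin (n + 1) × Fin (n + 1),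
      compIntegrand (a p.1 p.2) (Φ p.2) (Φ p.1) x x' z y := by
  rw [Fintype.sum_prod_type, kernelIntegrand, dotProduct, Finset.mul_sum]
  refine Finset.sum_congr rfl fun i _ => ?_
  rw [Matrix.mulVec, dotProduct, Finset.sum_mul, Finset.mul_sum]
  refine Finset.sum_congr rfl fun j _ => ?_
  rw [hφ, hφ, hA, compIntegrand]
  push_cast
  ring

end Assembly

end StableCZ

end

/-! ### The theorem -/

theorem theorem1p1 (n : ℕ) (hn : 1 ≤ n) (α : ℝ) (hα0 : 0 < α) (hα2 : α ≤ 2) :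
    ∃ C : ℝ, ∀ {Ω : Type*} [MeasurableSpace Ω] (P : Measure Ω) [IsProbabilityMeasure P]
      (X : ℝ≥0 → Ω → EuclideanSpace ℝ (Fin n)) (_ : StableCZ.IsRotInvStable α X P)
      (φ : EuclideanSpace ℝ (Fin n) → ℝ) (_ : StableCZ.IsContDensity φ (X 1) P)
      (A : EuclideanSpace ℝ (Fin n) → ℝ → Matrix (Fin (n + 1)) (Fin (n + 1)) ℂ)
      (_ : ∀ i j, AEMeasurable (fun p : EuclideanSpace ℝ (Fin n) × ℝ => A p.1 p.2 i j)
        (StableCZ.halfMeasure n))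
      (_ : StableCZ.coeffNorm A < ∞)
      (_ : ∀ i j, (i = Fin.last n ∨ j = Fin.last n) →
        ∀ y, 0 < y → ∀ x x', A x y i j = A x' y i j),
      -- the integral that defines the kernel converges absolutely off the diagonal
      (∀ x x', x ≠ x' → Integrable (fun p : EuclideanSpace ℝ (Fin n) × ℝ =>
        StableCZ.kernelIntegrand φ A x x' p.1 p.2) (StableCZ.halfMeasure n)) ∧
      -- the iterated integrals that define the operator converge absolutely
      (∀ᵐ y ∂(volume.restrict (Ioi (0 : ℝ))), ∀ x x',
        Integrable (fun xbar => StableCZ.kernelIntegrand φ A x x' xbar y)) ∧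
      (∀ᵐ y ∂(volume.restrict (Ioi (0 : ℝ))), ∀ (f : 𝓢(EuclideanSpace ℝ (Fin n), ℂ)) (x),
        Integrable (fun x' => StableCZ.sliceKernel φ A y x x' * f x')) ∧
      (∀ (f : 𝓢(EuclideanSpace ℝ (Fin n), ℂ)) (x),
        IntegrableOn (fun y => ∫ x', StableCZ.sliceKernel φ A y x x' * f x') (Ioi (0 : ℝ))) ∧
      StableCZ.IsCZOperator (StableCZ.opT φ A) (StableCZ.kernelK φ A)
        (C * (StableCZ.coeffNorm A).toReal) := by
  classical
  choose C hC0 hC using fun p : Fin (n + 1) × Fin (n + 1) =>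
    StableCZ.exists_isCZSlices_stableProfile (n := n) hα0 hα2 p.1 p.2
  -- Fixed before the process, the density and the matrix are introduced: one slice constant for
  -- each matrix position, and `δ = α` throughout.
  refine ⟨StableCZ.IsCZSlices.sliceConst n α * ∑ p, C p, ?_⟩
  intro Ω _ P _ X hX φ hφ A hAm hAfin hAconst
  choose a ha_adm ha_meas ha_bound ha_eq using fun p : Fin (n + 1) × Fin (n + 1) =>
    StableCZ.exists_coeff_version hAm hAfin hAconst p.1 p.2
  set M := (StableCZ.coeffNorm A).toReal with hM
  set Φ := StableCZ.stableProfile n α with hΦ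
  have hprof : ∀ i, StableCZ.IsProfile (Φ i) α := StableCZ.isProfile_stableProfile hα0 hα2
  have hgrad : ∀ y, 0 < y → ∀ x i, StableCZ.fullGrad φ y x i =
      (((y ^ (n + 1))⁻¹ : ℝ) : ℂ) * Φ i (y⁻¹ • x) := fun y hy x i =>
    StableCZ.fullGrad_eq hα0 (StableCZ.density_eq_fourierInv hα0 hX hφ) hy x i
  have hk := StableCZ.IsCZSlices.sum Finset.univ hα0 fun p _ =>
    hC p (a p) M (ha_adm p) (ha_meas p) (ha_bound p)
  set k : ℝ → EuclideanSpace ℝ (Fin n) → EuclideanSpace ℝ (Fin n) → ℂ := fun y x x' =>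
    ∑ p : Fin (n + 1) × Fin (n + 1), StableCZ.compKernel (a p) (Φ p.2) (Φ p.1) y x x' with hkdef
  have hpos : ∀ᵐ y ∂(volume.restrict (Ioi (0 : ℝ))), 0 < y := ae_restrict_mem measurableSet_Ioi
  have hAa : ∀ᵐ q ∂StableCZ.halfMeasure n, ∀ i j, A q.1 q.2 i j = a (i, j) q.1 q.2 :=
    ae_all_iff.2 fun i => ae_all_iff.2 fun j => ha_eq (i, j)
  -- The null set where `A` differs from its versions lies in `(x̄, y)` and does not involve `x` or
  -- `x'`. One null set of heights therefore serves all pairs, so the kernel and the operator agree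
  -- with those of the versions at every point.
  have h_int : ∀ᵐ y ∂(volume.restrict (Ioi (0 : ℝ))), ∀ x x',
      (fun xbar => StableCZ.kernelIntegrand φ A x x' xbar y) =ᵐ[volume] fun xbar =>
        ∑ p : Fin (n + 1) × Fin (n + 1),
          StableCZ.compIntegrand (a p) (Φ p.2) (Φ p.1) x x' xbar y := by
    filter_upwards [hpos, StableCZ.ae_slice_of_ae_half hAa] with y hy hyA x x'
    filter_upwards [hyA] with z hz
    exact StableCZ.kernelIntegrand_eq_sum (hgrad y hy) (a := fun i j => a (i, j)) hz x x'
  have hcomp : ∀ y, 0 < y → ∀ x x' (p : Fin (n + 1) × Fin (n + 1)), Integrable fun xbar =>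
      StableCZ.compIntegrand (a p) (Φ p.2) (Φ p.1) x x' xbar y := fun y hy x x' p =>
    StableCZ.integrable_compIntegrand_slice (ha_meas p) (ha_bound p) hα0 (hprof _) (hprof _) hy x x'
  have hslice : ∀ᵐ y ∂(volume.restrict (Ioi (0 : ℝ))), ∀ x x',
      StableCZ.sliceKernel φ A y x x' = k y x x' := by
    filter_upwards [hpos, h_int] with y hy hy2 x x'
    rw [StableCZ.sliceKernel, integral_congr_ae (hy2 x x'),
      integral_finsetSum _ fun p _ => hcomp y hy x x' p]
    simp only [StableCZ.integral_compIntegrand, hkdef]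
  have hop : StableCZ.opT φ A = StableCZ.IsCZSlices.sliceOp k := by
    funext f x
    refine integral_congr_ae (hslice.mono fun y hy => ?_)
    simp only [hy]
  have hker : StableCZ.kernelK φ A = fun x x' => ∫ y in Ioi (0 : ℝ), k y x x' := by
    funext x x'
    exact integral_congr_ae (hslice.mono fun y hy => hy x x')
  refine ⟨fun x x' hx => ?_, ?_, ?_, fun f x => ?_, ?_⟩
  · refine (integrable_finsetSum Finset.univ
      fun (p : Fin (n + 1) × Fin (n + 1)) _ => StableCZ.integrable_compIntegrand hn (ha_meas p)
        (ha_bound p) hα0 (hprof p.2) (hprof p.1) hx).congr ?_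
    filter_upwards [StableCZ.ae_half_height_pos, hAa] with q hq hqA
    exact (StableCZ.kernelIntegrand_eq_sum (hgrad q.2 hq) (a := fun i j => a (i, j)) hqA
      x x').symm
  · filter_upwards [hpos, h_int] with y hy hy2 x x'
    exact (integrable_finsetSum _ fun p _ => hcomp y hy x x' p).congr (hy2 x x').symm
  · filter_upwards [hpos, hslice] with y hy hy2 f x
    simp only [hy2]
    exact hk.integrable_mul hα0 hy x f.integrable
  · refine (hk.integrableOn_slice_integral hn hα0 hα2 f x).congr (hslice.mono fun y hy => ?_)
    simp only [hy]
  · rw [hop, hker, mul_assoc, Finset.sum_mul]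
    exact hk.isCZOperator hn hα0 hα2
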